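/- All sequences $\alpha=(\alpha_1,\alpha_2,\dots)$, $\beta=(\beta_1,\beta_2,\dots)$ are sequences of non-negative integers with finite support; $|\beta|=\sum_j\beta_j$ and $\beta!=\prod_j\beta_j!$; vectors are extended by zeros to sequences. A *floor diagram* $\mathcal D$ of degree $d$ is a directed multigraph on the vertices $1,\dots,d$ with positive integer edge weights $w(e)$ (considered up to isomorphisms fixing the vertices) such that every edge $i\to j$ has $i<j$ and, for each vertex $j$, $\operatorname{div}(j):=\sum_{j\to k}w-\sum_{i\to j}w\le 1$. Its multiplicity is $\mu(\mathcal D)=\prod_e w(e)^2$. A connected component of degree $d'$ (number of vertices) and genus $g$ (first Betti number) has cogenus $\frac{(d'-1)(d'-2)}2-g$. If the components have degrees $d_1,d_2,\dots$ and cogenera $\delta_1,\delta_2,\dots$, then $\mathcal D$ has cogenus $\sum_j\delta_j+\sum_{j<j'}d_jd_{j'}$. Let $\mathcal D$ have degree $d=\sum_j j(\alpha_j+\beta_j)$. An *$(\alpha,\beta)$-marking* of $\mathcal D$ is obtained as follows. Choose sequences $\alpha^i,\beta^i$ for the vertices $i$ of $\mathcal D$ with $\sum_i\alpha^i=\alpha$,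 $\sum_i\beta^i=\beta$ and $\sum_j j(\alpha^i_j+\beta^i_j)=1-\operatorname{div}(i)$ for all $i$. For all $i$ and $j$ attach to $i$, by edges of weight $j$ directed away from $i$, $\beta^i_j$ new vertices ("$\beta$-vertices") and $\alpha^i_j$ new vertices ("$\alpha$-vertices"), and subdivide each edge of $\mathcal D$ by a new vertex, both halves keeping its weight and direction. Finally choose a linear order on all vertices that extends the order of $1,\dots,d$, such that every edge goes from a smaller to a larger vertex, the $\alpha$-vertices are larger than all other vertices, and the weights of the edges at the $\alpha$-vertices are weakly increasing in this order. Two markings are equivalent if there is an isomorphism of weighted directed graphs between them that fixes the vertices of $\mathcal D$ and preserves the linear orders; $\nu_{\alpha,\beta}(\mathcal D)$ is the number of markings up to equivalence. Let $$N^\delta_{\alpha,\beta}=\sum_{\mathcal D}1^{\beta_1}2^{\beta_2}\cdots\,\mu(\mathcal D)\,\nu_{\alpha,\beta}(\mathcal D),$$ the sum being over all floor diagrams $\mathcal D$ of degree $\sum_j j(\alpha_j+\beta_j)$ and cogenus $\delta$, be the relative Severi degree, in its combinatorial description by floor diagrams. **Theorem.** Let $\delta\ge 1$. For all $m\ge0$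 and $m'\ge1$ there is exactly one polynomial $N_\delta(\alpha;\beta)=N_\delta(\alpha_1,\dots,\alpha_m;\beta_1,\dots,\beta_{m'})$ with rational coefficients (the *relative node polynomial*) such that $$N^\delta_{\alpha,\beta}=1^{\beta_1}2^{\beta_2}\cdots\frac{(|\beta|-\delta)!}{\beta!}\,N_\delta(\alpha;\beta)$$ for all vectors $\alpha\in\mathbb Z_{\ge0}^m$, $\beta\in\mathbb Z_{\ge0}^{m'}$ with $|\beta|\ge\delta$. These polynomials satisfy the polynomial identities $$N_\delta(\alpha,0;\beta)=N_\delta(\alpha;\beta)\quad\text{and}\quad N_\delta(\alpha;\beta,0)=N_\delta(\alpha;\beta).$$ Moreover there is a formal power series $N^\infty_\delta(\alpha;\beta)$ with rational coefficients in the infinitely many variables $\alpha_1,\alpha_2,\dots,\beta_1,\beta_2,\dots$ which, for all $m\ge0$ and $m'\ge1$, specializes to $N_\delta(\alpha_1,\dots,\alpha_m;\beta_1,\dots,\beta_{m'})$ under $\alpha_{m+1}=\alpha_{m+2}=\dots=0$ and $\beta_{m'+1}=\beta_{m'+2}=\dots=0$. -/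

import Mathlib

/-! Sequences `α = (α₁, α₂, …)` of non-negative integers with finite support are finitely supported
functions `ℕ+ →₀ ℕ`. -/

/-- `∑_{j ≥ 1} j * a_j`. -/
def seqDegree (a : ℕ+ →₀ ℕ) : ℕ := a.sum fun j k => (j : ℕ) * k

/-- The divergence of the vertex `j` with respect to a multiset of weighted edges
`(source, target, weight)`: the total weight of the outgoing edges minus the total weight of the
incoming edges. -/
def edgeDivergence {d : ℕ} (E : Multiset (Fin d × Fin d × ℕ+)) (j : Fin d) : ℤ :=
  ((E.filter fun e => e.1 = j).map fun e => ((e.2.2 : ℕ) : ℤ)).sum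
    - ((E.filter fun e => e.2.1 = j).map fun e => ((e.2.2 : ℕ) : ℤ)).sum

/-- A floor diagram on the vertices `1, …, d` (here `Fin d`): a directed multigraph with positive
integer edge weights. It is given by the multiset of its weighted edges `(source, target, weight)`,
so that two floor diagrams are equal iff they are isomorphic by an isomorphism fixing every
vertex. -/
@[ext]
structure FloorDiagram (d : ℕ) where
  edges : Multiset (Fin d × Fin d × ℕ+)
  source_lt_target : ∀ e ∈ edges, e.1 < e.2.1
  div_le_one : ∀ j, edgeDivergence edges j ≤ 1

namespace FloorDiagram

variable {d : ℕ} (D : FloorDiagram d)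

/-- The divergence of a vertex. -/
def div (j : Fin d) : ℤ := edgeDivergence D.edges j

/-- The multiplicity: the product of the squares of the edge weights. -/
def multiplicity : ℕ := (D.edges.map fun e => (e.2.2 : ℕ) ^ 2).prod

/-- The underlying simple graph; it has the same connected components. -/
def graph : SimpleGraph (Fin d) :=
  SimpleGraph.fromRel fun i j => ∃ w : ℕ+, (i, j, w) ∈ D.edges

/-- The degree (number of vertices) of a connected component. -/
noncomputable def componentDegree (c : D.graph.ConnectedComponent) : ℕ := c.supp.ncard

/-- The number of edges of a connected component, counted with multiplicity. -/
noncomputable def componentEdges (c : D.graph.ConnectedComponent) : ℕ :=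
  open Classical in (D.edges.filter fun e => e.1 ∈ c.supp).card

/-- The genus (first Betti number) of a connected component. -/
noncomputable def componentGenus (c : D.graph.ConnectedComponent) : ℤ :=
  D.componentEdges c - D.componentDegree c + 1

/-- The cogenus `(d - 1)(d - 2)/2 - g` of a connected component of degree `d` and genus `g`. -/
noncomputable def componentCogenus (c : D.graph.ConnectedComponent) : ℤ :=
  ((D.componentDegree c : ℤ) - 1) * ((D.componentDegree c : ℤ) - 2) / 2 - D.componentGenus c

open Classical in
/-- The cogenus: the sum of the cogenera of the connected components plus the sum of the products of
the degrees of any two different connected components. -/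
noncomputable def cogenus : ℤ :=
  ∑ c : D.graph.ConnectedComponent, D.componentCogenus c
    + ∑ s ∈ (Finset.univ : Finset D.graph.ConnectedComponent).powersetCard 2,
        ∏ c ∈ s, (D.componentDegree c : ℤ)

/-- A pair of collections of sequences, indexed by the vertices of `D`, that is compatible with `D`
and `(α, β)`. -/
structure Compatible (α β : ℕ+ →₀ ℕ) where
  a : Fin d → ℕ+ →₀ ℕ
  b : Fin d → ℕ+ →₀ ℕ
  sum_a : ∑ i, a i = α
  sum_b : ∑ i, b i = β
  degree_eq : ∀ i, (seqDegree (a i) + seqDegree (b i) : ℤ) = 1 - D.div i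

namespace Compatible

variable {D} {α β : ℕ+ →₀ ℕ} (C : D.Compatible α β)

/-- The vertices of the extended graph: the vertices of `D`; one midpoint for each edge of `D`;
and, for each vertex `i` of `D` and each `j ≥ 1`, `b i j` `β`-vertices and `a i j` `α`-vertices. -/
inductive Vertex where
  | floor (i : Fin d)
  | mid (e : D.edges)
  | beta (i : Fin d) (j : ℕ+) (k : Fin (C.b i j))
  | alpha (i : Fin d) (j : ℕ+) (k : Fin (C.a i j))

/-- `C.Edge u v w`: the extended graph has an edge `u → v`, of weight `w`. Each edge of `D` is
subdivided by its midpoint, and the `α`- and `β`-vertices made for `i` and `j` are joined to `i`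
by an edge of weight `j` directed away from `i`. There are no multiple edges. -/
inductive Edge : C.Vertex → C.Vertex → ℕ+ → Prop where
  | toMid (e : D.edges) : Edge (.floor e.1.1) (.mid e) e.1.2.2
  | fromMid (e : D.edges) : Edge (.mid e) (.floor e.1.2.1) e.1.2.2
  | beta (i : Fin d) (j : ℕ+) (k : Fin (C.b i j)) : Edge (.floor i) (.beta i j k) j
  | alpha (i : Fin d) (j : ℕ+) (k : Fin (C.a i j)) : Edge (.floor i) (.alpha i j k) j

/-- Being an `α`-vertex. -/
def Vertex.IsAlpha {C : D.Compatible α β} : C.Vertex → Prop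
  | .alpha _ _ _ => True
  | _ => False

end Compatible

/-- An `(α, β)`-marking of `D`: the extended graph of a compatible pair of collections, with a
(strict) linear order `lt` on its vertices. -/
structure Marking (α β : ℕ+ →₀ ℕ) where
  C : D.Compatible α β
  lt : C.Vertex → C.Vertex → Prop
  isStrictTotalOrder : IsStrictTotalOrder C.Vertex lt
  /-- The order extends the order of the vertices of `D`. -/
  lt_floor : ∀ i j : Fin d, i < j → lt (.floor i) (.floor j)
  /-- Edges are directed from smaller to larger vertices. -/
  lt_edge : ∀ u v w, C.Edge u v w → lt u v
  /-- The `α`-vertices are largest. -/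
  lt_alpha : ∀ u v : C.Vertex, ¬ u.IsAlpha → v.IsAlpha → lt u v
  /-- Larger `α`-vertices have adjacent edges of larger or equal weight. -/
  alpha_weight : ∀ i j k i' j' k', lt (.alpha i j k) (.alpha i' j' k') → j ≤ j'

/-- Two markings are equivalent if there is an isomorphism of weighted directed graphs between the
extended graphs that fixes the vertices of `D` and carries one linear order to the other. -/
def Marking.Equivalent {D : FloorDiagram d} {α β : ℕ+ →₀ ℕ} (M₁ M₂ : D.Marking α β) : Prop :=
  ∃ φ : M₁.C.Vertex ≃ M₂.C.Vertex,
    (∀ i, φ (.floor i) = .floor i) ∧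
    (∀ u v w, M₁.C.Edge u v w ↔ M₂.C.Edge (φ u) (φ v) w) ∧
    (∀ u v, M₁.lt u v ↔ M₂.lt (φ u) (φ v))

/-- Equivalence of `(α, β)`-markings as a setoid. -/
def markingSetoid (α β : ℕ+ →₀ ℕ) : Setoid (D.Marking α β) where
  r := Marking.Equivalent
  iseqv :=
    { refl := fun _ => ⟨Equiv.refl _, fun _ => rfl, fun _ _ _ => Iff.rfl, fun _ _ => Iff.rfl⟩
      symm := by
        rintro M₁ M₂ ⟨φ, h₁, h₂, h₃⟩
        refine ⟨φ.symm, fun i => ?_, fun u v w => ?_, fun u v => ?_⟩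
        · rw [Equiv.symm_apply_eq, h₁]
        · rw [h₂, Equiv.apply_symm_apply, Equiv.apply_symm_apply]
        · rw [h₃, Equiv.apply_symm_apply, Equiv.apply_symm_apply]
      trans := by
        rintro M₁ M₂ M₃ ⟨φ, h₁, h₂, h₃⟩ ⟨ψ, k₁, k₂, k₃⟩
        refine ⟨φ.trans ψ, fun i => ?_, fun u v w => ?_, fun u v => ?_⟩
        · rw [Equiv.trans_apply, h₁, k₁]
        · exact (h₂ u v w).trans (k₂ _ _ _)
        · exact (h₃ u v).trans (k₃ _ _) }

/-- The number of `(α, β)`-markings of `D` up to equivalence. -/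
noncomputable def numMarkings (α β : ℕ+ →₀ ℕ) : ℕ := Nat.card (Quotient (D.markingSetoid α β))

end FloorDiagram

/-- The relative Severi degree `N^δ_{α,β}` as a weighted count of floor diagrams: the sum of
`(∏ j^{β_j}) * μ(D) * ν_{α,β}(D)` over the (finitely many) floor diagrams `D` of degree
`∑ j (α_j + β_j)` and cogenus `δ`. -/
noncomputable def relativeSeveriDegree (δ : ℕ) (α β : ℕ+ →₀ ℕ) : ℕ :=
  ∑ᶠ (D : FloorDiagram (seqDegree α + seqDegree β)) (_ : D.cogenus = δ),
    (β.prod fun j k => (j : ℕ) ^ k) * D.multiplicity * D.numMarkings α β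

/-- The sequence `(a₁, …, a_m, 0, 0, …)`; the entry `a_{i+1}` is `a i` for `i : Fin m`. -/
noncomputable def toSeq {m : ℕ} (a : Fin m → ℕ) : ℕ+ →₀ ℕ :=
  ∑ i : Fin m, Finsupp.single (Nat.succPNat (i : ℕ)) (a i)

/-- `P`, a polynomial in `α₁, …, α_m` (the variables `Sum.inl i`) and `β₁, …, β_{m'}` (the variables
`Sum.inr j`), is a relative node polynomial for `δ` in `m + m'` variables: whenever `|β| ≥ δ`,
`N^δ_{α,β} = 1^{β₁} 2^{β₂} ⋯ (|β| - δ)! / β! * P(α; β)`. -/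
def IsRelativeNodePolynomial (δ m m' : ℕ) (P : MvPolynomial (Fin m ⊕ Fin m') ℚ) : Prop :=
  ∀ (α : Fin m → ℕ) (β : Fin m' → ℕ), δ ≤ ∑ j, β j →
    (relativeSeveriDegree δ (toSeq α) (toSeq β) : ℚ) =
      (∏ j : Fin m', ((j : ℚ) + 1) ^ β j)
        * ((Nat.factorial (∑ j, β j - δ) : ℚ) / ∏ j, (Nat.factorial (β j) : ℚ))
        * MvPolynomial.eval (Sum.elim (fun i => (α i : ℚ)) fun j => (β j : ℚ)) P

open Classical in
/-- The relative node polynomial `N_δ(α₁, …, α_m; β₁, …, β_{m'})`. -/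
noncomputable def relativeNodePolynomial (δ m m' : ℕ) : MvPolynomial (Fin m ⊕ Fin m') ℚ :=
  if h : ∃ P, IsRelativeNodePolynomial δ m m' P then h.choose else 0

/-- The substitution `α_{m+1} = 0` in a polynomial in `α₁, …, α_{m+1}; β₁, …, β_{m'}`. -/
noncomputable def setLastAlphaZero (m m' : ℕ) :
    MvPolynomial (Fin (m + 1) ⊕ Fin m') ℚ →ₐ[ℚ] MvPolynomial (Fin m ⊕ Fin m') ℚ :=
  MvPolynomial.aeval (Sum.elim
    (Fin.snoc (α := fun _ => MvPolynomial (Fin m ⊕ Fin m') ℚ)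
      (fun i => MvPolynomial.X (Sum.inl i)) 0)
    (fun j => MvPolynomial.X (Sum.inr j)))

/-- The substitution `β_{m'+1} = 0` in a polynomial in `α₁, …, α_m; β₁, …, β_{m'+1}`. -/
noncomputable def setLastBetaZero (m m' : ℕ) :
    MvPolynomial (Fin m ⊕ Fin (m' + 1)) ℚ →ₐ[ℚ] MvPolynomial (Fin m ⊕ Fin m') ℚ :=
  MvPolynomial.aeval (Sum.elim
    (fun i => MvPolynomial.X (Sum.inl i))
    (Fin.snoc (α := fun _ => MvPolynomial (Fin m ⊕ Fin m') ℚ)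
      (fun j => MvPolynomial.X (Sum.inr j)) 0))

/-- The variables `α₁, …, α_m, β₁, …, β_{m'}` among `α₁, α₂, …, β₁, β₂, …`. -/
def initialVariables (m m' : ℕ) : Fin m ⊕ Fin m' ↪ ℕ+ ⊕ ℕ+ :=
  Function.Embedding.sumMap
    ⟨fun i => Nat.succPNat i, fun _ _ h => Fin.ext (Nat.succPNat_injective h)⟩
    ⟨fun j => Nat.succPNat j, fun _ _ h => Fin.ext (Nat.succPNat_injective h)⟩

open Finset

namespace RelativeSeveri

/-! ### Sums of polynomials and finite sets of lists -/

theorem exists_polynomial_sum_range (q : Polynomial ℚ) :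
    ∃ S : Polynomial ℚ, ∀ n : ℕ, S.eval (n : ℚ) = ∑ k ∈ range n, q.eval (k : ℚ) := by
  induction q using Polynomial.induction_on' with
  | add p q hp hq =>
    obtain ⟨S, hS⟩ := hp
    obtain ⟨T, hT⟩ := hq
    exact ⟨S + T, fun n => by simp [hS, hT, Finset.sum_add_distrib]⟩
  | monomial p a =>
    refine ⟨Polynomial.C a * ∑ i ∈ range (p + 1),
      Polynomial.C (bernoulli i * ((p + 1).choose i) / (p + 1)) * Polynomial.X ^ (p + 1 - i),
      fun n => ?_⟩
    simp only [Polynomial.eval_mul, Polynomial.eval_C, Polynomial.eval_monomial,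
      ← Finset.mul_sum, sum_range_pow, Polynomial.eval_finsetSum, Polynomial.eval_pow,
      Polynomial.eval_X]
    congr 1
    refine Finset.sum_congr rfl fun i _ => ?_
    ring

/-- `f` agrees with a polynomial from `T` on. -/
def PolyFrom (T : ℕ) (f : ℕ → ℚ) : Prop :=
  ∃ p : Polynomial ℚ, ∀ n, T ≤ n → f n = p.eval (n : ℚ)

theorem PolyFrom.of_eq {T : ℕ} {f g : ℕ → ℚ} (hg : PolyFrom T g) (h : ∀ n, T ≤ n → f n = g n) :
    PolyFrom T f := by
  obtain ⟨p, hp⟩ := hg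
  exact ⟨p, fun n hn => (h n hn).trans (hp n hn)⟩

theorem PolyFrom.const (T : ℕ) (a : ℚ) : PolyFrom T fun _ => a :=
  ⟨Polynomial.C a, fun _ _ => by simp⟩

theorem PolyFrom.add {T : ℕ} {f g : ℕ → ℚ} (hf : PolyFrom T f) (hg : PolyFrom T g) :
    PolyFrom T fun n => f n + g n := by
  obtain ⟨p, hp⟩ := hf
  obtain ⟨q, hq⟩ := hg
  exact ⟨p + q, fun n hn => by simp [hp n hn, hq n hn]⟩

theorem PolyFrom.sub {T : ℕ} {f g : ℕ → ℚ} (hf : PolyFrom T f) (hg : PolyFrom T g) :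
    PolyFrom T fun n => f n - g n := by
  obtain ⟨p, hp⟩ := hf
  obtain ⟨q, hq⟩ := hg
  exact ⟨p - q, fun n hn => by simp [hp n hn, hq n hn]⟩

theorem PolyFrom.mul {T : ℕ} {f g : ℕ → ℚ} (hf : PolyFrom T f) (hg : PolyFrom T g) :
    PolyFrom T fun n => f n * g n := by
  obtain ⟨p, hp⟩ := hf
  obtain ⟨q, hq⟩ := hg
  exact ⟨p * q, fun n hn => by simp [hp n hn, hq n hn]⟩

theorem PolyFrom.sum {ι : Type*} {T : ℕ} (s : Finset ι) {f : ι → ℕ → ℚ}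
    (hf : ∀ i ∈ s, PolyFrom T (f i)) : PolyFrom T fun n => ∑ i ∈ s, f i n := by
  classical
  induction s using Finset.induction_on with
  | empty => simpa using PolyFrom.const T 0
  | insert a s ha ih =>
    simp only [Finset.sum_insert ha]
    exact (hf a (by simp)).add (ih fun i hi => hf i (by simp [hi]))

theorem PolyFrom.prod {ι : Type*} {T : ℕ} (s : Finset ι) {f : ι → ℕ → ℚ}
    (hf : ∀ i ∈ s, PolyFrom T (f i)) : PolyFrom T fun n => ∏ i ∈ s, f i n := by
  classical
  induction s using Finset.induction_on with
  | empty => simpa using PolyFrom.const T 1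
  | insert a s ha ih =>
    simp only [Finset.prod_insert ha]
    exact (hf a (by simp)).mul (ih fun i hi => hf i (by simp [hi]))

/-- Translating the argument of a function that is a polynomial from `S` on. -/
theorem PolyFrom.comp_sub {S T l : ℕ} {f : ℕ → ℚ} (hf : PolyFrom S f) (hl : l ≤ T)
    (h : S + l ≤ T) : PolyFrom T fun n => f (n - l) := by
  obtain ⟨p, hp⟩ := hf
  refine ⟨p.comp (Polynomial.X - Polynomial.C (l : ℚ)), fun n hn => ?_⟩
  change f (n - l) = _
  rw [hp (n - l) (by omega), Nat.cast_sub (hl.trans hn)]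
  simp

theorem PolyFrom.of_diff {T : ℕ} {f g : ℕ → ℚ} (hg : PolyFrom (T + 1) g)
    (h : ∀ n, T < n → f n = f (n - 1) + g n) : PolyFrom T f := by
  obtain ⟨q, hq⟩ := hg
  obtain ⟨S, hS⟩ := exists_polynomial_sum_range (q.comp (Polynomial.X + Polynomial.C ((T : ℚ) + 1)))
  refine ⟨Polynomial.C (f T) + S.comp (Polynomial.X - Polynomial.C (T : ℚ)), fun n hn => ?_⟩
  obtain ⟨k, rfl⟩ := Nat.exists_eq_add_of_le hn
  clear hn
  have : ∀ k : ℕ, f (T + k) = f T + ∑ i ∈ range k, q.eval ((i : ℚ) + (T + 1)) := by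
    intro k
    induction k with
    | zero => simp
    | succ k ih =>
      rw [Finset.sum_range_succ, ← add_assoc (f T), ← ih, ← add_assoc T k 1, h _ (by omega), hq _ (by omega)]
      congr 2
      push_cast
      ring
  rw [this]
  simp only [Polynomial.eval_add, Polynomial.eval_C, Polynomial.eval_comp, Polynomial.eval_sub,
    Polynomial.eval_X]
  have h2 := hS k
  simp only [Polynomial.eval_comp, Polynomial.eval_add, Polynomial.eval_X, Polynomial.eval_C] at h2
  push_cast
  rw [add_sub_cancel_left, h2]

theorem finite_lists {α : Type*} {S : Set α} (hS : S.Finite) (n : ℕ) :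
    {l : List α | l.length ≤ n ∧ ∀ x ∈ l, x ∈ S}.Finite := by
  have : Finite S := hS
  refine ((List.finite_length_le S n).image (List.map Subtype.val)).subset ?_
  rintro l ⟨h₁, h₂⟩
  refine ⟨l.pmap Subtype.mk h₂, by simpa using h₁, ?_⟩
  simp [List.map_pmap]

theorem sum_map_finset_sum {α ι : Type*} (L : List α) (s : Finset ι) (f : ι → α → ℕ) :
    ∑ h ∈ s, (L.map (f h)).sum = (L.map fun x => ∑ h ∈ s, f h x).sum := by
  induction L with
  | nil => simp
  | cons a L ih => simp [Finset.sum_add_distrib, ih]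

/-! ### Configurations of edges over the cuts of a diagram -/

/-- An edge whose marked point lies in a given gap between consecutive floors. It crosses the
`left` cuts before and the `right` cuts after this gap, and it has weight `wt`. The edges at the
`α`-vertices have `tag = true`. -/
@[ext]
structure Letter where
  left : ℕ
  right : ℕ
  wt : ℕ+
  tag : Bool

/-- The edges of a list of words, each with the index of its word. -/
def entries : List (List Letter) → List (ℕ × Letter)
  | [] => []
  | w :: c => w.map (fun l => (0, l)) ++ (entries c).map fun x => (x.1 + 1, x.2)

theorem entries_append (c c' : List (List Letter)) :
    entries (c ++ c') = entries c ++ (entries c').map fun x => (c.length + x.1, x.2) := by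
  induction c with
  | nil => simp [entries]
  | cons w c ih =>
    simp only [List.cons_append, entries, ih, List.map_append, List.append_assoc, List.map_map,
      List.length_cons]
    congr 3
    funext x
    simp only [Function.comp_apply, Prod.mk.injEq, and_true]
    omega

theorem mem_entries {L : List (List Letter)} {x : ℕ × Letter} :
    x ∈ entries L ↔ ∃ h : x.1 < L.length, x.2 ∈ L[x.1] := by
  induction L generalizing x with
  | nil => simp [entries]
  | cons w c ih =>
    obtain ⟨i, l⟩ := x
    cases i with
    | zero => simp [entries]
    | succ i =>
      have := @ih (i, l)
      simp only at this
      simp [entries, this]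

theorem fst_lt_of_mem_entries {c : List (List Letter)} {x : ℕ × Letter} (h : x ∈ entries c) :
    x.1 < c.length := (mem_entries.1 h).1

/-- No edge leaves the range of the configuration. -/
def Closed (c : List (List Letter)) : Prop :=
  ∀ x ∈ entries c, x.2.left ≤ x.1 ∧ x.1 + x.2.right < c.length

/-- The edge passes over the boundary between the words `j - 1` and `j`. -/
def Passes (x : ℕ × Letter) (j : ℕ) : Prop := x.1 < j + x.2.left ∧ j ≤ x.1 + x.2.right

/-- A non-empty closed configuration that is not a concatenation of two smaller ones. -/
def Indecomposable (c : List (List Letter)) : Prop :=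
  c ≠ [] ∧ Closed c ∧ ∀ j, 0 < j → j < c.length → ∃ x ∈ entries c, Passes x j

theorem closed_nil : Closed [] := by simp [Closed, entries]

theorem Closed.append {c c' : List (List Letter)} (h : Closed c) (h' : Closed c') :
    Closed (c ++ c') := by
  intro x hx
  rw [entries_append, List.mem_append, List.mem_map] at hx
  rw [List.length_append]
  rcases hx with hx | ⟨y, hy, rfl⟩
  · have := h x hx
    omega
  · have := h' y hy
    dsimp only
    omega

theorem Closed.of_append {c c' : List (List Letter)} (h : Closed (c ++ c'))
    (hp : ∀ x ∈ entries (c ++ c'), ¬ Passes x c.length) : Closed c ∧ Closed c' := by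
  simp only [Closed, entries_append, List.mem_append, List.mem_map, List.length_append,
    Passes] at h hp ⊢
  constructor
  · intro x hx
    have h1 := h x (Or.inl hx)
    have h2 := hp x (Or.inl hx)
    have h3 := fst_lt_of_mem_entries hx
    omega
  · intro x hx
    have h1 := h _ (Or.inr ⟨x, hx, rfl⟩)
    have h2 := hp _ (Or.inr ⟨x, hx, rfl⟩)
    dsimp only at h1 h2
    omega

theorem exists_eq_append_indecomposable (n : ℕ) (c : List (List Letter)) (hn : c.length = n)
    (hc : Closed c) (h : c ≠ []) : ∃ c₀ G, c = c₀ ++ G ∧ Closed c₀ ∧ Indecomposable G := by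
  induction n using Nat.strong_induction_on generalizing c with
  | _ n ih =>
    by_cases hi : Indecomposable c
    · exact ⟨[], c, rfl, closed_nil, hi⟩
    · simp only [Indecomposable, not_and, not_forall, not_exists] at hi
      obtain ⟨j, h0, hj, hp⟩ := hi h hc
      have hlen : (c.take j).length = j := by simp; omega
      obtain ⟨h1, h2⟩ := Closed.of_append (c := c.take j) (c' := c.drop j) (by simpa using hc)
        (by rw [hlen]; simpa using hp)
      obtain ⟨c₀, G, e, h3, h4⟩ := ih (n - j) (by omega) (c.drop j) (by simp [hn]) h2
        (by rw [Ne, ← List.length_eq_zero_iff]; simp; omega)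
      exact ⟨c.take j ++ c₀, G, by rw [List.append_assoc, ← e, List.take_append_drop],
        h1.append h3, h4⟩

theorem eq_nil_of_append_indecomposable {c₀ y G : List (List Letter)} (h₀ : Closed (c₀ ++ y))
    (hG : G ≠ []) (hGc : Closed G) (h : Indecomposable (y ++ G)) : y = [] := by
  by_contra hy
  obtain ⟨x, hx, hp1, hp2⟩ := h.2.2 y.length (List.length_pos_iff.2 hy)
    (by simp [List.length_pos_iff.2 hG])
  rw [entries_append, List.mem_append, List.mem_map] at hx
  rcases hx with hx | ⟨z, hz, rfl⟩
  · have := h₀ (c₀.length + x.1, x.2)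
      (by rw [entries_append]; exact List.mem_append_right _ (List.mem_map.2 ⟨x, hx, rfl⟩))
    rw [List.length_append] at this
    dsimp only at this
    omega
  · have := hGc z hz
    dsimp only at hp1
    omega

theorem append_indecomposable_inj {c₀ c₀' G G' : List (List Letter)} (h₀ : Closed c₀)
    (h₀' : Closed c₀') (hG : Indecomposable G) (hG' : Indecomposable G')
    (h : c₀ ++ G = c₀' ++ G') : c₀ = c₀' ∧ G = G' := by
  rcases List.append_eq_append_iff.1 h with ⟨y, rfl, rfl⟩ | ⟨y, rfl, rfl⟩
  · obtain rfl := eq_nil_of_append_indecomposable h₀' hG'.1 hG'.2.1 hG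
    simp
  · obtain rfl := eq_nil_of_append_indecomposable h₀ hG.1 hG.2.1 hG'
    simp

/-- Summation over configurations according to their last indecomposable block. -/
theorem sum_eq_sum_last_block {S G : Finset (List (List Letter))}
    {C : List (List Letter) → Finset (List (List Letter))} (F : List (List Letter) → ℚ)
    (hS : ∀ c, c ∈ S ↔ ∃ g ∈ G, ∃ c₀ ∈ C g, c = c₀ ++ g)
    (hG : ∀ g ∈ G, Indecomposable g) (hC : ∀ g ∈ G, ∀ c₀ ∈ C g, Closed c₀) :
    ∑ c ∈ S, F c = ∑ g ∈ G, ∑ c₀ ∈ C g, F (c₀ ++ g) := by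
  rw [Finset.sum_sigma']
  symm
  refine Finset.sum_bij (fun x _ => x.2 ++ x.1) ?_ ?_ ?_ ?_
  · rintro ⟨g, c₀⟩ h
    rw [Finset.mem_sigma] at h
    exact (hS _).2 ⟨g, h.1, c₀, h.2, rfl⟩
  · rintro ⟨g, c₀⟩ h ⟨g', c₀'⟩ h' e
    rw [Finset.mem_sigma] at h h'
    obtain ⟨rfl, rfl⟩ := append_indecomposable_inj (hC _ h.1 _ h.2) (hC _ h'.1 _ h'.2)
      (hG _ h.1) (hG _ h'.1) e
    rfl
  · intro c hc
    obtain ⟨g, hg, c₀, h₀, rfl⟩ := (hS c).1 hc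
    exact ⟨⟨g, c₀⟩, Finset.mem_sigma.2 ⟨hg, h₀⟩, rfl⟩
  · intros
    rfl

/-- The edge crosses the cut `h`. -/
abbrev Crosses (x : ℕ × Letter) (h : ℕ) : Prop := x.1 ≤ h + x.2.left ∧ h ≤ x.1 + x.2.right

/-- The total weight of the edges that cross the cut `h`. -/
def cutWeight (c : List (List Letter)) (h : ℕ) : ℕ :=
  ((entries c).map fun x => if Crosses x h then (x.2.wt : ℕ) else 0).sum

/-- The number of edges that are marked at the cut `h`. -/
def marks (c : List (List Letter)) (h : ℕ) : ℕ :=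
  ((entries c).map fun x => if x.1 = h then 1 else 0).sum

/-- The cogenus of an edge. -/
def letterCost (l : Letter) : ℕ := (l.left + l.right + 1) * l.wt - 1

/-- The cogenus of a configuration. -/
def cost (c : List (List Letter)) : ℕ := ((entries c).map fun x => letterCost x.2).sum

/-- The edge ends behind the last cut of a configuration of length `n`. -/
abbrev ReachesEnd (n : ℕ) (x : ℕ × Letter) : Prop := x.1 + x.2.right + 1 = n

/-- The cogenus of an edge in a configuration of length `n`, where the edges behind the last floor
do not contribute. -/
def endLetterCost (n : ℕ) (x : ℕ × Letter) : ℕ :=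
  if ReachesEnd n x then (x.2.left + x.2.right) * x.2.wt else letterCost x.2

/-- The cogenus of a configuration, where the edges behind the last floor do not contribute. -/
def endCost (c : List (List Letter)) : ℕ :=
  ((entries c).map fun x => endLetterCost c.length x).sum

theorem cost_append (c c' : List (List Letter)) : cost (c ++ c') = cost c + cost c' := by
  simp only [cost, entries_append, List.map_append, List.sum_append, List.map_map]
  rfl

theorem endCost_append {c c' : List (List Letter)} (hc : Closed c) (h : c' ≠ []) :
    endCost (c ++ c') = cost c + endCost c' := by
  simp only [endCost, cost, entries_append, List.map_append, List.sum_append, List.map_map]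
  congr 2
  · refine List.map_congr_left fun x hx => ?_
    have := hc x hx
    have := List.length_pos_iff.2 h
    rw [endLetterCost, List.length_append, if_neg (by simp only [ReachesEnd]; omega)]
  · refine List.map_congr_left fun x _ => ?_
    have : ReachesEnd (c ++ c').length (c.length + x.1, x.2) ↔ ReachesEnd c'.length x := by
      simp only [ReachesEnd, List.length_append]
      omega
    simp only [Function.comp_apply, endLetterCost, this]

theorem cutWeight_append_left {c c' : List (List Letter)} (hc' : Closed c') {h : ℕ}
    (hh : h < c.length) : cutWeight (c ++ c') h = cutWeight c h := by
  simp only [cutWeight, entries_append, List.map_append, List.sum_append, List.map_map]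
  rw [add_eq_left, List.sum_eq_zero_iff]
  simp only [List.mem_map, forall_exists_index, and_imp]
  rintro _ x hx rfl
  have := hc' x hx
  simp only [Function.comp_apply, Crosses]
  rw [if_neg (by omega)]

theorem cutWeight_append_right {c c' : List (List Letter)} (hc : Closed c) (h : ℕ) :
    cutWeight (c ++ c') (c.length + h) = cutWeight c' h := by
  simp only [cutWeight, entries_append, List.map_append, List.sum_append, List.map_map]
  have : ((entries c).map fun x => if Crosses x (c.length + h) then (x.2.wt : ℕ) else 0).sum = 0 := by
    rw [List.sum_eq_zero_iff]
    simp only [List.mem_map, forall_exists_index, and_imp]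
    rintro _ x hx rfl
    have := hc x hx
    simp only [Crosses]
    rw [if_neg (by omega)]
  rw [this, zero_add]
  congr 1
  refine List.map_congr_left fun x _ => ?_
  simp only [Function.comp_apply, Crosses, add_assoc, add_le_add_iff_left]

theorem marks_append_left {c c' : List (List Letter)} {h : ℕ}
    (hh : h < c.length) : marks (c ++ c') h = marks c h := by
  simp only [marks, entries_append, List.map_append, List.sum_append, List.map_map]
  rw [add_eq_left, List.sum_eq_zero_iff]
  simp only [List.mem_map, forall_exists_index, and_imp]
  rintro _ x hx rfl
  simp only [Function.comp_apply]
  rw [if_neg (by omega)]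

theorem marks_append_right (c c' : List (List Letter)) (h : ℕ) :
    marks (c ++ c') (c.length + h) = marks c' h := by
  simp only [marks, entries_append, List.map_append, List.sum_append, List.map_map]
  have : ((entries c).map fun x => if x.1 = c.length + h then 1 else 0).sum = 0 := by
    rw [List.sum_eq_zero_iff]
    simp only [List.mem_map, forall_exists_index, and_imp]
    rintro _ x hx rfl
    have := fst_lt_of_mem_entries hx
    rw [if_neg (by omega)]
  rw [this, zero_add]
  congr 1
  refine List.map_congr_left fun x _ => ?_
  simp only [Function.comp_apply, add_right_inj]

/-! ### Bounds for indecomposable configurations -/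

/-- The weight of the edge on the cut `h` of a configuration of length `n`, where the edges behind
the last floor count as edges of weight one. -/
def endWt (n h : ℕ) (x : ℕ × Letter) : ℕ := if h + 1 < n then x.2.wt else 1

theorem card_passes_add_le {c : List (List Letter)} (hc : Closed c) {x : ℕ × Letter}
    (hx : x ∈ entries c) (g : ℕ) :
    (∑ h ∈ Ico g c.length, if x.1 = h then 1 else 0) +
      #{j ∈ Ioo g c.length | x.1 < j + x.2.left ∧ j ≤ x.1 + x.2.right} ≤
      ∑ h ∈ Ico g c.length, if Crosses x h then endWt c.length h x else 0 := by
  have hcl := hc x hx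
  have h1 : #{h ∈ Ico g c.length | Crosses x h} ≤
      ∑ h ∈ Ico g c.length, if Crosses x h then endWt c.length h x else 0 := by
    rw [Finset.card_filter]
    refine Finset.sum_le_sum fun h _ => ?_
    split_ifs
    · unfold endWt
      have := x.2.wt.pos
      split_ifs <;> omega
    · exact le_rfl
  refine le_trans ?_ h1
  rw [Finset.sum_ite_eq]
  by_cases hg : g ≤ x.1 + x.2.right
  · set z := max g (x.1 - x.2.left) with hz
    have hsub : insert z ({j ∈ Ioo g c.length | x.1 < j + x.2.left ∧ j ≤ x.1 + x.2.right}) ⊆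
        {h ∈ Ico g c.length | Crosses x h} := by
      intro j
      simp only [Finset.mem_insert, Finset.mem_filter, mem_Ioo, mem_Ico, Crosses]
      omega
    have hnot : z ∉ ({j ∈ Ioo g c.length | x.1 < j + x.2.left ∧ j ≤ x.1 + x.2.right} : Finset ℕ) := by
      simp only [Finset.mem_filter, mem_Ioo]
      omega
    have := Finset.card_le_card hsub
    rw [Finset.card_insert_of_notMem hnot] at this
    split_ifs <;> omega
  · rw [if_neg (by simp only [mem_Ico]; omega), zero_add]
    refine Finset.card_le_card fun j => ?_
    simp only [Finset.mem_filter, mem_Ioo, mem_Ico, Crosses]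
    omega

/-- The variant of `cutWeight` where the edges behind the last floor count as edges of
weight one. -/
def endCutWeight (c : List (List Letter)) (h : ℕ) : ℕ :=
  ((entries c).map fun x => if Crosses x h then endWt c.length h x else 0).sum

theorem sum_marks_add_le {c : List (List Letter)} (hc : Indecomposable c) (g : ℕ) :
    ∑ h ∈ Ico g c.length, marks c h + (c.length - g - 1) ≤
      ∑ h ∈ Ico g c.length, endCutWeight c h := by
  have h1 : c.length - g - 1 ≤ ((entries c).map fun x =>
      #{j ∈ Ioo g c.length | x.1 < j + x.2.left ∧ j ≤ x.1 + x.2.right}).sum := by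
    simp only [Finset.card_filter]
    rw [← sum_map_finset_sum, ← Nat.card_Ioo, Finset.card_eq_sum_ones]
    refine Finset.sum_le_sum fun j hj => ?_
    rw [mem_Ioo] at hj
    obtain ⟨x, hx, hp⟩ := hc.2.2 j (by omega) hj.2
    refine le_trans ?_ (List.le_sum_of_mem (List.mem_map.2 ⟨x, hx, rfl⟩))
    unfold Passes at hp
    rw [if_pos hp]
  refine (Nat.add_le_add_left h1 _).trans ?_
  simp only [marks, endCutWeight]
  rw [sum_map_finset_sum, sum_map_finset_sum, ← List.sum_map_add]
  exact List.sum_le_sum fun x hx => card_passes_add_le hc.2.1 hx g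

theorem marks_le_endCutWeight (c : List (List Letter)) (h : ℕ) : marks c h ≤ endCutWeight c h := by
  refine List.sum_le_sum fun x _ => ?_
  by_cases hx : x.1 = h
  · rw [if_pos hx, if_pos (by simp only [Crosses]; omega)]
    unfold endWt
    have := x.2.wt.pos
    split_ifs <;> omega
  · simp [hx]

theorem card_crosses {c : List (List Letter)} (hc : Closed c) {x : ℕ × Letter}
    (hx : x ∈ entries c) :
    #{h ∈ range c.length | Crosses x h} = x.2.left + x.2.right + 1 := by
  have := hc x hx
  have : ({h ∈ range c.length | Crosses x h} : Finset ℕ) =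
      Icc (x.1 - x.2.left) (x.1 + x.2.right) := by
    ext h
    simp only [Finset.mem_filter, mem_range, mem_Icc, Crosses]
    omega
  rw [this, Nat.card_Icc]
  omega

theorem sum_marks {c : List (List Letter)} :
    ∑ h ∈ range c.length, marks c h = (entries c).length := by
  simp only [marks]
  rw [sum_map_finset_sum, List.map_congr_left (g := fun _ => 1)]
  · simp
  · intro x hx
    have := fst_lt_of_mem_entries hx
    simp [this]

theorem sum_cutWeight {c : List (List Letter)} (hc : Closed c) :
    ∑ h ∈ range c.length, cutWeight c h = cost c + ∑ h ∈ range c.length, marks c h := by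
  rw [sum_marks]
  simp only [cutWeight, cost]
  rw [sum_map_finset_sum, show (entries c).length = ((entries c).map fun _ => 1).sum by simp,
    ← List.sum_map_add]
  congr 1
  refine List.map_congr_left fun x hx => ?_
  rw [← Finset.sum_filter, Finset.sum_const, card_crosses hc hx, letterCost, smul_eq_mul]
  have : 0 < (x.2.left + x.2.right + 1) * (x.2.wt : ℕ) := by positivity
  omega

theorem sum_endCutWeight {c : List (List Letter)} (hc : Closed c) :
    ∑ h ∈ range c.length, endCutWeight c h = endCost c + ∑ h ∈ range c.length, marks c h := by
  rw [sum_marks]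
  simp only [endCutWeight, endCost]
  rw [sum_map_finset_sum, show (entries c).length = ((entries c).map fun _ => 1).sum by simp,
    ← List.sum_map_add]
  congr 1
  refine List.map_congr_left fun x hx => ?_
  have hcl := hc x hx
  obtain ⟨n, hn⟩ : ∃ n, c.length = n + 1 := ⟨c.length - 1, by omega⟩
  have hcard := card_crosses hc hx
  rw [hn, Finset.range_add_one, Finset.filter_insert] at hcard
  rw [hn, Finset.sum_range_succ]
  have h1 : ∀ h ∈ range n, (if Crosses x h then endWt (n + 1) h x else 0) =
      if Crosses x h then (x.2.wt : ℕ) else 0 := by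
    intro h hh
    rw [mem_range] at hh
    simp [endWt, hh]
  have h2 : (if Crosses x n then endWt (n + 1) n x else 0) = if Crosses x n then 1 else 0 := by
    simp [endWt]
  rw [Finset.sum_congr rfl h1, h2, ← Finset.sum_filter, Finset.sum_const, smul_eq_mul]
  by_cases hr : ReachesEnd (n + 1) x
  · have hcr : Crosses x n := by
      simp only [Crosses, ReachesEnd] at hr ⊢
      omega
    rw [if_pos hcr, Finset.card_insert_of_notMem (by simp)] at hcard
    rw [if_pos hcr, endLetterCost, if_pos hr, Nat.succ_injective hcard]
  · have hcr : ¬ Crosses x n := by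
      simp only [Crosses, ReachesEnd] at hr ⊢
      omega
    rw [if_neg hcr] at hcard
    rw [if_neg hcr, endLetterCost, if_neg hr, hcard, letterCost]
    have : 0 < (x.2.left + x.2.right + 1) * (x.2.wt : ℕ) := by positivity
    omega

theorem endCutWeight_of_lt {c : List (List Letter)} {h : ℕ} (hh : h + 1 < c.length) :
    endCutWeight c h = cutWeight c h := by
  simp [endCutWeight, cutWeight, endWt, hh]

theorem endCutWeight_le (c : List (List Letter)) (h : ℕ) : endCutWeight c h ≤ cutWeight c h := by
  refine List.sum_le_sum fun x _ => ?_
  split_ifs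
  · unfold endWt
    have := x.2.wt.pos
    split_ifs <;> omega
  · exact le_rfl

theorem marks_le_cutWeight (c : List (List Letter)) (h : ℕ) : marks c h ≤ cutWeight c h :=
  (marks_le_endCutWeight c h).trans (endCutWeight_le c h)

theorem endCost_le_cost {c : List (List Letter)} (hc : Closed c) : endCost c ≤ cost c := by
  have h1 := sum_cutWeight hc
  have h2 := sum_endCutWeight hc
  have := Finset.sum_le_sum fun h (_ : h ∈ range c.length) => endCutWeight_le c h
  omega

theorem length_le_endCost {c : List (List Letter)} (hc : Indecomposable c) :
    c.length ≤ endCost c + 1 := by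
  have h1 := sum_marks_add_le hc 0
  have h2 := sum_endCutWeight hc.2.1
  rw [← Finset.range_eq_Ico] at h1
  omega

theorem endCutWeight_le_endCost {c : List (List Letter)} (hc : Indecomposable c) {g : ℕ}
    (hg : g + 1 < c.length) :
    endCutWeight c g + (c.length - g - 2) ≤ marks c g + endCost c := by
  have h1 := sum_marks_add_le hc (g + 1)
  have h2 := sum_endCutWeight hc.2.1
  have h3 := Finset.sum_le_sum fun h (_ : h ∈ range g) => marks_le_endCutWeight c h
  rw [← Finset.sum_range_add_sum_Ico _ (show g + 1 ≤ c.length by omega),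
    ← Finset.sum_range_add_sum_Ico (marks c) (show g + 1 ≤ c.length by omega),
    Finset.sum_range_succ, Finset.sum_range_succ] at h2
  omega

theorem cutWeight_le_cost {c : List (List Letter)} (hc : Closed c) {g : ℕ} (hg : g < c.length) :
    cutWeight c g ≤ marks c g + cost c := by
  have h2 := sum_cutWeight hc
  rw [← Finset.add_sum_erase _ _ (mem_range.2 hg),
    ← Finset.add_sum_erase _ (marks c) (mem_range.2 hg)] at h2
  have h3 := Finset.sum_le_sum fun h (_ : h ∈ (range c.length).erase g) => marks_le_cutWeight c h
  omega

/-- Some edge of weight at least two ends behind the last cut. -/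
def Heavy (c : List (List Letter)) : Prop :=
  ∃ x ∈ entries c, ReachesEnd c.length x ∧ 2 ≤ (x.2.wt : ℕ)

theorem Heavy.endCost_lt_cost {c : List (List Letter)} (h : Heavy c) :
    endCost c < cost c := by
  obtain ⟨x, hx, hr, hw⟩ := h
  refine List.sum_lt_sum _ _ (fun y _ => ?_) ⟨x, hx, ?_⟩
  · unfold endLetterCost letterCost
    have := y.2.wt.pos
    split_ifs
    · rw [add_mul _ 1]
      omega
    · exact le_rfl
  · rw [endLetterCost, if_pos hr, letterCost, add_mul _ 1]
    have : 1 * (x.2.wt : ℕ) = x.2.wt := one_mul _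
    omega

/-! ### The weighted count of closed configurations -/

/-- The number of ways to insert `n - X` equal edges into a word of length `m`. -/
def gapCount (n X m : ℕ) : ℚ := if X ≤ n then ((n - X + m).choose m : ℕ) else 0

theorem gapCount_eq {n X m : ℕ} (h : X ≤ n + m) : gapCount n X m = ((n + m - X).choose m : ℕ) := by
  unfold gapCount
  split_ifs with h1
  · rw [show n - X + m = n + m - X by omega]
  · rw [Nat.choose_eq_zero_of_lt (by omega), Nat.cast_zero]

theorem polyFrom_gapCount {T X m : ℕ} (h : X ≤ T + m) : PolyFrom T fun n => gapCount n X m := by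
  refine ⟨Polynomial.C ((m.factorial : ℚ)⁻¹) *
    (descPochhammer ℚ m).comp (Polynomial.X + Polynomial.C ((m : ℚ) - X)), fun n hn => ?_⟩
  beta_reduce
  rw [gapCount_eq (by omega)]
  have h1 : (n : ℚ) + ((m : ℚ) - X) = ((n + m - X : ℕ) : ℚ) := by
    rw [Nat.cast_sub (by omega)]
    push_cast
    ring
  simp only [Polynomial.eval_mul, Polynomial.eval_C, Polynomial.eval_comp, Polynomial.eval_add,
    Polynomial.eval_X]
  rw [h1, descPochhammer_eval_eq_descFactorial, Nat.descFactorial_eq_factorial_mul_choose]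
  have : (m.factorial : ℚ) ≠ 0 := by positivity
  push_cast
  field_simp

/-- The number of ways to insert the trivial edges into the first `n` words of a configuration that
is placed behind `p` cuts. -/
def cutProd (c : List (List Letter)) (p n : ℕ) : ℚ :=
  ∏ h ∈ range n, gapCount (p + h + 1) (cutWeight c h) (marks c h)

/-- The product of the squares of the weights. -/
def sqProd (c : List (List Letter)) : ℚ := ((entries c).map fun x => ((x.2.wt : ℕ) : ℚ) ^ 2).prod

/-- The weighted number of insertions of trivial edges into a configuration that is placed behind
`p` cuts. -/
def configWeight (c : List (List Letter)) (p : ℕ) : ℚ := cutProd c p c.length * sqProd c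

theorem cutProd_append {c c' : List (List Letter)} (hc : Closed c) (hc' : Closed c') (n : ℕ) :
    cutProd (c ++ c') 0 (c.length + n) = cutProd c 0 c.length * cutProd c' c.length n := by
  simp only [cutProd]
  rw [Finset.prod_range_add]
  congr 1
  · refine Finset.prod_congr rfl fun h hh => ?_
    rw [mem_range] at hh
    rw [cutWeight_append_left hc' hh, marks_append_left hh]
  · refine Finset.prod_congr rfl fun h _ => ?_
    rw [cutWeight_append_right hc, marks_append_right, zero_add]

theorem configWeight_append {c c' : List (List Letter)} (hc : Closed c) (hc' : Closed c') :
    configWeight (c ++ c') 0 = configWeight c 0 * configWeight c' c.length := by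
  simp only [configWeight, List.length_append, cutProd_append hc hc', sqProd, entries_append,
    List.map_append, List.prod_append, List.map_map]
  rw [mul_mul_mul_comm]
  rfl

theorem finite_configs {S : Set (List (List Letter))} (k n : ℕ)
    (h : ∀ c ∈ S, c.length ≤ k ∧ Closed c ∧ ∃ f : ℕ × Letter → ℕ,
      (∀ x ∈ entries c, 1 ≤ f x ∧ x.2.wt ≤ f x + 1) ∧ ((entries c).map f).sum ≤ n) : S.Finite := by
  have h1 : {l : Letter | l.left ≤ k ∧ l.right ≤ k ∧ (l.wt : ℕ) ≤ n + 1}.Finite := by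
    refine Set.Finite.of_finite_image (f := fun l : Letter => (l.left, l.right, (l.wt : ℕ), l.tag))
      (((Set.finite_Iic k).prod ((Set.finite_Iic k).prod
        ((Set.finite_Iic (n + 1)).prod Set.finite_univ))).subset ?_) ?_
    · rintro _ ⟨l, hl, rfl⟩
      simpa using hl
    · rintro ⟨a, b, w, t⟩ _ ⟨a', b', w', t'⟩ _ e
      simpa [PNat.coe_inj] using e
  refine (finite_lists (finite_lists h1 n) k).subset fun c hc => ?_
  obtain ⟨hk, hcl, f, hf, hs⟩ := h c hc
  refine ⟨hk, fun w hw => ?_⟩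
  obtain ⟨i, hi, rfl⟩ := List.getElem_of_mem hw
  have hmem : ∀ l ∈ c.get ⟨i, hi⟩, (i, l) ∈ entries c := fun l hl => mem_entries.2 ⟨hi, hl⟩
  constructor
  · have h2 : marks c i ≤ ((entries c).map f).sum := by
      refine List.sum_le_sum fun x hx => ?_
      have := (hf x hx).1
      split_ifs <;> omega
    refine le_trans ?_ (h2.trans hs)
    have : ∀ (c : List (List Letter)) (i : ℕ) (hi : i < c.length),
        (c.get ⟨i, hi⟩).length ≤ marks c i := by
      intro c
      induction c with
      | nil => simp
      | cons w c ih =>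
        intro i hi
        cases i with
        | zero => simp [marks, entries, Function.comp_def]
        | succ i =>
          refine (ih i (by simpa using hi)).trans ?_
          simp [marks, entries, Function.comp_def]
    exact this c i hi
  · intro l hl
    have h2 := hmem l hl
    have h3 := hcl _ h2
    have h4 := (hf _ h2).2
    have h5 : f (i, l) ≤ ((entries c).map f).sum := List.le_sum_of_mem (List.mem_map.2 ⟨_, h2, rfl⟩)
    simp only [Set.mem_ofPred_eq]
    dsimp only at h3 h4
    omega

/-- The edges are not `α`-edges, and they are not trivial. -/
def Inner (c : List (List Letter)) : Prop :=
  ∀ x ∈ entries c, x.2.tag = false ∧ 1 ≤ letterCost x.2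

theorem inner_append {c c' : List (List Letter)} : Inner (c ++ c') ↔ Inner c ∧ Inner c' := by
  simp only [Inner, entries_append, List.mem_append, List.mem_map]
  constructor
  · exact fun h => ⟨fun x hx => h x (Or.inl hx), fun x hx => h (c.length + x.1, x.2) (Or.inr ⟨x, hx, rfl⟩)⟩
  · rintro ⟨h, h'⟩ x (hx | ⟨y, hy, rfl⟩)
    exacts [h x hx, h' y hy]

theorem wt_le_letterCost (l : Letter) : (l.wt : ℕ) ≤ letterCost l + 1 := by
  unfold letterCost
  rw [add_mul _ 1, one_mul]
  omega

theorem finite_closedConfigs (d k : ℕ) :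
    {c | c.length = k ∧ Closed c ∧ Inner c ∧ cost c = d}.Finite :=
  finite_configs k d fun _ hc => ⟨hc.1.le, hc.2.1, fun x => letterCost x.2,
    fun x hx => ⟨(hc.2.2.1 x hx).2, wt_le_letterCost _⟩, hc.2.2.2.le⟩

/-- The closed configurations of length `k` and cogenus `d`. -/
noncomputable def closedConfigs (d k : ℕ) : Finset (List (List Letter)) :=
  (finite_closedConfigs d k).toFinset

theorem mem_closedConfigs {d k : ℕ} {c : List (List Letter)} :
    c ∈ closedConfigs d k ↔ c.length = k ∧ Closed c ∧ Inner c ∧ cost c = d := by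
  simp [closedConfigs]

theorem finite_blocks (d : ℕ) : {c | Indecomposable c ∧ Inner c ∧ cost c ≤ d}.Finite :=
  finite_configs (d + 1) d fun c hc => by
    have h1 := length_le_endCost hc.1
    have h2 := endCost_le_cost hc.1.2.1
    exact ⟨by have := hc.2.2; omega, hc.1.2.1, fun x => letterCost x.2,
      fun x hx => ⟨(hc.2.1 x hx).2, wt_le_letterCost _⟩, hc.2.2⟩

/-- The indecomposable configurations of cogenus at most `d`. -/
noncomputable def blocks (d : ℕ) : Finset (List (List Letter)) := (finite_blocks d).toFinset

theorem mem_blocks {d : ℕ} {c : List (List Letter)} :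
    c ∈ blocks d ↔ Indecomposable c ∧ Inner c ∧ cost c ≤ d := by
  simp [blocks]

/-- The weighted number of closed configurations of length `k` and cogenus `d`. -/
noncomputable def closedCount (d k : ℕ) : ℚ := ∑ c ∈ closedConfigs d k, configWeight c 0

open Classical in
theorem sum_filter_configWeight {Q : List (List Letter) → Prop}
    (hQ : ∀ c g, Closed c → g ≠ [] → (Q (c ++ g) ↔ Q g)) {d k : ℕ} (hk : 1 ≤ k) :
    ∑ c ∈ closedConfigs d k with Q c, configWeight c 0 =
      ∑ g ∈ blocks d with g.length ≤ k ∧ Q g,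
        closedCount (d - cost g) (k - g.length) * configWeight g (k - g.length) := by
  rw [sum_eq_sum_last_block (G := {g ∈ blocks d | g.length ≤ k ∧ Q g})
    (C := fun g => closedConfigs (d - cost g) (k - g.length))]
  · refine Finset.sum_congr rfl fun g hg => ?_
    rw [Finset.mem_filter, mem_blocks] at hg
    rw [closedCount, Finset.sum_mul]
    refine Finset.sum_congr rfl fun c hc => ?_
    rw [mem_closedConfigs] at hc
    rw [configWeight_append hc.2.1 hg.1.1.2.1, hc.1]
  · intro c
    simp only [Finset.mem_filter, mem_closedConfigs, mem_blocks]
    constructor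
    · rintro ⟨⟨h1, h2, h3, h4⟩, h5⟩
      obtain ⟨c₀, g, rfl, hc₀, hg⟩ := exists_eq_append_indecomposable k c h1 h2
        (by rintro rfl; simp at h1; omega)
      rw [List.length_append] at h1
      rw [cost_append] at h4
      rw [inner_append] at h3
      exact ⟨g, ⟨⟨hg, h3.2, by omega⟩, by omega, (hQ _ _ hc₀ hg.1).1 h5⟩, c₀,
        ⟨by omega, hc₀, h3.1, by omega⟩, rfl⟩
    · rintro ⟨g, ⟨⟨h1, h2, h3⟩, h4, h5⟩, c₀, ⟨h6, h7, h8, h9⟩, rfl⟩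
      refine ⟨⟨?_, h7.append h1.2.1, inner_append.2 ⟨h8, h2⟩, ?_⟩, (hQ _ _ h7 h1.1).2 h5⟩
      · rw [List.length_append]
        omega
      · rw [cost_append]
        omega
  · intro g hg
    rw [Finset.mem_filter, mem_blocks] at hg
    exact hg.1.1
  · intro g _ c hc
    exact (mem_closedConfigs.1 hc).2.1

theorem polyFrom_cutProd {c : List (List Letter)} {T n : ℕ} (hn : n ≤ c.length) (hT : c.length ≤ T)
    (h : ∀ h < n, cutWeight c h + (c.length - h - 1) ≤ marks c h + T) :
    PolyFrom T fun k => cutProd c (k - c.length) n := by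
  refine PolyFrom.prod _ fun i hi => ?_
  rw [mem_range] at hi
  have := h i hi
  refine ((polyFrom_gapCount (T := T - (c.length - i - 1)) (X := cutWeight c i)
    (m := marks c i) (by omega)).comp_sub (T := T) (l := c.length - i - 1) (by omega)
    (by omega)).of_eq fun k hk => ?_
  congr 1
  omega

theorem polyFrom_configWeight {c : List (List Letter)} {T : ℕ} (hT : c.length ≤ T)
    (h : ∀ h < c.length, cutWeight c h + (c.length - h - 1) ≤ marks c h + T) :
    PolyFrom T fun k => configWeight c (k - c.length) :=
  (polyFrom_cutProd le_rfl hT h).mul (PolyFrom.const T _)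

theorem Indecomposable.cutWeight_add_le {c : List (List Letter)} (hc : Indecomposable c) {h : ℕ}
    (hh : h < c.length) : cutWeight c h + (c.length - h - 1) ≤ marks c h + (cost c + 1) := by
  rcases eq_or_lt_of_le (Nat.succ_le_of_lt hh) with e | e
  · have := cutWeight_le_cost hc.2.1 hh
    omega
  · have h1 := endCutWeight_le_endCost hc (g := h) (by omega)
    have h2 := endCost_le_cost hc.2.1
    rw [endCutWeight_of_lt (by omega)] at h1
    omega

theorem Heavy.cutWeight_add_le {c : List (List Letter)} (hc : Indecomposable c) (hh : Heavy c)
    {h : ℕ} (hl : h < c.length) : cutWeight c h + (c.length - h - 1) ≤ marks c h + cost c := by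
  have h2 := hh.endCost_lt_cost
  rcases eq_or_lt_of_le (Nat.succ_le_of_lt hl) with e | e
  · have := cutWeight_le_cost hc.2.1 hl
    omega
  · have h1 := endCutWeight_le_endCost hc (g := h) (by omega)
    rw [endCutWeight_of_lt (by omega)] at h1
    omega

theorem eq_of_mem_blocks_of_cost_eq_zero {d : ℕ} {c : List (List Letter)} (hc : c ∈ blocks d)
    (h : cost c = 0) : c = [[]] := by
  rw [mem_blocks] at hc
  obtain ⟨h1, h2, h3⟩ := hc
  have h4 := length_le_endCost h1
  have h5 := endCost_le_cost h1.2.1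
  match c, h1.1 with
  | [], h => exact absurd rfl h
  | [[]], _ => rfl
  | [l :: w], _ =>
    have h6 := (h2 (0, l) (by simp [entries])).2
    simp only [cost, entries, List.map_cons, List.sum_cons, List.cons_append] at h
    dsimp only at h6
    omega
  | _ :: _ :: _, _ =>
    simp only [List.length_cons] at h4
    omega

theorem singleton_nil_mem_blocks (d : ℕ) : [[]] ∈ blocks d := by
  rw [mem_blocks]
  refine ⟨⟨by simp, by simp [Closed, entries], fun j h1 h2 => ?_⟩, by simp [Inner, entries], by simp [cost, entries]⟩
  simp at h2
  omega

theorem polyFrom_closedCount (d : ℕ) : PolyFrom d (closedCount d) := by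
  classical
  induction d using Nat.strong_induction_on with
  | _ d ih =>
    have h1 : ∀ k, d < k → closedCount d k = closedCount d (k - 1) +
        ∑ g ∈ (blocks d).erase [[]],
          closedCount (d - cost g) (k - g.length) * configWeight g (k - g.length) := by
      intro k hk
      have h2 := sum_filter_configWeight (Q := fun _ => True) (fun _ _ _ _ => Iff.rfl) (d := d)
        (k := k) (by omega)
      simp only [and_true, Finset.filter_true] at h2
      rw [Finset.filter_true_of_mem, ← Finset.add_sum_erase _ _ (singleton_nil_mem_blocks d)] at h2
      · rw [closedCount, h2]
        simp [cost, entries, configWeight, cutProd, cutWeight, marks, sqProd, gapCount]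
      · intro g hg
        rw [mem_blocks] at hg
        have h4 := length_le_endCost hg.1
        have h5 := endCost_le_cost hg.1.2.1
        have := hg.2.2
        omega
    refine PolyFrom.of_diff (PolyFrom.sum _ fun g hg => ?_) h1
    rw [Finset.mem_erase] at hg
    have h3 : cost g ≠ 0 := fun h => hg.1 (eq_of_mem_blocks_of_cost_eq_zero hg.2 h)
    have hg2 := mem_blocks.1 hg.2
    have h4 := length_le_endCost hg2.1
    have h5 := endCost_le_cost hg2.1.2.1
    have h6 := hg2.2.2
    refine PolyFrom.mul ?_ (polyFrom_configWeight (by omega) fun h hh => ?_)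
    · exact (ih (d - cost g) (by omega)).comp_sub (by omega) (by omega)
    · have := hg2.1.cutWeight_add_le hh
      omega

theorem heavy_append {c g : List (List Letter)} (hc : Closed c) (hg : g ≠ []) :
    Heavy (c ++ g) ↔ Heavy g := by
  have h0 := List.length_pos_iff.2 hg
  simp only [Heavy, entries_append, List.mem_append, List.mem_map, List.length_append, ReachesEnd]
  constructor
  · rintro ⟨x, hx | ⟨y, hy, rfl⟩, h1, h2⟩
    · have := hc x hx
      omega
    · exact ⟨y, hy, by dsimp only at h1; omega, h2⟩
  · rintro ⟨x, hx, h1, h2⟩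
    exact ⟨_, Or.inr ⟨x, hx, rfl⟩, by dsimp only; omega, h2⟩

open Classical in
theorem polyFrom_light {d : ℕ} (hd : 1 ≤ d) :
    PolyFrom d fun k => ∑ c ∈ closedConfigs d k with ¬ Heavy c, configWeight c 0 := by
  have h : PolyFrom d fun k => ∑ c ∈ closedConfigs d k with Heavy c, configWeight c 0 := by
    have h1 : PolyFrom d fun k => ∑ g ∈ blocks d with Heavy g,
        closedCount (d - cost g) (k - g.length) * configWeight g (k - g.length) := by
      refine PolyFrom.sum _ fun g hg => ?_
      rw [Finset.mem_filter, mem_blocks] at hg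
      have h4 := length_le_endCost hg.1.1
      have h5 := hg.2.endCost_lt_cost
      have h6 := hg.1.2.2
      refine PolyFrom.mul ?_ (polyFrom_configWeight (by omega) fun h hh => ?_)
      · exact (polyFrom_closedCount (d - cost g)).comp_sub (by omega) (by omega)
      · have := Heavy.cutWeight_add_le hg.1.1 hg.2 hh
        omega
    refine h1.of_eq fun k hk => ?_
    rw [sum_filter_configWeight (fun _ _ => heavy_append) (by omega)]
    congr 1
    refine Finset.filter_congr fun g hg => ?_
    rw [mem_blocks] at hg
    refine and_iff_right_of_imp fun hh => ?_
    have h4 := length_le_endCost hg.1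
    have h5 := hh.endCost_lt_cost
    omega
  refine ((polyFrom_closedCount d).sub h).of_eq fun k _ => ?_
  rw [closedCount, ← Finset.sum_filter_add_sum_filter_not (closedConfigs d k) Heavy]
  ring

/-! ### Configurations up to the last floor -/

/-- The `α`-edges come after the other edges, ordered by their weights. -/
def Letter.key (l : Letter) : ℕ := if l.tag then l.wt else 0

/-- The last word may contain `α`-edges, behind its other edges and ordered by their weights; and no
edge is trivial. -/
def EndInner (c : List (List Letter)) : Prop :=
  (∀ x ∈ entries c, (x.2.tag = true → x.1 + 1 = c.length) ∧ 1 ≤ endLetterCost c.length x) ∧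
    ∀ w ∈ c.getLast?, w.Pairwise fun l l' => l.key ≤ l'.key

theorem reachesEnd_append {c g : List (List Letter)} {x : ℕ × Letter} :
    ReachesEnd (c ++ g).length (c.length + x.1, x.2) ↔ ReachesEnd g.length x := by
  simp only [ReachesEnd, List.length_append]
  omega

theorem not_reachesEnd_append {c g : List (List Letter)} (hc : Closed c) (hg : g ≠ [])
    {x : ℕ × Letter} (hx : x ∈ entries c) : ¬ ReachesEnd (c ++ g).length x := by
  have := hc x hx
  have := List.length_pos_iff.2 hg
  simp only [ReachesEnd, List.length_append]
  omega

theorem endInner_append {c g : List (List Letter)} (hc : Closed c) (hg : g ≠ []) :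
    EndInner (c ++ g) ↔ Inner c ∧ EndInner g := by
  have h0 := List.length_pos_iff.2 hg
  have h1 : ∀ x ∈ entries c, ((x.2.tag = true → x.1 + 1 = (c ++ g).length) ∧
      1 ≤ endLetterCost (c ++ g).length x) ↔ x.2.tag = false ∧ 1 ≤ letterCost x.2 := by
    intro x hx
    have := fst_lt_of_mem_entries hx
    rw [endLetterCost, if_neg (not_reachesEnd_append hc hg hx), List.length_append]
    refine and_congr_left fun _ => ⟨fun h => ?_, fun h => by simp [h]⟩
    by_contra h'
    have := h (by simpa using h')
    omega
  have h2 : ∀ x ∈ entries g, (((c.length + x.1, x.2).2.tag = true →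
      (c.length + x.1, x.2).1 + 1 = (c ++ g).length) ∧
      1 ≤ endLetterCost (c ++ g).length (c.length + x.1, x.2)) ↔
      (x.2.tag = true → x.1 + 1 = g.length) ∧ 1 ≤ endLetterCost g.length x := by
    intro x _
    simp only [endLetterCost, reachesEnd_append]
    simp only [List.length_append, add_assoc, add_right_inj]
  unfold EndInner Inner
  rw [List.getLast?_append_of_ne_nil _ hg, ← and_assoc]
  refine and_congr_left fun _ => ?_
  constructor
  · refine fun h => ⟨fun x hx => (h1 x hx).1 (h x ?_), fun x hx => (h2 x hx).1 (h _ ?_)⟩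
    · rw [entries_append]
      exact List.mem_append_left _ hx
    · rw [entries_append]
      exact List.mem_append_right _ (List.mem_map.2 ⟨x, hx, rfl⟩)
  · rintro ⟨h, h'⟩ x hx
    rw [entries_append, List.mem_append, List.mem_map] at hx
    rcases hx with hx | ⟨y, hy, rfl⟩
    exacts [(h1 x hx).2 (h x hx), (h2 y hy).2 (h' y hy)]

theorem wt_le_endLetterCost {n : ℕ} {x : ℕ × Letter} (h : 1 ≤ endLetterCost n x) :
    (x.2.wt : ℕ) ≤ endLetterCost n x + 1 := by
  unfold endLetterCost at h ⊢
  split_ifs at h ⊢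
  · exact (Nat.le_mul_of_pos_left _ (Nat.pos_of_mul_pos_right h)).trans (Nat.le_succ _)
  · exact wt_le_letterCost _

theorem finite_endConfigs (d k : ℕ) :
    {c | c.length = k ∧ Closed c ∧ EndInner c ∧ endCost c = d}.Finite :=
  finite_configs k d fun c hc => ⟨hc.1.le, hc.2.1, fun x => endLetterCost c.length x,
    fun x hx => ⟨(hc.2.2.1.1 x hx).2, wt_le_endLetterCost (hc.2.2.1.1 x hx).2⟩, hc.2.2.2.le⟩

/-- The configurations of length `k` and cogenus `d` up to the last floor. -/
noncomputable def endConfigs (d k : ℕ) : Finset (List (List Letter)) :=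
  (finite_endConfigs d k).toFinset

theorem mem_endConfigs {d k : ℕ} {c : List (List Letter)} :
    c ∈ endConfigs d k ↔ c.length = k ∧ Closed c ∧ EndInner c ∧ endCost c = d := by
  simp [endConfigs]

theorem finite_endBlocks (d : ℕ) : {c | Indecomposable c ∧ EndInner c ∧ endCost c ≤ d}.Finite :=
  finite_configs (d + 1) d fun c hc => by
    have h1 := length_le_endCost hc.1
    exact ⟨by have := hc.2.2; omega, hc.1.2.1, fun x => endLetterCost c.length x,
      fun x hx => ⟨(hc.2.1.1 x hx).2, wt_le_endLetterCost (hc.2.1.1 x hx).2⟩, hc.2.2⟩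

/-- The indecomposable configurations of cogenus at most `d` at the last floor. -/
noncomputable def endBlocks (d : ℕ) : Finset (List (List Letter)) := (finite_endBlocks d).toFinset

theorem mem_endBlocks {d : ℕ} {c : List (List Letter)} :
    c ∈ endBlocks d ↔ Indecomposable c ∧ EndInner c ∧ endCost c ≤ d := by
  simp [endBlocks]

/-- The number of edges behind the last floor, of weight `j`, at `β`-vertices. -/
def betaCount (c : List (List Letter)) (j : ℕ+) : ℕ :=
  ((entries c).map fun x =>
    if ReachesEnd c.length x ∧ x.2.tag = false ∧ x.2.wt = j then 1 else 0).sum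

/-- The number of edges of weight `j` at `α`-vertices. -/
def alphaCount (c : List (List Letter)) (j : ℕ+) : ℕ :=
  ((entries c).map fun x =>
    if ReachesEnd c.length x ∧ x.2.tag = true ∧ x.2.wt = j then 1 else 0).sum

/-- The number of edges behind the last floor at `β`-vertices. -/
def betaTotal (c : List (List Letter)) : ℕ :=
  ((entries c).map fun x => if ReachesEnd c.length x ∧ x.2.tag = false then 1 else 0).sum

/-- The number of edges at `β`-vertices that are larger than the last floor. -/
def lastMarks (c : List (List Letter)) : ℕ :=
  ((entries c).map fun x =>
    if ReachesEnd c.length x ∧ x.2.tag = false ∧ x.2.right = 0 then 1 else 0).sum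

/-- The product of the squares of the weights of the edges between floors. -/
def innerSqProd (c : List (List Letter)) : ℚ :=
  ((entries c).map fun x => if ReachesEnd c.length x then 1 else ((x.2.wt : ℕ) : ℚ) ^ 2).prod

theorem sum_entries_append_of_reachesEnd {c g : List (List Letter)} (hc : Closed c) (hg : g ≠ [])
    (P : Letter → Prop) [DecidablePred P] :
    ((entries (c ++ g)).map fun x => if ReachesEnd (c ++ g).length x ∧ P x.2 then 1 else 0).sum =
      ((entries g).map fun x => if ReachesEnd g.length x ∧ P x.2 then 1 else 0).sum := by
  rw [entries_append, List.map_append, List.sum_append, List.map_map]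
  have : ((entries c).map fun x =>
      if ReachesEnd (c ++ g).length x ∧ P x.2 then 1 else 0).sum = 0 := by
    rw [List.sum_eq_zero_iff]
    simp only [List.mem_map, forall_exists_index, and_imp]
    rintro _ x hx rfl
    rw [if_neg fun h => not_reachesEnd_append hc hg hx h.1]
  rw [this, zero_add]
  congr 1
  refine List.map_congr_left fun x _ => ?_
  simp only [Function.comp_apply, reachesEnd_append]

theorem innerSqProd_append {c g : List (List Letter)} (hc : Closed c) (hg : g ≠ []) :
    innerSqProd (c ++ g) = sqProd c * innerSqProd g := by
  rw [innerSqProd, entries_append, List.map_append, List.prod_append, List.map_map]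
  congr 2
  · refine List.map_congr_left fun x hx => ?_
    rw [if_neg (not_reachesEnd_append hc hg hx)]
  · refine List.map_congr_left fun x _ => ?_
    simp only [Function.comp_apply, reachesEnd_append]

open Classical in
/-- The number of ways to complete the last word. -/
noncomputable def lastWeight (c : List (List Letter)) (α β : ℕ+ →₀ ℕ) : ℚ :=
  if (∀ j, betaCount c j ≤ β j) ∧ ∀ j, alphaCount c j ≤ α j then
    ((β.degree - betaTotal c + lastMarks c).factorial : ℚ) /
      ((lastMarks c).factorial * ∏ j ∈ β.support, ((β j - betaCount c j).factorial : ℚ)) *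
      ∏ j ∈ α.support, ((α j).choose (alphaCount c j) : ℚ)
  else 0

/-- The weighted number of ways to complete a configuration that is placed behind `p` cuts. -/
noncomputable def endConfigWeight (c : List (List Letter)) (p : ℕ) (α β : ℕ+ →₀ ℕ) : ℚ :=
  cutProd c p (c.length - 1) * innerSqProd c * lastWeight c α β

/-- The weighted number of configurations up to the last floor. -/
noncomputable def endCount (d k : ℕ) (α β : ℕ+ →₀ ℕ) : ℚ :=
  ∑ c ∈ endConfigs d k, endConfigWeight c 0 α β

theorem lastWeight_append {c g : List (List Letter)} (hc : Closed c) (hg : g ≠ [])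
    (α β : ℕ+ →₀ ℕ) : lastWeight (c ++ g) α β = lastWeight g α β := by
  have h1 : ∀ j, betaCount (c ++ g) j = betaCount g j := fun j =>
    sum_entries_append_of_reachesEnd hc hg fun l => l.tag = false ∧ l.wt = j
  have h2 : ∀ j, alphaCount (c ++ g) j = alphaCount g j := fun j =>
    sum_entries_append_of_reachesEnd hc hg fun l => l.tag = true ∧ l.wt = j
  have h3 : betaTotal (c ++ g) = betaTotal g :=
    sum_entries_append_of_reachesEnd hc hg fun l => l.tag = false
  have h4 : lastMarks (c ++ g) = lastMarks g :=
    sum_entries_append_of_reachesEnd hc hg fun l => l.tag = false ∧ l.right = 0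
  unfold lastWeight
  rw [h3, h4]
  simp_rw [h1, h2]
  congr 1
  simp only [h1, h2]

theorem endConfigWeight_append {c g : List (List Letter)} (hc : Closed c) (hgc : Closed g)
    (hg : g ≠ []) (α β : ℕ+ →₀ ℕ) :
    endConfigWeight (c ++ g) 0 α β = configWeight c 0 * endConfigWeight g c.length α β := by
  have := List.length_pos_iff.2 hg
  rw [endConfigWeight, lastWeight_append hc hg, innerSqProd_append hc hg, List.length_append,
    show c.length + g.length - 1 = c.length + (g.length - 1) by omega, cutProd_append hc hgc,
    configWeight, endConfigWeight]
  ring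

theorem endCount_eq {d k : ℕ} (hk : d + 1 ≤ k) (α β : ℕ+ →₀ ℕ) :
    endCount d k α β = ∑ g ∈ endBlocks d,
      closedCount (d - endCost g) (k - g.length) * endConfigWeight g (k - g.length) α β := by
  rw [endCount, sum_eq_sum_last_block (G := endBlocks d)
    (C := fun g => closedConfigs (d - endCost g) (k - g.length))]
  · refine Finset.sum_congr rfl fun g hg => ?_
    rw [mem_endBlocks] at hg
    rw [closedCount, Finset.sum_mul]
    refine Finset.sum_congr rfl fun c hc => ?_
    rw [mem_closedConfigs] at hc
    rw [endConfigWeight_append hc.2.1 hg.1.2.1 hg.1.1, hc.1]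
  · intro c
    simp only [mem_closedConfigs, mem_endBlocks, mem_endConfigs]
    constructor
    · rintro ⟨h1, h2, h3, h4⟩
      obtain ⟨c₀, g, rfl, hc₀, hg⟩ := exists_eq_append_indecomposable k c h1 h2
        (by rintro rfl; simp at h1; omega)
      rw [List.length_append] at h1
      rw [endCost_append hc₀ hg.1] at h4
      rw [endInner_append hc₀ hg.1] at h3
      exact ⟨g, ⟨hg, h3.2, by omega⟩, c₀, ⟨by omega, hc₀, h3.1, by omega⟩, rfl⟩
    · rintro ⟨g, ⟨h1, h2, h3⟩, c₀, ⟨h6, h7, h8, h9⟩, rfl⟩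
      refine ⟨?_, h7.append h1.2.1, (endInner_append h7 h1.1).2 ⟨h8, h2⟩, ?_⟩
      · have := length_le_endCost h1
        rw [List.length_append]
        omega
      · rw [endCost_append h7 h1.1]
        omega
  · intro g hg
    exact (mem_endBlocks.1 hg).1
  · intro g _ c hc
    exact (mem_closedConfigs.1 hc).2.1

/-! ### Polynomial functions of several variables -/

/-- On `S`, the function `f` agrees with a polynomial. -/
def PolyOn {σ : Type*} (S : Set (σ → ℕ)) (f : (σ → ℕ) → ℚ) : Prop :=
  ∃ P : MvPolynomial σ ℚ, ∀ x ∈ S, f x = MvPolynomial.eval (fun i => (x i : ℚ)) P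

section PolyOn

variable {σ ι : Type*} {S : Set (σ → ℕ)} {f g : (σ → ℕ) → ℚ}

theorem PolyOn.const (a : ℚ) : PolyOn S fun _ => a := ⟨MvPolynomial.C a, fun _ _ => by simp⟩

theorem PolyOn.coord (i : σ) : PolyOn S fun x => (x i : ℚ) :=
  ⟨MvPolynomial.X i, fun _ _ => by simp⟩

theorem PolyOn.add (hf : PolyOn S f) (hg : PolyOn S g) : PolyOn S fun x => f x + g x := by
  obtain ⟨P, hP⟩ := hf
  obtain ⟨Q, hQ⟩ := hg
  exact ⟨P + Q, fun x hx => by simp [hP x hx, hQ x hx]⟩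

theorem PolyOn.mul (hf : PolyOn S f) (hg : PolyOn S g) : PolyOn S fun x => f x * g x := by
  obtain ⟨P, hP⟩ := hf
  obtain ⟨Q, hQ⟩ := hg
  exact ⟨P * Q, fun x hx => by simp [hP x hx, hQ x hx]⟩

theorem PolyOn.sum (s : Finset ι) {f : ι → (σ → ℕ) → ℚ} (hf : ∀ i ∈ s, PolyOn S (f i)) :
    PolyOn S fun x => ∑ i ∈ s, f i x := by
  classical
  induction s using Finset.induction_on with
  | empty => simpa using PolyOn.const 0
  | insert a s ha ih =>
    simp only [Finset.sum_insert ha]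
    exact (hf a (by simp)).add (ih fun i hi => hf i (by simp [hi]))

theorem PolyOn.prod (s : Finset ι) {f : ι → (σ → ℕ) → ℚ} (hf : ∀ i ∈ s, PolyOn S (f i)) :
    PolyOn S fun x => ∏ i ∈ s, f i x := by
  classical
  induction s using Finset.induction_on with
  | empty => simpa using PolyOn.const 1
  | insert a s ha ih =>
    simp only [Finset.prod_insert ha]
    exact (hf a (by simp)).mul (ih fun i hi => hf i (by simp [hi]))

theorem PolyFrom.comp_polyOn {T : ℕ} {p : ℕ → ℚ} (hp : PolyFrom T p) {n : (σ → ℕ) → ℕ}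
    (hn : PolyOn S fun x => (n x : ℚ)) (h : ∀ x ∈ S, T ≤ n x) : PolyOn S fun x => p (n x) := by
  obtain ⟨q, hq⟩ := hp
  obtain ⟨P, hP⟩ := hn
  refine ⟨Polynomial.aeval P q, fun x hx => ?_⟩
  have h1 : MvPolynomial.eval (fun i => (x i : ℚ)) (Polynomial.aeval P q) =
      Polynomial.eval (MvPolynomial.eval (fun i => (x i : ℚ)) P) q := by
    rw [Polynomial.aeval_def, Polynomial.hom_eval₂, Polynomial.eval, MvPolynomial.algebraMap_eq]
    congr 1
    ext
    simp
  beta_reduce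
  rw [hq _ (h x hx), h1, ← hP x hx]

end PolyOn

theorem polyFrom_descFactorial (k : ℕ) : PolyFrom 0 fun n => (n.descFactorial k : ℚ) :=
  ⟨descPochhammer ℚ k, fun n _ => (descPochhammer_eval_eq_descFactorial ℚ n k).symm⟩

theorem polyFrom_choose (k : ℕ) : PolyFrom 0 fun n => (n.choose k : ℚ) := by
  refine ((polyFrom_descFactorial k).mul (PolyFrom.const 0 (k.factorial : ℚ)⁻¹)).of_eq fun n _ => ?_
  have : (k.factorial : ℚ) ≠ 0 := by positivity
  rw [Nat.descFactorial_eq_factorial_mul_choose]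
  push_cast
  field_simp

theorem betaTotal_le_endCost_add {c : List (List Letter)} (h : EndInner c) :
    betaTotal c ≤ endCost c := by
  refine List.sum_le_sum fun x hx => ?_
  have := (h.1 x hx).2
  split_ifs <;> omega

/-- The weights of the edges of a configuration. -/
noncomputable def weights (c : List (List Letter)) : Finset ℕ+ :=
  ((entries c).map fun x => x.2.wt).toFinset

theorem betaCount_eq_zero {c : List (List Letter)} {j : ℕ+} (h : j ∉ weights c) :
    betaCount c j = 0 := by
  rw [betaCount, List.sum_eq_zero_iff]
  simp only [List.mem_map, forall_exists_index, and_imp]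
  rintro _ x hx rfl
  rw [if_neg]
  rintro ⟨_, _, rfl⟩
  exact h (by simp only [weights, List.mem_toFinset, List.mem_map]; exact ⟨x, hx, rfl⟩)

theorem alphaCount_eq_zero {c : List (List Letter)} {j : ℕ+} (h : j ∉ weights c) :
    alphaCount c j = 0 := by
  rw [alphaCount, List.sum_eq_zero_iff]
  simp only [List.mem_map, forall_exists_index, and_imp]
  rintro _ x hx rfl
  rw [if_neg]
  rintro ⟨_, _, rfl⟩
  exact h (by simp only [weights, List.mem_toFinset, List.mem_map]; exact ⟨x, hx, rfl⟩)

theorem lastWeight_eq {d : ℕ} {c : List (List Letter)} (hb : betaTotal c ≤ d) {α β : ℕ+ →₀ ℕ}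
    (hβ : d ≤ β.degree) :
    lastWeight c α β = (((β.degree - d).factorial : ℚ) / ∏ j ∈ β.support, ((β j).factorial : ℚ)) *
      (((β.degree - betaTotal c + lastMarks c).descFactorial (d - betaTotal c + lastMarks c) : ℚ) *
        ((lastMarks c).factorial : ℚ)⁻¹ *
        (∏ j ∈ weights c, ((β j).descFactorial (betaCount c j) : ℚ)) *
        ∏ j ∈ weights c, ((α j).choose (alphaCount c j) : ℚ)) := by
  classical
  unfold lastWeight
  split_ifs with h
  · have h1 : ∏ j ∈ weights c, ((β j).descFactorial (betaCount c j) : ℚ) =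
        ∏ j ∈ β.support, ((β j).descFactorial (betaCount c j) : ℚ) := by
      have e1 : ∀ j ∈ weights c ∪ β.support, j ∉ weights c →
          ((β j).descFactorial (betaCount c j) : ℚ) = 1 := fun j _ hj => by
        simp [betaCount_eq_zero hj]
      have e2 : ∀ j ∈ weights c ∪ β.support, j ∉ β.support →
          ((β j).descFactorial (betaCount c j) : ℚ) = 1 := fun j _ hj => by
        have := h.1 j
        rw [Finsupp.notMem_support_iff] at hj
        rw [hj] at this ⊢
        rw [Nat.le_zero.1 this]
        simp
      rw [Finset.prod_subset Finset.subset_union_left e1,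
        Finset.prod_subset Finset.subset_union_right e2]
    have h2 : ∏ j ∈ weights c, ((α j).choose (alphaCount c j) : ℚ) =
        ∏ j ∈ α.support, ((α j).choose (alphaCount c j) : ℚ) := by
      have e1 : ∀ j ∈ weights c ∪ α.support, j ∉ weights c →
          ((α j).choose (alphaCount c j) : ℚ) = 1 := fun j _ hj => by
        simp [alphaCount_eq_zero hj]
      have e2 : ∀ j ∈ weights c ∪ α.support, j ∉ α.support →
          ((α j).choose (alphaCount c j) : ℚ) = 1 := fun j _ hj => by
        have := h.2 j
        rw [Finsupp.notMem_support_iff] at hj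
        rw [hj] at this ⊢
        rw [Nat.le_zero.1 this]
        simp
      rw [Finset.prod_subset Finset.subset_union_left e1,
        Finset.prod_subset Finset.subset_union_right e2]
    have h3 : ∏ j ∈ β.support, ((β j).factorial : ℚ) =
        (∏ j ∈ β.support, ((β j - betaCount c j).factorial : ℚ)) *
          ∏ j ∈ β.support, ((β j).descFactorial (betaCount c j) : ℚ) := by
      rw [← Finset.prod_mul_distrib]
      refine Finset.prod_congr rfl fun j _ => ?_
      rw [← Nat.factorial_mul_descFactorial (h.1 j)]
      push_cast
      ring
    have h4 : ((β.degree - betaTotal c + lastMarks c).factorial : ℚ) = (β.degree - d).factorial *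
        ((β.degree - betaTotal c + lastMarks c).descFactorial (d - betaTotal c + lastMarks c)) := by
      rw [← Nat.factorial_mul_descFactorial (n := β.degree - betaTotal c + lastMarks c)
        (k := d - betaTotal c + lastMarks c) (by omega)]
      rw [show β.degree - betaTotal c + lastMarks c - (d - betaTotal c + lastMarks c) =
        β.degree - d by omega]
      push_cast
      ring
    have h5 : ∏ j ∈ β.support, ((β j).descFactorial (betaCount c j) : ℚ) ≠ 0 := by
      refine Finset.prod_ne_zero_iff.2 fun j _ => ?_
      rw [Nat.cast_ne_zero, Ne, Nat.descFactorial_eq_zero_iff_lt, not_lt]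
      exact h.1 j
    have h6 : ∏ j ∈ β.support, ((β j - betaCount c j).factorial : ℚ) ≠ 0 :=
      Finset.prod_ne_zero_iff.2 fun j _ => by positivity
    have h7 : ((lastMarks c).factorial : ℚ) ≠ 0 := by positivity
    rw [h1, h2, h3, h4]
    field_simp
  · rw [not_and_or] at h
    symm
    rcases h with h | h
    · push Not at h
      obtain ⟨j, hj⟩ := h
      rw [Finset.prod_eq_zero (i := j) (s := weights c)
        (f := fun j => ((β j).descFactorial (betaCount c j) : ℚ))]
      · simp
      · by_contra h'
        rw [betaCount_eq_zero h'] at hj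
        omega
      · rw [Nat.cast_eq_zero, Nat.descFactorial_eq_zero_iff_lt]
        exact hj
    · push Not at h
      obtain ⟨j, hj⟩ := h
      rw [Finset.prod_eq_zero (i := j) (s := weights c)
        (f := fun j => ((α j).choose (alphaCount c j) : ℚ))]
      · simp
      · by_contra h'
        rw [alphaCount_eq_zero h'] at hj
        omega
      · rw [Nat.cast_eq_zero, Nat.choose_eq_zero_iff]
        exact hj

/-! ### Vectors and sequences -/

theorem toSeq_apply {m : ℕ} (a : Fin m → ℕ) (j : ℕ+) :
    toSeq a j = ∑ i : Fin m, if Nat.succPNat (i : ℕ) = j then a i else 0 := by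
  simp [toSeq, Finsupp.finsetSum_apply, Finsupp.single_apply]

theorem toSeq_succPNat {m : ℕ} (a : Fin m → ℕ) (i : Fin m) : toSeq a (Nat.succPNat i) = a i := by
  rw [toSeq_apply, Finset.sum_eq_single i]
  · simp
  · intro k _ hk
    rw [if_neg fun h => hk (Fin.ext (Nat.succPNat_injective h))]
  · simp

theorem toSeq_prod {m : ℕ} (a : Fin m → ℕ) {M : Type*} [CommMonoid M] (f : ℕ+ → ℕ → M)
    (hf : ∀ j, f j 0 = 1) : (toSeq a).prod f = ∏ i : Fin m, f (Nat.succPNat i) (a i) := by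
  classical
  have h : (toSeq a).support ⊆ univ.image fun i : Fin m => Nat.succPNat (i : ℕ) := by
    intro j hj
    rw [Finsupp.mem_support_iff, toSeq_apply] at hj
    obtain ⟨i, _, hi⟩ := Finset.exists_ne_zero_of_sum_ne_zero hj
    rw [Finset.mem_image]
    refine ⟨i, Finset.mem_univ _, ?_⟩
    by_contra h'
    simp [h'] at hi
  rw [Finsupp.prod_of_support_subset _ h _ fun j _ => hf j, Finset.prod_image]
  · exact Finset.prod_congr rfl fun i _ => by rw [toSeq_succPNat]
  · intro i _ k _ e
    exact Fin.ext (Nat.succPNat_injective e)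

theorem seqDegree_toSeq {m : ℕ} (a : Fin m → ℕ) :
    seqDegree (toSeq a) = ∑ i : Fin m, ((i : ℕ) + 1) * a i := by
  exact toSeq_prod a (M := Multiplicative ℕ) (fun j k => Multiplicative.ofAdd ((j : ℕ) * k))
    fun j => congrArg Multiplicative.ofAdd (mul_zero _)

theorem degree_toSeq {m : ℕ} (a : Fin m → ℕ) : (toSeq a).degree = ∑ i : Fin m, a i := by
  exact toSeq_prod a (M := Multiplicative ℕ) (fun j k => Multiplicative.ofAdd k) fun j => rfl

/-! ### The count is a node polynomial away from the smallest degree -/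

theorem polyOn_endConfigWeight {m m' d : ℕ} {g : List (List Letter)} (hg : g ∈ endBlocks d)
    {S : Set (Fin m ⊕ Fin m' → ℕ)}
    (hS : ∀ x ∈ S, d ≤ ∑ j, x (Sum.inr j) ∧
      d < seqDegree (toSeq (x ∘ Sum.inl)) + seqDegree (toSeq (x ∘ Sum.inr))) :
    ∃ f, PolyOn S f ∧ ∀ x ∈ S,
      closedCount (d - endCost g)
          (seqDegree (toSeq (x ∘ Sum.inl)) + seqDegree (toSeq (x ∘ Sum.inr)) - g.length) *
        endConfigWeight g
          (seqDegree (toSeq (x ∘ Sum.inl)) + seqDegree (toSeq (x ∘ Sum.inr)) - g.length)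
          (toSeq (x ∘ Sum.inl)) (toSeq (x ∘ Sum.inr)) =
        (((∑ j, x (Sum.inr j) - d).factorial : ℚ) / ∏ j, ((x (Sum.inr j)).factorial : ℚ)) * f x := by
  rw [mem_endBlocks] at hg
  obtain ⟨h1, h2, h3⟩ := hg
  have h4 := length_le_endCost h1
  have h5 : PolyFrom (d + 1) fun k =>
      closedCount (d - endCost g) (k - g.length) * cutProd g (k - g.length) (g.length - 1) := by
    refine PolyFrom.mul ?_ (polyFrom_cutProd (by omega) (by omega) fun h hh => ?_)
    · exact (polyFrom_closedCount _).comp_sub (by omega) (by omega)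
    · have := endCutWeight_le_endCost h1 (g := h) (by omega)
      rw [endCutWeight_of_lt (by omega)] at this
      omega
  have hdeg : PolyOn S fun x => ((seqDegree (toSeq (x ∘ Sum.inl)) +
      seqDegree (toSeq (x ∘ Sum.inr)) : ℕ) : ℚ) := by
    simp only [seqDegree_toSeq]
    push_cast
    exact (PolyOn.sum _ fun i _ => (PolyOn.const _).mul (PolyOn.coord _)).add
      (PolyOn.sum _ fun i _ => (PolyOn.const _).mul (PolyOn.coord _))
  have hbeta : PolyOn S fun x => ((∑ j, x (Sum.inr j) : ℕ) : ℚ) := by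
    push_cast
    exact PolyOn.sum _ fun i _ => PolyOn.coord _
  have hα : ∀ j, PolyOn S fun x => ((toSeq (x ∘ Sum.inl) j : ℕ) : ℚ) := fun j => by
    simp only [toSeq_apply]
    push_cast
    refine PolyOn.sum _ fun i _ => ?_
    split_ifs
    exacts [PolyOn.coord _, PolyOn.const 0]
  have hβ : ∀ j, PolyOn S fun x => ((toSeq (x ∘ Sum.inr) j : ℕ) : ℚ) := fun j => by
    simp only [toSeq_apply]
    push_cast
    refine PolyOn.sum _ fun i _ => ?_
    split_ifs
    exacts [PolyOn.coord _, PolyOn.const 0]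
  have hb : betaTotal g ≤ d := (betaTotal_le_endCost_add h2).trans h3
  have h6 : PolyFrom d fun n => ((n - betaTotal g + lastMarks g).descFactorial
      (d - betaTotal g + lastMarks g) : ℚ) := by
    have h7 : PolyFrom 0 fun n => ((n + lastMarks g).descFactorial
        (d - betaTotal g + lastMarks g) : ℚ) := by
      obtain ⟨p, hp⟩ := polyFrom_descFactorial (d - betaTotal g + lastMarks g)
      refine ⟨p.comp (Polynomial.X + Polynomial.C (lastMarks g : ℚ)), fun n _ => ?_⟩
      rw [Polynomial.eval_comp]
      simpa using hp (n + lastMarks g) (Nat.zero_le _)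
    exact h7.comp_sub hb (by omega)
  refine ⟨_, ((h5.comp_polyOn hdeg fun x hx => (hS x hx).2).mul (PolyOn.const (innerSqProd g))).mul
    ((((h6.comp_polyOn hbeta fun x hx => (hS x hx).1).mul
      (PolyOn.const ((lastMarks g).factorial : ℚ)⁻¹)).mul
      (PolyOn.prod (weights g) fun j _ =>
        (polyFrom_descFactorial (betaCount g j)).comp_polyOn (hβ j) fun _ _ => Nat.zero_le _)).mul
      (PolyOn.prod (weights g) fun j _ =>
        (polyFrom_choose (alphaCount g j)).comp_polyOn (hα j) fun _ _ => Nat.zero_le _)),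
    fun x hx => ?_⟩
  have h8 := (hS x hx).1
  have h9 := degree_toSeq (x ∘ Sum.inr)
  simp only [Function.comp_apply] at h9
  have h10 := toSeq_prod (x ∘ Sum.inr) (M := ℚ) (fun _ k => (k.factorial : ℚ)) (by simp)
  simp only [Finsupp.prod, Function.comp_apply] at h10
  rw [endConfigWeight, lastWeight_eq hb (by rw [h9]; exact h8), h9, h10]
  ring

theorem exists_polynomial_endCount (d m m' : ℕ) :
    ∃ P : MvPolynomial (Fin m ⊕ Fin m') ℚ, ∀ x : Fin m ⊕ Fin m' → ℕ,
      d ≤ ∑ j, x (Sum.inr j) →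
      d < seqDegree (toSeq (x ∘ Sum.inl)) + seqDegree (toSeq (x ∘ Sum.inr)) →
      endCount d (seqDegree (toSeq (x ∘ Sum.inl)) + seqDegree (toSeq (x ∘ Sum.inr)))
        (toSeq (x ∘ Sum.inl)) (toSeq (x ∘ Sum.inr)) =
      (((∑ j, x (Sum.inr j) - d).factorial : ℚ) / ∏ j, ((x (Sum.inr j)).factorial : ℚ)) *
        MvPolynomial.eval (fun i => (x i : ℚ)) P := by
  classical
  let S : Set (Fin m ⊕ Fin m' → ℕ) := {x | d ≤ ∑ j, x (Sum.inr j) ∧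
    d < seqDegree (toSeq (x ∘ Sum.inl)) + seqDegree (toSeq (x ∘ Sum.inr))}
  have h : ∀ g : endBlocks d, _ := fun g => polyOn_endConfigWeight g.2 (S := S) fun x hx => hx
  choose f hf hfe using h
  obtain ⟨P, hP⟩ := PolyOn.sum univ fun g _ => hf g
  refine ⟨P, fun x h1 h2 => ?_⟩
  rw [endCount_eq h2, ← hP x ⟨h1, h2⟩]
  beta_reduce
  rw [Finset.mul_sum, ← Finset.sum_coe_sort]
  exact Finset.sum_congr rfl fun g _ => hfe g x ⟨h1, h2⟩

/-! ### The smallest degree -/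

theorem endLetterCost_eq_letterCost {n : ℕ} {x : ℕ × Letter}
    (h : ReachesEnd n x → (x.2.wt : ℕ) = 1) : endLetterCost n x = letterCost x.2 := by
  unfold endLetterCost letterCost
  split_ifs with hr
  · rw [h hr]
    omega
  · rfl

theorem wt_eq_one_of_not_heavy {c : List (List Letter)} (h : ¬ Heavy c) {x : ℕ × Letter}
    (hx : x ∈ entries c) (hr : ReachesEnd c.length x) : (x.2.wt : ℕ) = 1 := by
  by_contra h'
  have := x.2.wt.pos
  exact h ⟨x, hx, hr, by omega⟩

theorem mem_endConfigs_of_not_heavy {d n : ℕ} {c : List (List Letter)}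
    (hc : c ∈ closedConfigs d n) (h : ¬ Heavy c) : c ∈ endConfigs d n := by
  rw [mem_closedConfigs] at hc
  obtain ⟨h1, h2, h3, h4⟩ := hc
  have h5 : ∀ x ∈ entries c, endLetterCost c.length x = letterCost x.2 := fun x hx =>
    endLetterCost_eq_letterCost (wt_eq_one_of_not_heavy h hx)
  refine mem_endConfigs.2 ⟨h1, h2, ⟨fun x hx => ?_, fun w hw => ?_⟩, ?_⟩
  · rw [h5 x hx]
    exact ⟨fun h6 => by simp [(h3 x hx).1] at h6, (h3 x hx).2⟩
  · have h6 : ∀ l ∈ w, l.key = 0 := by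
      intro l hl
      obtain ⟨i, hi, rfl⟩ := List.getElem_of_mem (List.mem_of_getLast? hw)
      have := (h3 (i, l) (mem_entries.2 ⟨hi, hl⟩)).1
      dsimp only at this
      simp [Letter.key, this]
    exact List.Pairwise.imp_of_mem (R := fun _ _ => True)
      (fun {a b} ha hb _ => by rw [h6 a ha, h6 b hb]) (by simp [List.pairwise_iff_getElem])
  · rw [endCost, List.map_congr_left h5, ← h4, cost]

theorem mem_closedConfigs_of_mem_endConfigs {d n : ℕ} {c : List (List Letter)}
    (hc : c ∈ endConfigs d n)
    (h : ∀ x ∈ entries c, ReachesEnd c.length x → x.2.tag = false ∧ x.2.wt = 1) :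
    c ∈ closedConfigs d n ∧ ¬ Heavy c := by
  rw [mem_endConfigs] at hc
  obtain ⟨h1, h2, h3, h4⟩ := hc
  have h5 : ∀ x ∈ entries c, endLetterCost c.length x = letterCost x.2 := fun x hx =>
    endLetterCost_eq_letterCost fun hr => by simp [(h x hx hr).2]
  refine ⟨mem_closedConfigs.2 ⟨h1, h2, fun x hx => ⟨?_, ?_⟩, ?_⟩, ?_⟩
  · by_contra h6
    have h7 := (h3.1 x hx).1 (by simpa using h6)
    have h8 := h2 x hx
    exact h6 (h x hx (by simp only [ReachesEnd]; omega)).1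
  · rw [← h5 x hx]
    exact (h3.1 x hx).2
  · rw [← h4, endCost, List.map_congr_left h5, cost]
  · rintro ⟨x, hx, hr, hw⟩
    simp [(h x hx hr).2] at hw

theorem lastWeight_single {d n : ℕ} {c : List (List Letter)} (hn : 1 ≤ n)
    (hc : c ∈ closedConfigs d n) (h : ¬ Heavy c) :
    lastWeight c 0 (Finsupp.single 1 n) =
      gapCount n (cutWeight c (n - 1)) (marks c (n - 1)) := by
  rw [mem_closedConfigs] at hc
  obtain ⟨h1, h2, h3, h4⟩ := hc
  have hα : ∀ j, alphaCount c j = 0 := fun j => by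
    rw [alphaCount, List.sum_eq_zero_iff]
    simp only [List.mem_map, forall_exists_index, and_imp]
    rintro _ x hx rfl
    simp [(h3 x hx).1]
  have hβ : ∀ j ≠ 1, betaCount c j = 0 := fun j hj => by
    rw [betaCount, List.sum_eq_zero_iff]
    simp only [List.mem_map, forall_exists_index, and_imp]
    rintro _ x hx rfl
    rw [if_neg]
    rintro ⟨hr, _, rfl⟩
    exact hj (PNat.coe_eq_one_iff.1 (wt_eq_one_of_not_heavy h hx hr))
  have hβ1 : betaCount c 1 = betaTotal c := by
    rw [betaCount, betaTotal]
    congr 1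
    refine List.map_congr_left fun x hx => if_congr ?_ rfl rfl
    refine and_congr_right fun hr => and_iff_left ?_
    exact PNat.coe_eq_one_iff.1 (wt_eq_one_of_not_heavy h hx hr)
  have hX : cutWeight c (n - 1) = betaTotal c := by
    rw [cutWeight, betaTotal]
    congr 1
    refine List.map_congr_left fun x hx => ?_
    have hcl := h2 x hx
    have hcr : Crosses x (n - 1) ↔ ReachesEnd c.length x := by
      simp only [Crosses, ReachesEnd]
      omega
    by_cases hr : ReachesEnd c.length x
    · rw [if_pos (hcr.2 hr), if_pos ⟨hr, (h3 x hx).1⟩, wt_eq_one_of_not_heavy h hx hr]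
    · rw [if_neg (mt hcr.1 hr), if_neg fun h => hr h.1]
  have hm : marks c (n - 1) = lastMarks c := by
    rw [marks, lastMarks]
    congr 1
    refine List.map_congr_left fun x hx => if_congr ?_ rfl rfl
    have hcl := h2 x hx
    simp only [(h3 x hx).1, ReachesEnd, true_and]
    omega
  classical
  rw [hX, hm, lastWeight, gapCount]
  refine if_congr ?_ ?_ rfl
  · constructor
    · rintro ⟨h5, -⟩
      simpa [hβ1] using h5 1
    · refine fun h5 => ⟨fun j => ?_, fun j => by simp [hα]⟩
      by_cases hj : j = 1
      · subst hj
        simpa [hβ1] using h5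
      · simp [hβ j hj]
  · rw [Finsupp.support_single (1 : ℕ+) (show n ≠ 0 by omega), Finset.prod_singleton, Finsupp.degree_single]
    simp only [Finsupp.support_zero, Finset.prod_empty, mul_one, Finsupp.single_eq_same, hβ1]
    rw [add_comm (n - betaTotal c), Nat.cast_add_choose]

open Classical in
theorem endCount_single {d n : ℕ} (hn : 1 ≤ n) :
    endCount d n 0 (Finsupp.single 1 n) =
      ∑ c ∈ closedConfigs d n with ¬ Heavy c, configWeight c 0 := by
  rw [endCount, ← Finset.sum_subset (s₁ := {c ∈ closedConfigs d n | ¬ Heavy c})]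
  · refine Finset.sum_congr rfl fun c hc => ?_
    rw [Finset.mem_filter] at hc
    have h1 := mem_closedConfigs.1 hc.1
    rw [endConfigWeight, lastWeight_single hn hc.1 hc.2, configWeight, h1.1, cutProd, cutProd]
    have h2 : innerSqProd c = sqProd c := by
      rw [innerSqProd, sqProd]
      congr 1
      refine List.map_congr_left fun x hx => ?_
      split_ifs with hr
      · simp [wt_eq_one_of_not_heavy hc.2 hx hr]
      · rfl
    rw [h2]
    obtain ⟨k, rfl⟩ : ∃ k, n = k + 1 := ⟨n - 1, by omega⟩
    rw [Finset.prod_range_succ, Nat.add_sub_cancel, zero_add]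
    ring
  · intro c hc
    rw [Finset.mem_filter] at hc
    exact mem_endConfigs_of_not_heavy hc.1 hc.2
  · intro c hc hc'
    rw [endConfigWeight, lastWeight, if_neg, mul_zero]
    rintro ⟨h1, h2⟩
    refine hc' (Finset.mem_filter.2 (mem_closedConfigs_of_mem_endConfigs hc fun x hx hr => ?_))
    have htag : x.2.tag = false := by
      by_contra htag
      have h3 : 1 ≤ alphaCount c x.2.wt := by
        refine le_trans ?_ (List.le_sum_of_mem (List.mem_map.2 ⟨x, hx, rfl⟩))
        rw [if_pos ⟨hr, by simpa using htag, rfl⟩]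
      have := h2 x.2.wt
      rw [Finsupp.zero_apply] at this
      omega
    refine ⟨htag, ?_⟩
    by_contra hw
    have h3 : 1 ≤ betaCount c x.2.wt := by
      refine le_trans ?_ (List.le_sum_of_mem (List.mem_map.2 ⟨x, hx, rfl⟩))
      rw [if_pos ⟨hr, htag, rfl⟩]
    have := h1 x.2.wt
    rw [Finsupp.single_eq_of_ne hw] at this
    omega

theorem polynomial_eq_of_eval_eq {p q : Polynomial ℚ} {T : ℕ}
    (h : ∀ n : ℕ, T ≤ n → p.eval (n : ℚ) = q.eval (n : ℚ)) : p = q := by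
  refine Polynomial.eq_of_infinite_eval_eq p q ?_
  refine ((Set.Ici_infinite T).image (f := fun n : ℕ => (n : ℚ))
    Nat.cast_injective.injOn).mono ?_
  rintro _ ⟨n, hn, rfl⟩
  exact h n hn

theorem toSeq_zero (m : ℕ) : toSeq (0 : Fin m → ℕ) = 0 := by
  simp [toSeq]

theorem toSeq_single (m n : ℕ) :
    toSeq (Pi.single 0 n : Fin (m + 1) → ℕ) = Finsupp.single 1 n := by
  rw [toSeq, Finset.sum_eq_single 0]
  · rw [Pi.single_eq_same]
    rfl
  · intro i _ hi
    rw [Pi.single_eq_of_ne hi, Finsupp.single_zero]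
  · simp

/-- The count of configurations is given by a polynomial whenever `|β| ≥ d`. -/
theorem exists_polynomial_endCount_of_le {d : ℕ} (hd : 1 ≤ d) (m m' : ℕ) :
    ∃ P : MvPolynomial (Fin m ⊕ Fin (m' + 1)) ℚ, ∀ (α : Fin m → ℕ) (β : Fin (m' + 1) → ℕ),
      d ≤ ∑ j, β j →
      endCount d (seqDegree (toSeq α) + seqDegree (toSeq β)) (toSeq α) (toSeq β) =
        (((∑ j, β j - d).factorial : ℚ) / ∏ j, ((β j).factorial : ℚ)) *
          MvPolynomial.eval (Sum.elim (fun i => (α i : ℚ)) fun j => (β j : ℚ)) P := by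
  classical
  obtain ⟨P, hP⟩ := exists_polynomial_endCount d m (m' + 1)
  have hP' : ∀ (α : Fin m → ℕ) (β : Fin (m' + 1) → ℕ), d ≤ ∑ j, β j →
      d < seqDegree (toSeq α) + seqDegree (toSeq β) →
      endCount d (seqDegree (toSeq α) + seqDegree (toSeq β)) (toSeq α) (toSeq β) =
        (((∑ j, β j - d).factorial : ℚ) / ∏ j, ((β j).factorial : ℚ)) *
          MvPolynomial.eval (Sum.elim (fun i => (α i : ℚ)) fun j => (β j : ℚ)) P := by
    intro α β h1 h2
    have h3 := hP (Sum.elim α β) h1 h2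
    have h4 : (fun i => ((Sum.elim α β i : ℕ) : ℚ)) =
        Sum.elim (fun i => (α i : ℚ)) fun j => (β j : ℚ) := by
      ext (i | i) <;> rfl
    rw [h4] at h3
    exact h3
  refine ⟨P, fun α β hβ => ?_⟩
  by_cases hk : d < seqDegree (toSeq α) + seqDegree (toSeq β)
  · exact hP' α β hβ hk
  have hβ2 : seqDegree (toSeq β) = ∑ j, β j + ∑ j : Fin (m' + 1), (j : ℕ) * β j := by
    rw [seqDegree_toSeq, ← Finset.sum_add_distrib]
    exact Finset.sum_congr rfl fun j _ => by ring
  have hα0 : α = 0 := by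
    have h1 : ∑ i : Fin m, ((i : ℕ) + 1) * α i = 0 := by
      rw [← seqDegree_toSeq]
      omega
    rw [Finset.sum_eq_zero_iff] at h1
    funext i
    simpa using h1 i (Finset.mem_univ _)
  have hβ0 : β = Pi.single 0 d := by
    have h1 : ∑ j : Fin (m' + 1), (j : ℕ) * β j = 0 := by omega
    have h0 : ∑ j, β j = d := by omega
    rw [Finset.sum_eq_zero_iff] at h1
    have h2 : ∀ j, j ≠ 0 → β j = 0 := fun j hj => by
      have := h1 j (Finset.mem_univ _)
      rw [Nat.mul_eq_zero] at this
      exact this.resolve_left fun h => hj (Fin.ext h)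
    rw [Finset.sum_eq_single 0 (fun j _ hj => h2 j hj) (by simp)] at h0
    funext j
    by_cases hj : j = 0
    · subst hj
      simp [h0]
    · rw [h2 j hj, Pi.single_eq_of_ne hj]
  subst hα0 hβ0
  obtain ⟨p, hp'⟩ := polyFrom_light hd
  have hp : ∀ n : ℕ, d ≤ n → endCount d n 0 (Finsupp.single 1 n) = p.eval (n : ℚ) :=
    fun n hn => (endCount_single (by omega)).trans (hp' n hn)
  have hline : ∀ n : ℕ, d < n → endCount d n 0 (Finsupp.single 1 n) =
      (((n - d).factorial : ℚ) / (n.factorial : ℚ)) *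
        MvPolynomial.eval (Sum.elim (fun _ => (0 : ℚ))
          fun j => ((Pi.single 0 n : Fin (m' + 1) → ℕ) j : ℚ)) P := by
    intro n hn
    have h1 := hP' 0 (Pi.single 0 n)
    simp only [Finset.sum_pi_single', Finset.mem_univ, if_true, toSeq_zero, toSeq_single] at h1
    have h2 : seqDegree 0 + seqDegree (Finsupp.single 1 n) = n := by simp [seqDegree]
    rw [h2] at h1
    rw [h1 hn.le hn]
    congr 2
    rw [Fin.prod_univ_succ]
    simp
  let v : Fin m ⊕ Fin (m' + 1) → Polynomial ℚ :=
    Sum.elim (fun _ => 0) fun j => if j = 0 then Polynomial.X else 0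
  have hq : ∀ n : ℕ, (MvPolynomial.aeval v P).eval (n : ℚ) =
      MvPolynomial.eval (Sum.elim (fun _ => (0 : ℚ))
        fun j => ((Pi.single 0 n : Fin (m' + 1) → ℕ) j : ℚ)) P := by
    intro n
    have h1 : (Polynomial.evalRingHom (n : ℚ)).comp (MvPolynomial.aeval v : _ →ₐ[ℚ] _).toRingHom =
        MvPolynomial.eval (Sum.elim (fun _ => (0 : ℚ))
          fun j => ((Pi.single 0 n : Fin (m' + 1) → ℕ) j : ℚ)) := by
      refine MvPolynomial.ringHom_ext (fun r => by simp) ?_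
      rintro (i | j)
      · simp [v]
      · by_cases hj : j = 0 <;> simp [v, hj]
    exact RingHom.congr_fun h1 P
  have hpq : p * descPochhammer ℚ d = MvPolynomial.aeval v P := by
    refine polynomial_eq_of_eval_eq (T := d + 1) fun n hn => ?_
    rw [hq, Polynomial.eval_mul, ← hp n (by omega), hline n (by omega),
      descPochhammer_eval_eq_descFactorial, ← Nat.factorial_mul_descFactorial (show d ≤ n by omega)]
    have h1 : ((n - d).factorial : ℚ) ≠ 0 := by positivity
    have h2 : (n.descFactorial d : ℚ) ≠ 0 := by
      rw [Nat.cast_ne_zero, Ne, Nat.descFactorial_eq_zero_iff_lt]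
      omega
    push_cast
    field_simp
  have h1 : seqDegree 0 + seqDegree (Finsupp.single 1 d) = d := by simp [seqDegree]
  have h2 := hq d
  rw [← hpq, Polynomial.eval_mul, ← hp d le_rfl,
    descPochhammer_eval_eq_descFactorial, Nat.descFactorial_self] at h2
  have h3 : ∏ j, (((Pi.single 0 d : Fin (m' + 1) → ℕ) j).factorial : ℚ) = d.factorial := by
    rw [Fin.prod_univ_succ]
    simp
  have h4 : ∑ j, (Pi.single 0 d : Fin (m' + 1) → ℕ) j = d := by simp
  have h5 : (d.factorial : ℚ) ≠ 0 := by positivity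
  rw [toSeq_zero, toSeq_single, h1, h3, h4, Nat.sub_self, Nat.factorial_zero]
  simp only [Pi.zero_apply, Nat.cast_zero]
  rw [← h2]
  field_simp
  simp

/-! ### Markings as words -/

/-- A vertex that is not a floor: the source of its incoming edge, the weight of its edges and,
unless it is a `β`-vertex (`false`) or an `α`-vertex (`true`), the target of its outgoing edge. -/
abbrev Mark (d : ℕ) := Fin d × ℕ+ × (Fin d ⊕ Bool)

/-- The kinds of vertices of the extended graph. -/
abbrev Label (d : ℕ) := Fin d ⊕ Mark d

namespace Mark

variable {d : ℕ}

/-- The target of the outgoing edge; for `α`- and `β`-vertices, a place behind the last floor. -/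
def tgt (x : Mark d) : ℕ := Sum.elim (fun t : Fin d => (t : ℕ)) (fun _ => d) x.2.2

/-- Being an `α`-vertex. -/
abbrev IsAlpha (x : Mark d) : Prop := x.2.2 = Sum.inr true

/-- The `α`-vertices come after all other vertices, ordered by weights. -/
def key (x : Mark d) : ℕ := if x.IsAlpha then x.2.1 else 0

end Mark

/-- The edges between vertices of given kinds. -/
def Label.Edge {d : ℕ} : Label d → Label d → ℕ+ → Prop
  | .inl i, .inr x, w => x.1 = i ∧ x.2.1 = w
  | .inr x, .inl t, w => x.2.2 = Sum.inl t ∧ x.2.1 = w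
  | _, _, _ => False

/-- The condition on two vertices, the first one smaller than the second one, in a marking. -/
def Label.Lt {d : ℕ} : Label d → Label d → Prop
  | .inl i, .inl j => i < j
  | .inl i, .inr y => y.tgt ≠ i
  | .inr x, .inl j => x.1 ≠ j ∧ ¬ x.IsAlpha
  | .inr x, .inr y => x.key ≤ y.key

section Vertex

open FloorDiagram FloorDiagram.Compatible

variable {d : ℕ} {D : FloorDiagram d} {α β : ℕ+ →₀ ℕ} {C : D.Compatible α β}

/-- The kind of a vertex. -/
def label : C.Vertex → Label d
  | .floor i => .inl i
  | .mid e => .inr (e.1.1, e.1.2.2, .inl e.1.2.1)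
  | .beta i j _ => .inr (i, j, .inr false)
  | .alpha i j _ => .inr (i, j, .inr true)

theorem edge_iff {u v : C.Vertex} {w : ℕ+} : C.Edge u v w ↔ (label u).Edge (label v) w := by
  constructor
  · rintro (_ | _ | _ | _) <;> simp [label, Label.Edge]
  · intro h
    cases u <;> cases v <;> simp only [label, Label.Edge, reduceCtorEq, false_and] at h
    · obtain ⟨rfl, rfl⟩ := h
      exact .toMid _
    · obtain ⟨rfl, rfl⟩ := h
      exact .beta _ _ _
    · obtain ⟨rfl, rfl⟩ := h
      exact .alpha _ _ _
    · obtain ⟨h, rfl⟩ := h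
      obtain rfl := Sum.inl_injective h
      exact .fromMid _

theorem isAlpha_iff {v : C.Vertex} : v.IsAlpha ↔ ∃ x : Mark d, label v = .inr x ∧ x.IsAlpha := by
  cases v <;> simp [label, Vertex.IsAlpha]

theorem le_support_left (C : D.Compatible α β) {i : Fin d} {j : ℕ+} (h : C.a i j ≠ 0) :
    j ∈ α.support := by
  rw [Finsupp.mem_support_iff, ← C.sum_a, Finsupp.finsetSum_apply]
  exact (Finset.sum_pos' (fun _ _ => Nat.zero_le _)
    ⟨i, Finset.mem_univ _, Nat.pos_of_ne_zero h⟩).ne'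

theorem le_support_right (C : D.Compatible α β) {i : Fin d} {j : ℕ+} (h : C.b i j ≠ 0) :
    j ∈ β.support := by
  rw [Finsupp.mem_support_iff, ← C.sum_b, Finsupp.finsetSum_apply]
  exact (Finset.sum_pos' (fun _ _ => Nat.zero_le _)
    ⟨i, Finset.mem_univ _, Nat.pos_of_ne_zero h⟩).ne'

instance (C : D.Compatible α β) : Finite C.Vertex := by
  let f : (Fin d ⊕ D.edges) ⊕ (Σ i : Fin d, Σ j : β.support, Fin (C.b i j)) ⊕
      (Σ i : Fin d, Σ j : α.support, Fin (C.a i j)) → C.Vertex :=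
    Sum.elim (Sum.elim .floor .mid)
      (Sum.elim (fun x => .beta x.1 x.2.1 x.2.2) (fun x => .alpha x.1 x.2.1 x.2.2))
  refine Finite.of_surjective f fun v => ?_
  cases v with
  | floor i => exact ⟨.inl (.inl i), rfl⟩
  | mid e => exact ⟨.inl (.inr e), rfl⟩
  | beta i j k => exact ⟨.inr (.inl ⟨i, ⟨j, le_support_right C k.pos.ne'⟩, k⟩), rfl⟩
  | alpha i j k => exact ⟨.inr (.inr ⟨i, ⟨j, le_support_left C k.pos.ne'⟩, k⟩), rfl⟩

theorem card_isAlpha (C : D.Compatible α β) : Nat.card {v : C.Vertex // v.IsAlpha} = α.degree := by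
  let e : {v : C.Vertex // v.IsAlpha} ≃ Σ i : Fin d, Σ j : α.support, Fin (C.a i j) :=
    { toFun := fun v => match v with
        | ⟨.alpha i j k, _⟩ => ⟨i, ⟨j, le_support_left C k.pos.ne'⟩, k⟩
      invFun := fun x => ⟨.alpha x.1 x.2.1 x.2.2, trivial⟩
      left_inv := by
        rintro ⟨(_ | _ | _ | _), h⟩
        · exact h.elim
        · exact h.elim
        · exact h.elim
        · rfl
      right_inv := fun _ => rfl }
  rw [Nat.card_congr e, Nat.card_sigma]
  simp only [Nat.card_sigma, Nat.card_fin]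
  have h : ∀ i, ∑ j : α.support, C.a i j = ∑ j ∈ α.support, C.a i j := fun i =>
    Finset.sum_coe_sort α.support fun j => C.a i j
  simp only [h]
  rw [Finset.sum_comm, Finsupp.degree_apply]
  refine Finset.sum_congr rfl fun j _ => ?_
  conv_rhs => rw [← C.sum_a, Finsupp.finsetSum_apply]

theorem isAlpha_of_isAlpha_map {M₁ M₂ : D.Marking α β} (φ : M₁.C.Vertex ≃ M₂.C.Vertex)
    (h : ∀ u v, M₁.lt u v ↔ M₂.lt (φ u) (φ v)) {v : M₁.C.Vertex} (hv : (φ v).IsAlpha) :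
    v.IsAlpha := by
  by_contra hn
  have := M₂.isStrictTotalOrder
  have h1 : ∀ u : M₁.C.Vertex, u.IsAlpha → (φ u).IsAlpha := by
    intro u hu
    by_contra hu'
    exact asymm_of M₂.lt ((h v u).1 (M₁.lt_alpha v u hn hu)) (M₂.lt_alpha _ _ hu' hv)
  let f : {u : M₁.C.Vertex // u.IsAlpha} → {u : M₂.C.Vertex // u.IsAlpha} :=
    fun u => ⟨φ u, h1 u u.2⟩
  have hf : Function.Injective f := fun a b e =>
    Subtype.ext (φ.injective (congrArg Subtype.val e))
  have hs := hf.surjective_of_finite (Finite.card_eq.1 (by rw [card_isAlpha, card_isAlpha])).some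
  obtain ⟨u, hu⟩ := hs ⟨φ v, hv⟩
  have : (u : M₁.C.Vertex) = v := φ.injective (congrArg Subtype.val hu)
  exact hn (this ▸ u.2)

theorem label_map {M₁ M₂ : D.Marking α β} (φ : M₁.C.Vertex ≃ M₂.C.Vertex)
    (h₁ : ∀ i, φ (.floor i) = .floor i) (h₂ : ∀ u v w, M₁.C.Edge u v w ↔ M₂.C.Edge (φ u) (φ v) w)
    (h₃ : ∀ u v, M₁.lt u v ↔ M₂.lt (φ u) (φ v)) (v : M₁.C.Vertex) : label (φ v) = label v := by
  have hα : v.IsAlpha ↔ (φ v).IsAlpha := by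
    refine ⟨fun h => ?_, isAlpha_of_isAlpha_map φ h₃⟩
    refine isAlpha_of_isAlpha_map φ.symm (fun u v => ?_) (by simpa using h)
    rw [h₃, Equiv.apply_symm_apply, Equiv.apply_symm_apply]
  have hin : ∀ i w, M₁.C.Edge (.floor i) v w → ∃ k, label (φ v) = .inr (i, w, k) := by
    intro i w h
    have h4 := (h₂ _ _ _).1 h
    rw [h₁, edge_iff] at h4
    rcases hx : label (φ v) with t | ⟨s, w', k⟩
    · rw [hx] at h4
      exact h4.elim
    · rw [hx] at h4
      obtain ⟨rfl, rfl⟩ := h4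
      exact ⟨k, rfl⟩
  have hout : ∀ i w k, label (φ v) = .inr (i, w, k) →
      ∀ t, k = Sum.inl t ↔ M₁.C.Edge v (.floor t) w := by
    intro i w k h t
    rw [h₂, h₁, edge_iff, h]
    simp [label, Label.Edge]
  cases v with
  | floor i => rw [h₁]; rfl
  | mid e =>
    obtain ⟨k, hk⟩ := hin _ _ (.toMid e)
    rw [hk, (hout _ _ _ hk _).2 (.fromMid e)]
    rfl
  | beta i j k =>
    obtain ⟨t | b, hk⟩ := hin _ _ (.beta i j k)
    · have := (hout _ _ _ hk t).1 rfl
      cases this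
    · cases b
      · exact hk
      · exact (hα.2 (isAlpha_iff.2 ⟨_, hk, rfl⟩)).elim
  | alpha i j k =>
    obtain ⟨t | b, hk⟩ := hin _ _ (.alpha i j k)
    · have := (hout _ _ _ hk t).1 rfl
      cases this
    · cases b
      · obtain ⟨x, hx, hxa⟩ := isAlpha_iff.1 (hα.1 trivial)
        rw [hk] at hx
        obtain rfl := Sum.inr_injective hx
        simp [Mark.IsAlpha] at hxa
      · exact hk

/-- `L` lists the kinds of the vertices in the order of the marking. -/
def HasWord (M : D.Marking α β) (L : List (Label d)) : Prop :=
  ∃ (n : ℕ) (e : Fin n ≃ M.C.Vertex), (∀ i j, i < j ↔ M.lt (e i) (e j)) ∧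
    L = List.ofFn fun i => label (e i)

theorem exists_hasWord (M : D.Marking α β) : ∃ L, HasWord M L := by
  classical
  have := M.isStrictTotalOrder
  let _ := linearOrderOfSTO M.lt
  let _ := Fintype.ofFinite M.C.Vertex
  let e := Fintype.orderIsoFinOfCardEq M.C.Vertex rfl
  exact ⟨_, _, e.toEquiv, fun i j => (e.lt_iff_lt (x := i) (y := j)).symm, rfl⟩

theorem HasWord.unique {M : D.Marking α β} {L L' : List (Label d)} (h : HasWord M L)
    (h' : HasWord M L') : L = L' := by
  obtain ⟨n, e, he, rfl⟩ := h
  obtain ⟨n', e', he', rfl⟩ := h'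
  obtain rfl : n = n' := by simpa using Nat.card_congr (e.trans e'.symm)
  let f : Fin n ≃o Fin n :=
    (⟨e.trans e'.symm, fun {i j} => by
      rw [← not_lt, ← not_lt, he, he']
      rw [← he', ← he, he']
      simp [he]⟩)
  have hf : f = OrderIso.refl _ := Subsingleton.elim _ _
  congr
  ext i
  have h1 : e'.symm (e i) = i := DFunLike.congr_fun hf i
  rw [Equiv.symm_apply_eq] at h1
  rw [h1]

theorem equivalent_iff {M₁ M₂ : D.Marking α β} :
    Marking.Equivalent M₁ M₂ ↔ ∃ L, HasWord M₁ L ∧ HasWord M₂ L := by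
  constructor
  · rintro ⟨φ, h₁, h₂, h₃⟩
    obtain ⟨L, hL⟩ := exists_hasWord M₁
    refine ⟨L, hL, ?_⟩
    obtain ⟨n, e, he, rfl⟩ := hL
    refine ⟨n, e.trans φ, fun i j => by rw [he, h₃]; rfl, ?_⟩
    congr
    ext i
    exact (label_map φ h₁ h₂ h₃ _).symm
  · rintro ⟨L, ⟨n, e, he, rfl⟩, ⟨n', e', he', h⟩⟩
    obtain rfl : n = n' := by simpa using congrArg List.length h
    have hl : ∀ i, label (e i) = label (e' i) := fun i => congrFun (List.ofFn_injective h) i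
    have hlab : ∀ v, label (e' (e.symm v)) = label v := fun v => by
      rw [← hl, Equiv.apply_symm_apply]
    refine ⟨e.symm.trans e', fun i => ?_, fun u v w => ?_, fun u v => ?_⟩
    · have := hlab (.floor i)
      change e' _ = _
      revert this
      cases e' (e.symm (.floor i)) <;> simp [label]
    · rw [edge_iff, edge_iff]
      simp only [Equiv.trans_apply, hlab]
    · simp only [Equiv.trans_apply, ← he', he, Equiv.apply_symm_apply]

theorem order_conditions_iff {lt : C.Vertex → C.Vertex → Prop} (hlt : IsStrictTotalOrder C.Vertex lt) :
    ((∀ i j : Fin d, i < j → lt (.floor i) (.floor j)) ∧ (∀ u v w, C.Edge u v w → lt u v) ∧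
      (∀ u v : C.Vertex, ¬ u.IsAlpha → v.IsAlpha → lt u v) ∧
      ∀ i j k i' j' k', lt (.alpha i j k) (.alpha i' j' k') → j ≤ j') ↔
    ∀ u v, lt u v → (label u).Lt (label v) := by
  constructor
  · rintro ⟨h1, h2, h3, h4⟩ u v h
    have has : ¬ lt v u := asymm_of lt h
    rcases hu : label u with i | x <;> rcases hv : label v with j | y
    · cases u <;> simp only [label, reduceCtorEq, Sum.inl.injEq] at hu
      cases v <;> simp only [label, reduceCtorEq, Sum.inl.injEq] at hv
      subst hu hv
      change _ < _
      by_contra hle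
      rcases eq_or_lt_of_le (not_lt.1 hle) with e | e
      · subst e
        exact has h
      · exact has (h1 _ _ e)
    · rintro e
      obtain ⟨s, w, t | b⟩ := y
      · refine has (h2 v u w (edge_iff.2 ?_))
        rw [hu, hv]
        exact ⟨congrArg Sum.inl (Fin.ext e), rfl⟩
      · exact absurd e i.2.ne'
    · constructor
      · rintro rfl
        refine has (h2 v u x.2.1 (edge_iff.2 ?_))
        rw [hu, hv]
        exact ⟨rfl, rfl⟩
      · intro hx
        exact has (h3 v u (fun h5 => by obtain ⟨y, hy, _⟩ := isAlpha_iff.1 h5; simp [hv] at hy)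
          (isAlpha_iff.2 ⟨x, hu, hx⟩))
    · change x.key ≤ y.key
      unfold Mark.key
      split_ifs with hx hy
      · cases u <;> simp only [label, reduceCtorEq, Sum.inr.injEq] at hu <;> subst hu <;>
          simp only [Mark.IsAlpha, reduceCtorEq, Sum.inr.injEq] at hx
        cases v <;> simp only [label, reduceCtorEq, Sum.inr.injEq] at hv <;> subst hv <;>
          simp only [Mark.IsAlpha, reduceCtorEq, Sum.inr.injEq] at hy
        exact h4 _ _ _ _ _ _ h
      · refine (has (h3 v u (fun h5 => ?_) (isAlpha_iff.2 ⟨x, hu, hx⟩))).elim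
        obtain ⟨z, hz, hz'⟩ := isAlpha_iff.1 h5
        rw [hv] at hz
        exact hy (Sum.inr_injective hz ▸ hz')
      all_goals exact Nat.zero_le _
  · intro h
    have htri : ∀ u v, u ≠ v → ¬ lt u v → lt v u := fun u v hne hn =>
      (trichotomous_of lt u v).resolve_left hn |>.resolve_left hne
    refine ⟨fun i j hij => ?_, fun u v w he => ?_, fun u v hu hv => ?_, fun i j k i' j' k' hl => ?_⟩
    · by_contra hn
      have := h _ _ (htri _ _ (by simpa using hij.ne) hn)
      exact absurd hij (not_lt_of_gt this)
    · rw [edge_iff] at he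
      by_contra hn
      have h5 := h v u
      rcases hu : label u with i | x <;> rcases hv : label v with j | y <;> rw [hu, hv] at he h5
      · exact he
      · refine (h5 (htri _ _ ?_ hn)).1 he.1
        rintro rfl
        simp [hu] at hv
      · refine h5 (htri _ _ ?_ hn) ?_
        · rintro rfl
          simp [hu] at hv
        · rw [Mark.tgt, he.1]
          rfl
      · exact he
    · by_contra hn
      obtain ⟨y, hy, hya⟩ := isAlpha_iff.1 hv
      have h5 := h v u (htri _ _ (by rintro rfl; exact hu hv) hn)
      rw [hy] at h5
      rcases hx : label u with i | x <;> rw [hx] at h5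
      · exact h5.2 hya
      · have hxa : ¬ x.IsAlpha := fun hxa => hu (isAlpha_iff.2 ⟨x, hx, hxa⟩)
        change y.key ≤ x.key at h5
        rw [Mark.key, Mark.key, if_pos hya, if_neg hxa] at h5
        exact absurd y.2.1.pos (by omega)
    · have : Mark.key (i, j, Sum.inr true) ≤ Mark.key (i', j', Sum.inr true) := h _ _ hl
      simpa [Mark.key] using this

/-- The number of vertices of a given kind. -/
noncomputable def labelCount (C : D.Compatible α β) (x : Label d) : ℕ :=
  Nat.card {v : C.Vertex // label v = x}

theorem count_ofFn {X : Type*} [DecidableEq X] {n : ℕ} (f : Fin n → X) (x : X) :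
    (List.ofFn f : Multiset X).count x = Nat.card {i // f i = x} := by
  rw [Multiset.coe_count, List.count_eq_length_filter, List.ofFn_eq_map, List.filter_map,
    List.length_map, Nat.card_eq_fintype_card, Fintype.card_subtype, Finset.card_def]
  have : List.filter ((fun y => y == x) ∘ f) (List.finRange n) =
      List.filter (fun i => decide (f i = x)) (List.finRange n) :=
    List.filter_congr fun i _ => by simp [beq_eq_decide]
  rw [this]
  rfl

theorem exists_hasWord_iff {L : List (Label d)} :
    (∃ M : D.Marking α β, HasWord M L) ↔
      L.Pairwise Label.Lt ∧ ∃ C : D.Compatible α β, ∀ x, (L : Multiset (Label d)).count x = labelCount C x := by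
  constructor
  · rintro ⟨M, n, e, he, rfl⟩
    constructor
    · rw [List.pairwise_ofFn]
      intro i j hij
      exact (order_conditions_iff M.isStrictTotalOrder).1
        ⟨M.lt_floor, M.lt_edge, M.lt_alpha, M.alpha_weight⟩ _ _ ((he i j).1 hij)
    · refine ⟨M.C, fun x => ?_⟩
      rw [count_ofFn]
      exact Nat.card_congr (e.subtypeEquiv fun _ => Iff.rfl)
  · rintro ⟨hL, C, hC⟩
    have h1 : ∀ x, Nonempty ({i : Fin L.length // L.get i = x} ≃ {v : C.Vertex // label v = x}) := by
      intro x
      refine Finite.card_eq.1 ?_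
      have := hC x
      rw [labelCount] at this
      rw [← this, ← count_ofFn, List.ofFn_get]
    let e := Equiv.ofFiberEquiv fun x => (h1 x).some
    have he : ∀ i, label (e i) = L.get i := fun i => Equiv.ofFiberEquiv_map _ i
    let lt : C.Vertex → C.Vertex → Prop := fun u v => e.symm u < e.symm v
    have hlt : IsStrictTotalOrder C.Vertex lt :=
      { irrefl := fun u => lt_irrefl (e.symm u)
        trans := fun u v w => lt_trans (a := e.symm u)
        trichotomous := fun u v h h' => by
          exact e.symm.injective (le_antisymm (not_lt.1 h') (not_lt.1 h)) }
    obtain ⟨h2, h3, h4, h5⟩ := (order_conditions_iff hlt).2 fun u v huv => by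
      have := List.pairwise_iff_get.1 hL _ _ huv
      rwa [← he, ← he, Equiv.apply_symm_apply, Equiv.apply_symm_apply] at this
    refine ⟨⟨C, lt, hlt, h2, h3, h4, h5⟩, L.length, e, fun i j => ?_, ?_⟩
    · simp [lt]
    · simp [he]

theorem numMarkings_eq (D : FloorDiagram d) (α β : ℕ+ →₀ ℕ) :
    D.numMarkings α β = Nat.card {L : List (Label d) // L.Pairwise Label.Lt ∧
      ∃ C : D.Compatible α β, ∀ x, (L : Multiset (Label d)).count x = labelCount C x} := by
  have h : D.markingSetoid α β = Setoid.ker fun M => (exists_hasWord M).choose := by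
    ext M₁ M₂
    rw [Setoid.ker_def]
    refine equivalent_iff.trans ⟨?_, fun h => ⟨_, (exists_hasWord M₁).choose_spec, ?_⟩⟩
    · rintro ⟨L, h1, h2⟩
      rw [(exists_hasWord M₁).choose_spec.unique h1, (exists_hasWord M₂).choose_spec.unique h2]
    · rw [h]
      exact (exists_hasWord M₂).choose_spec
  rw [FloorDiagram.numMarkings, h, Nat.card_congr (Setoid.quotientKerEquivRange _)]
  refine Nat.card_congr (Equiv.subtypeEquivRight fun L => ?_)
  rw [← exists_hasWord_iff]
  constructor
  · rintro ⟨M, rfl⟩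
    exact ⟨M, (exists_hasWord M).choose_spec⟩
  · rintro ⟨M, hM⟩
    exact ⟨M, (exists_hasWord M).choose_spec.unique hM⟩

theorem labelCount_floor (C : D.Compatible α β) (i : Fin d) : labelCount C (.inl i) = 1 := by
  rw [labelCount, Nat.card_eq_one_iff_unique]
  refine ⟨⟨?_⟩, ⟨⟨.floor i, rfl⟩⟩⟩
  rintro ⟨v, h⟩ ⟨v', h'⟩
  refine Subtype.ext ?_
  cases v <;> simp only [label, reduceCtorEq, Sum.inl.injEq] at h
  cases v' <;> simp only [label, reduceCtorEq, Sum.inl.injEq] at h'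
  subst h h'
  rfl

theorem labelCount_mid (C : D.Compatible α β) (s t : Fin d) (w : ℕ+) :
    labelCount C (.inr (s, w, .inl t)) = D.edges.count (s, t, w) := by
  have e : {v : C.Vertex // label v = .inr (s, w, .inl t)} ≃ {e : D.edges // e.1 = (s, t, w)} :=
    { toFun := fun v => match v with
        | ⟨.mid e, h⟩ => ⟨e, by
            simp only [label, Sum.inr.injEq, Prod.mk.injEq, Sum.inl.injEq] at h
            ext <;> simp [h]⟩
      invFun := fun e => ⟨.mid e.1, by rw [label, e.2]⟩
      left_inv := by
        rintro ⟨(_ | _ | _ | _), h⟩ <;> first | rfl | (exfalso; simp [label] at h)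
      right_inv := fun _ => rfl }
  rw [labelCount, Nat.card_congr e, Nat.card_eq_fintype_card, Fintype.card_subtype]
  conv_rhs => rw [← Multiset.map_univ_coe D.edges]
  rw [Multiset.count_map, Finset.card_def]
  simp only [Finset.filter_val, eq_comm]

theorem labelCount_beta (C : D.Compatible α β) (i : Fin d) (j : ℕ+) :
    labelCount C (.inr (i, j, .inr false)) = C.b i j := by
  have e : Fin (C.b i j) ≃ {v : C.Vertex // label v = .inr (i, j, .inr false)} :=
    Equiv.ofBijective (fun k => ⟨.beta i j k, rfl⟩) ⟨fun k k' h => by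
      simpa using congrArg Subtype.val h, by
      rintro ⟨(_ | _ | ⟨i', j', k⟩ | _), h⟩ <;>
        simp only [label, reduceCtorEq, Sum.inr.injEq, Prod.mk.injEq, and_false, Bool.true_eq_false,
          and_true] at h
      obtain ⟨rfl, rfl⟩ := h
      exact ⟨k, rfl⟩⟩
  rw [labelCount, ← Nat.card_congr e, Nat.card_eq_fintype_card, Fintype.card_fin]

theorem labelCount_alpha (C : D.Compatible α β) (i : Fin d) (j : ℕ+) :
    labelCount C (.inr (i, j, .inr true)) = C.a i j := by
  have e : Fin (C.a i j) ≃ {v : C.Vertex // label v = .inr (i, j, .inr true)} :=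
    Equiv.ofBijective (fun k => ⟨.alpha i j k, rfl⟩) ⟨fun k k' h => by
      simpa using congrArg Subtype.val h, by
      rintro ⟨(_ | _ | _ | ⟨i', j', k⟩), h⟩ <;>
        simp only [label, reduceCtorEq, Sum.inr.injEq, Prod.mk.injEq, and_false, Bool.false_eq_true,
          and_true] at h
      obtain ⟨rfl, rfl⟩ := h
      exact ⟨k, rfl⟩⟩
  rw [labelCount, ← Nat.card_congr e, Nat.card_eq_fintype_card, Fintype.card_fin]

end Vertex

/-! ### The cogenus counts edges -/

theorem sq_sum_eq {ι : Type*} [DecidableEq ι] (s : Finset ι) (f : ι → ℤ) :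
    (∑ a ∈ s, f a) ^ 2 = ∑ a ∈ s, f a ^ 2 + 2 * ∑ t ∈ s.powersetCard 2, ∏ a ∈ t, f a := by
  induction s using Finset.induction_on with
  | empty =>
    rw [Finset.powersetCard_eq_empty.2 (by simp)]
    simp
  | insert a s ha ih =>
    have h1 : ∑ t ∈ (insert a s).powersetCard 2, ∏ b ∈ t, f b =
        ∑ t ∈ s.powersetCard 2, ∏ b ∈ t, f b + f a * ∑ b ∈ s, f b := by
      rw [Finset.powersetCard_succ_insert ha, Finset.sum_union, Finset.powersetCard_one,
        Finset.sum_image, Finset.sum_map, Finset.mul_sum]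
      · congr 1
        refine Finset.sum_congr rfl fun b hb => ?_
        have hab : a ∉ ({b} : Finset ι) := by
          rw [Finset.mem_singleton]
          rintro rfl
          exact ha hb
        simp [Finset.prod_insert hab]
      · intro t ht t' ht' e
        simp only [Finset.coe_map, Set.mem_image, Finset.mem_coe] at ht ht'
        obtain ⟨b, hb, rfl⟩ := ht
        obtain ⟨b', hb', rfl⟩ := ht'
        have h2 : ∀ b ∈ s, a ∉ ({b} : Finset ι) := fun b hb h => by
          rw [Finset.mem_singleton] at h
          exact ha (h ▸ hb)
        have h3 := congrArg (fun t => t.erase a) e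
        simpa [Finset.erase_insert (h2 b hb), Finset.erase_insert (h2 b' hb')] using h3
      · rw [Finset.disjoint_left]
        intro t ht ht'
        rw [Finset.mem_powersetCard] at ht
        rw [Finset.mem_image] at ht'
        obtain ⟨t', _, rfl⟩ := ht'
        exact ha (ht.1 (Finset.mem_insert_self _ _))
    rw [Finset.sum_insert ha, Finset.sum_insert ha, h1, add_sq, ih]
    ring

theorem sum_componentDegree {d : ℕ} (D : FloorDiagram d) :
    ∑ᶠ c : D.graph.ConnectedComponent, (D.componentDegree c : ℤ) = d := by
  classical
  rw [finsum_eq_sum_of_fintype]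
  have h : ∀ c : D.graph.ConnectedComponent, (D.componentDegree c : ℤ) =
      ∑ i : Fin d, if D.graph.connectedComponentMk i = c then 1 else 0 := by
    intro c
    rw [FloorDiagram.componentDegree, Set.ncard_eq_toFinset_card', Finset.sum_boole]
    congr 2
    ext i
    simp [SimpleGraph.ConnectedComponent.mem_supp_iff]
  simp only [h]
  rw [Finset.sum_comm]
  simp

theorem sum_componentEdges {d : ℕ} (D : FloorDiagram d) :
    ∑ᶠ c : D.graph.ConnectedComponent, (D.componentEdges c : ℤ) = D.edges.card := by
  classical
  rw [finsum_eq_sum_of_fintype]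
  have h : ∀ E : Multiset (Fin d × Fin d × ℕ+), ∑ c : D.graph.ConnectedComponent,
      ((E.filter fun e => e.1 ∈ c.supp).card : ℤ) = E.card := by
    intro E
    induction E using Multiset.induction_on with
    | empty => simp
    | cons e E ih =>
      have : ∀ c : D.graph.ConnectedComponent,
          (((e ::ₘ E).filter fun e => e.1 ∈ c.supp).card : ℤ) =
          (if D.graph.connectedComponentMk e.1 = c then 1 else 0) +
            (E.filter fun e => e.1 ∈ c.supp).card := by
        intro c
        rw [Multiset.filter_cons]
        simp only [SimpleGraph.ConnectedComponent.mem_supp_iff]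
        split_ifs <;> simp [add_comm]
      simp only [this]
      rw [Finset.sum_add_distrib, ih]
      simp [add_comm]
  rw [← h D.edges]
  refine Finset.sum_congr rfl fun c _ => ?_
  rw [FloorDiagram.componentEdges]

theorem two_mul_cogenus {d : ℕ} (D : FloorDiagram d) :
    2 * D.cogenus = d * (d - 1) - 2 * D.edges.card := by
  classical
  have h1 := sum_componentDegree D
  have h2 := sum_componentEdges D
  rw [finsum_eq_sum_of_fintype] at h1 h2
  have h3 := sq_sum_eq (Finset.univ : Finset D.graph.ConnectedComponent)
    fun c => (D.componentDegree c : ℤ)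
  have h4 : ∀ c, 2 * D.componentCogenus c =
      (D.componentDegree c : ℤ) ^ 2 - D.componentDegree c - 2 * D.componentEdges c := by
    intro c
    have h5 : 2 ∣ ((D.componentDegree c : ℤ) - 1) * ((D.componentDegree c : ℤ) - 2) := by
      have := Int.even_mul_succ_self ((D.componentDegree c : ℤ) - 2)
      rw [show (D.componentDegree c : ℤ) - 2 + 1 = D.componentDegree c - 1 by ring, mul_comm] at this
      exact this.two_dvd
    rw [FloorDiagram.componentCogenus, FloorDiagram.componentGenus, mul_sub, Int.mul_ediv_cancel' h5]
    ring
  have h6 : 2 * D.cogenus = ∑ c : D.graph.ConnectedComponent, 2 * D.componentCogenus c +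
      2 * ∑ s ∈ (Finset.univ : Finset D.graph.ConnectedComponent).powersetCard 2,
        ∏ c ∈ s, (D.componentDegree c : ℤ) := by
    rw [← Finset.mul_sum, ← mul_add, FloorDiagram.cogenus]
  rw [h6]
  simp only [h4]
  rw [Finset.sum_sub_distrib, Finset.sum_sub_distrib, h1, ← Finset.mul_sum, h2]
  rw [h1] at h3
  linarith

theorem cogenus_eq_iff {d : ℕ} (D : FloorDiagram d) (δ : ℕ) :
    D.cogenus = δ ↔ 2 * (D.edges.card + δ) = d * (d - 1) := by
  have h := two_mul_cogenus D
  zify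
  rcases d with _ | d
  · simp at h ⊢
    omega
  · simp only [Nat.cast_add, Nat.cast_one, Nat.add_sub_cancel] at h ⊢
    rw [add_sub_cancel_right] at h
    omega

/-! ### Words between the floors -/

section Words

variable {d : ℕ}

/-- The sequence of all vertices, given the words between the floors. -/
def flat (u : Fin d → List (Mark d)) : List (Label d) :=
  (List.finRange d).flatMap fun g => Sum.inl g :: (u g).map Sum.inr

theorem map_inr_append_inj {X Y : Type*} {a a' : List Y} {r r' : List (X ⊕ Y)}
    (hr : ∀ y t, r ≠ Sum.inr y :: t) (hr' : ∀ y t, r' ≠ Sum.inr y :: t)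
    (h : a.map Sum.inr ++ r = a'.map Sum.inr ++ r') : a = a' ∧ r = r' := by
  induction a generalizing a' with
  | nil =>
    cases a' with
    | nil => exact ⟨rfl, h⟩
    | cons y a' => exact (hr _ _ h).elim
  | cons x a ih =>
    cases a' with
    | nil => exact (hr' _ _ h.symm).elim
    | cons y a' =>
      simp only [List.map_cons, List.cons_append, List.cons.injEq, Sum.inr.injEq] at h
      obtain ⟨rfl, h⟩ := h
      obtain ⟨rfl, rfl⟩ := ih h
      exact ⟨rfl, rfl⟩

theorem flatMap_ne {X Y : Type*} (G : List X) (u : X → List Y) (y : Y) (t : List (X ⊕ Y)) :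
    (G.flatMap fun g => Sum.inl g :: (u g).map Sum.inr) ≠ Sum.inr y :: t := by
  cases G <;> simp

theorem flatMap_inj {X Y : Type*} {G : List X} {u u' : X → List Y}
    (h : (G.flatMap fun g => Sum.inl g :: (u g).map Sum.inr) =
      G.flatMap fun g => (Sum.inl g :: (u' g).map Sum.inr : List (X ⊕ Y))) :
    ∀ g ∈ G, u g = u' g := by
  induction G with
  | nil => simp
  | cons g G ih =>
    simp only [List.flatMap_cons, List.cons_append, List.cons.injEq, true_and] at h
    obtain ⟨h1, h2⟩ := map_inr_append_inj (flatMap_ne G u) (flatMap_ne G u') h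
    simpa [h1] using ih h2

theorem flat_injective : Function.Injective (flat (d := d)) := fun _ _ h =>
  funext fun g => flatMap_inj h g (List.mem_finRange g)

theorem exists_eq_append_flatMap {X Y : Type*} [DecidableEq X] (L : List (X ⊕ Y)) :
    ∀ G : List X, G.Nodup → L.filterMap Sum.getLeft? = G →
      ∃ (p : List Y) (u : X → List Y),
        L = p.map Sum.inr ++ G.flatMap fun g => Sum.inl g :: (u g).map Sum.inr := by
  induction L with
  | nil =>
    rintro G _ rfl
    exact ⟨[], fun _ => [], by simp⟩
  | cons z L ih =>
    rintro G hG rfl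
    rcases z with g | y
    · simp only [List.filterMap_cons, Sum.getLeft?_inl] at hG ⊢
      obtain ⟨p, u, h⟩ := ih _ (List.nodup_cons.1 hG).2 rfl
      refine ⟨[], Function.update u g p, ?_⟩
      simp only [List.map_nil, List.nil_append, List.flatMap_cons, Function.update_self,
        List.cons_append, List.cons.injEq, true_and]
      conv_lhs => rw [h]
      congr 1
      refine List.flatMap_congr fun g' hg' => ?_
      rw [Function.update_of_ne]
      rintro rfl
      exact (List.nodup_cons.1 hG).1 hg'
    · simp only [List.filterMap_cons, Sum.getLeft?_inr] at hG ⊢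
      obtain ⟨p, u, h⟩ := ih _ hG rfl
      exact ⟨y :: p, u, by
        rw [List.map_cons, List.cons_append, ← h]⟩

/-- The words between the floors respect the directions of the edges and the order of the
`α`-vertices. -/
def IsOrdered (u : Fin d → List (Mark d)) : Prop :=
  (∀ g, ∀ x ∈ u g, x.1 ≤ g ∧ (g : ℕ) < x.tgt ∧ (x.IsAlpha → (g : ℕ) + 1 = d)) ∧
    ∀ g, (u g).Pairwise fun x y => x.key ≤ y.key

theorem pairwise_flat_iff {u : Fin d → List (Mark d)} : (flat u).Pairwise Label.Lt ↔ IsOrdered u := by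
  have hsorted : (List.finRange d).Pairwise (· < ·) := List.pairwise_lt_finRange d
  rw [flat, List.pairwise_flatMap]
  constructor
  · rintro ⟨h1, h2⟩
    have h2' : ∀ g h : Fin d, g < h → ∀ x ∈ Sum.inl g :: (u g).map Sum.inr,
        ∀ y ∈ Sum.inl h :: (u h).map Sum.inr, Label.Lt x y := by
      intro g h hgh
      rw [List.pairwise_iff_get] at h2
      have := h2 ⟨g, by simp⟩ ⟨h, by simp⟩ hgh
      simpa using this
    have h1' := fun g => h1 g (List.mem_finRange g)
    simp only [List.pairwise_cons, List.pairwise_map] at h1'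
    refine ⟨fun g x hx => ⟨?_, ?_, ?_⟩, fun g => (h1' g).2⟩
    · by_contra hlt
      have : x.1 ≠ x.1 ∧ ¬ x.IsAlpha :=
        h2' g x.1 (not_le.1 hlt) (Sum.inr x) (by simp [hx]) (Sum.inl x.1) (by simp)
      exact this.1 rfl
    · by_contra hlt
      have ht : x.tgt < d := by omega
      rcases eq_or_lt_of_le (not_lt.1 hlt) with e | e
      · have : x.tgt ≠ g := (h1' g).1 (Sum.inr x) (by simp [hx])
        exact this e
      · have : x.tgt ≠ x.tgt :=
          h2' ⟨x.tgt, ht⟩ g e (Sum.inl ⟨x.tgt, ht⟩) (by simp) (Sum.inr x) (by simp [hx])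
        exact this rfl
    · intro hα
      by_contra hne
      have hlt : (g : ℕ) + 1 < d := by omega
      have : x.1 ≠ ⟨g + 1, hlt⟩ ∧ ¬ x.IsAlpha :=
        h2' g ⟨g + 1, hlt⟩ (Fin.lt_def.2 (Nat.lt_succ_self _)) (Sum.inr x) (by simp [hx])
          (Sum.inl ⟨g + 1, hlt⟩) (by simp)
      exact this.2 hα
  · rintro ⟨h1, h2⟩
    refine ⟨fun g _ => ?_, hsorted.imp fun {g h} hgh x hx y hy => ?_⟩
    · rw [List.pairwise_cons, List.pairwise_map]
      refine ⟨?_, h2 g⟩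
      simp only [List.mem_map, forall_exists_index, and_imp]
      rintro _ x hx rfl
      exact (h1 g x hx).2.1.ne'
    · simp only [List.mem_cons, List.mem_map] at hx hy
      rcases hx with rfl | ⟨x, hx, rfl⟩ <;> rcases hy with rfl | ⟨y, hy, rfl⟩
      · exact hgh
      · have := (h1 h y hy).2.1
        rw [Fin.lt_def] at hgh
        change y.tgt ≠ g
        omega
      · have := h1 g x hx
        refine ⟨fun e => ?_, fun hα => ?_⟩
        · rw [e] at this
          exact absurd hgh (not_lt.2 this.1)
        · have := this.2.2 hα
          rw [Fin.lt_def] at hgh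
          omega
      · have hx' : ¬ x.IsAlpha := fun hα => by
          have := (h1 g x hx).2.2 hα
          rw [Fin.lt_def] at hgh
          omega
        change x.key ≤ y.key
        rw [Mark.key, if_neg hx']
        exact Nat.zero_le _

theorem exists_eq_flat {L : List (Label d)} (hL : L.Pairwise Label.Lt)
    (h : ∀ i, (L : Multiset (Label d)).count (Sum.inl i) = 1) : ∃ u, L = flat u := by
  have hmem : ∀ i, Sum.inl i ∈ L := fun i => by
    rw [← Multiset.mem_coe, ← Multiset.one_le_count_iff_mem, h]
  have h1 : (L.filterMap Sum.getLeft?).Pairwise (· < ·) := by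
    rw [List.pairwise_filterMap]
    refine hL.imp ?_
    rintro (i | x) (j | y) hlt a ha b hb <;> simp at ha hb
    subst ha hb
    exact hlt
  have h2 : L.filterMap Sum.getLeft? = List.finRange d := by
    refine List.Perm.eq_of_pairwise (le := (· < ·)) (fun a b _ _ h h' => absurd h h'.asymm)
      h1 (List.pairwise_lt_finRange d) ?_
    rw [List.perm_ext_iff_of_nodup (h1.imp fun h => h.ne) (List.nodup_finRange d)]
    intro i
    simp only [List.mem_filterMap, List.mem_finRange, iff_true]
    exact ⟨_, hmem i, rfl⟩
  obtain ⟨p, u, e⟩ := exists_eq_append_flatMap L _ (List.nodup_finRange d) h2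
  cases p with
  | nil => exact ⟨u, e⟩
  | cons x p =>
    exfalso
    rw [e, List.map_cons, List.cons_append, List.pairwise_cons] at hL
    have : x.1 ≠ x.1 ∧ ¬ x.IsAlpha := hL.1 (Sum.inl x.1) (by simp)
    exact this.1 rfl

/-- The multiset of all vertices that are not floors. -/
def marksOf (u : Fin d → List (Mark d)) : Multiset (Mark d) := ∑ g, (u g : Multiset (Mark d))

theorem count_flat_inr (u : Fin d → List (Mark d)) (x : Mark d) :
    (flat u : Multiset (Label d)).count (Sum.inr x) = (marksOf u).count x := by
  have h : ∀ G : List (Fin d), ((G.flatMap fun g => Sum.inl g :: (u g).map Sum.inr :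
      List (Label d)) : Multiset (Label d)).count (Sum.inr x) =
      (G.map fun g => (u g : Multiset (Mark d)).count x).sum := by
    intro G
    induction G with
    | nil => simp
    | cons g G ih =>
      rw [List.flatMap_cons, ← Multiset.coe_add, Multiset.count_add, ih, List.map_cons,
        List.sum_cons, ← Multiset.cons_coe, Multiset.count_cons_of_ne (by simp),
        ← Multiset.map_coe, Multiset.count_map_eq_count' _ _ Sum.inr_injective]
  rw [flat, h, marksOf, Multiset.count_sum', ← List.sum_ofFn, List.ofFn_eq_map]

theorem count_flat_inl (u : Fin d → List (Mark d)) (i : Fin d) :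
    (flat u : Multiset (Label d)).count (Sum.inl i) = 1 := by
  have h : ∀ G : List (Fin d), ((G.flatMap fun g => Sum.inl g :: (u g).map Sum.inr :
      List (Label d)) : Multiset (Label d)).count (Sum.inl i) =
      (G : Multiset (Fin d)).count i := by
    intro G
    induction G with
    | nil => simp
    | cons g G ih =>
      rw [List.flatMap_cons, ← Multiset.coe_add, Multiset.count_add, ih, ← Multiset.cons_coe,
        ← Multiset.cons_coe, Multiset.count_cons, Multiset.count_cons, ← Multiset.map_coe,
        Multiset.count_eq_zero_of_notMem (s := Multiset.map _ _) (by simp)]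
      simp [add_comm]
  rw [flat, h]
  exact Multiset.count_eq_one_of_mem (Multiset.coe_nodup.2 (List.nodup_finRange d))
    (by simp)

/-- The edges between floors. -/
def edgesOf (V : Multiset (Mark d)) : Multiset (Fin d × Fin d × ℕ+) :=
  V.filterMap fun x => Sum.elim (fun t => some (x.1, t, x.2.1)) (fun _ => none) x.2.2

/-- The weights of the edges at the `β`-vertices (`c = false`) or `α`-vertices (`c = true`) that
start at the floor `i`. -/
def endWeights (V : Multiset (Mark d)) (c : Bool) (i : Fin d) : Multiset ℕ+ :=
  V.filterMap fun x => if x.1 = i ∧ x.2.2 = Sum.inr c then some x.2.1 else none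

/-- The weights of the edges at the `β`-vertices (`c = false`) or `α`-vertices (`c = true`). -/
def allEndWeights (V : Multiset (Mark d)) (c : Bool) : Multiset ℕ+ :=
  V.filterMap fun x => if x.2.2 = Sum.inr c then some x.2.1 else none

/-- The total weight of the edges that start at the floor `i`. -/
def outflow (V : Multiset (Mark d)) (i : ℕ) : ℕ :=
  (V.map fun x => if (x.1 : ℕ) = i then (x.2.1 : ℕ) else 0).sum

/-- The total weight of the edges that end at the floor `i`. -/
def inflow (V : Multiset (Mark d)) (i : ℕ) : ℕ :=
  (V.map fun x => if x.tgt = i then (x.2.1 : ℕ) else 0).sum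

/-- The total weight of the edges that start at `g` or before and end after `g`. -/
def cutflow (V : Multiset (Mark d)) (g : ℕ) : ℕ :=
  (V.map fun x => if (x.1 : ℕ) ≤ g ∧ g < x.tgt then (x.2.1 : ℕ) else 0).sum

theorem edgesOf_cons_inl (s t : Fin d) (w : ℕ+) (V : Multiset (Mark d)) :
    edgesOf ((s, w, Sum.inl t) ::ₘ V) = (s, t, w) ::ₘ edgesOf V := by
  rw [edgesOf, Multiset.filterMap_cons]
  exact Multiset.singleton_add _ _

theorem edgesOf_cons_inr (s : Fin d) (w : ℕ+) (c : Bool) (V : Multiset (Mark d)) :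
    edgesOf ((s, w, Sum.inr c) ::ₘ V) = edgesOf V := by
  rw [edgesOf, Multiset.filterMap_cons]
  exact zero_add _

theorem endWeights_cons (x : Mark d) (V : Multiset (Mark d)) (c : Bool) (i : Fin d) :
    endWeights (x ::ₘ V) c i =
      (if x.1 = i then (if x.2.2 = Sum.inr c then {x.2.1} else 0) else 0) + endWeights V c i := by
  rw [endWeights, Multiset.filterMap_cons]
  by_cases h : x.1 = i <;> by_cases h' : x.2.2 = Sum.inr c <;> simp [h, h', endWeights]

theorem allEndWeights_cons (x : Mark d) (V : Multiset (Mark d)) (c : Bool) :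
    allEndWeights (x ::ₘ V) c =
      (if x.2.2 = Sum.inr c then {x.2.1} else 0) + allEndWeights V c := by
  rw [allEndWeights, Multiset.filterMap_cons]
  by_cases h : x.2.2 = Sum.inr c <;> simp [h, allEndWeights]

theorem count_edgesOf (V : Multiset (Mark d)) (s t : Fin d) (w : ℕ+) :
    (edgesOf V).count (s, t, w) = V.count (s, w, Sum.inl t) := by
  induction V using Multiset.induction_on with
  | empty => simp [edgesOf]
  | cons x V ih =>
    obtain ⟨s', w', t' | c⟩ := x
    · rw [edgesOf_cons_inl, Multiset.count_cons, Multiset.count_cons, ← ih]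
      congr 1
      simp only [Prod.mk.injEq, Sum.inl.injEq]
      congr 1
      simp only [eq_iff_iff]
      tauto
    · rw [edgesOf_cons_inr, Multiset.count_cons_of_ne (by simp), ← ih]

theorem count_endWeights (V : Multiset (Mark d)) (c : Bool) (i : Fin d) (j : ℕ+) :
    (endWeights V c i).count j = V.count (i, j, Sum.inr c) := by
  induction V using Multiset.induction_on with
  | empty => simp [endWeights]
  | cons x V ih =>
    obtain ⟨s, w, k⟩ := x
    rw [Multiset.count_cons, ← ih, endWeights_cons, Multiset.count_add, add_comm]
    congr 1
    by_cases h : s = i <;> by_cases h' : k = Sum.inr c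
    · simp [h, h', Multiset.count_singleton]
    · simp [h, h', Ne.symm h']
    · simp [h, h', Ne.symm h]
    · simp [h, Ne.symm h]

theorem sum_endWeights (V : Multiset (Mark d)) (c : Bool) :
    ∑ i, endWeights V c i = allEndWeights V c := by
  induction V using Multiset.induction_on with
  | empty => simp [endWeights, allEndWeights]
  | cons x V ih =>
    rw [allEndWeights_cons, ← ih]
    simp only [endWeights_cons]
    rw [Finset.sum_add_distrib, Finset.sum_ite_eq]
    simp

theorem seqDegree_toFinsupp (s : Multiset ℕ+) :
    seqDegree (Multiset.toFinsupp s) = (s.map fun w : ℕ+ => (w : ℕ)).sum := by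
  induction s using Multiset.induction_on with
  | empty => simp [seqDegree]
  | cons w s ih =>
    rw [← Multiset.singleton_add, map_add, seqDegree, Finsupp.sum_add_index', Multiset.map_add,
      Multiset.sum_add, ← ih, seqDegree]
    · simp
    · simp
    · intros
      ring

theorem outflow_eq (V : Multiset (Mark d)) (i : Fin d) :
    outflow V i = (((edgesOf V).filter fun e => e.1 = i).map fun e => (e.2.2 : ℕ)).sum +
      ((endWeights V true i).map fun w : ℕ+ => (w : ℕ)).sum +
      ((endWeights V false i).map fun w : ℕ+ => (w : ℕ)).sum := by
  induction V using Multiset.induction_on with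
  | empty => simp [outflow, edgesOf, endWeights]
  | cons x V ih =>
    rw [outflow, Multiset.map_cons, Multiset.sum_cons, ← outflow, ih, endWeights_cons,
      endWeights_cons]
    obtain ⟨s, w, t | c⟩ := x
    · rw [edgesOf_cons_inl, Multiset.filter_cons]
      by_cases h : s = i
      · simp [h]
        ring
      · simp [h, Fin.val_inj]
    · rw [edgesOf_cons_inr]
      by_cases h : s = i
      · cases c
        · simp [h]
          ring
        · simp [h]
          ring
      · simp [h, Fin.val_inj]

theorem inflow_eq (V : Multiset (Mark d)) (i : Fin d) :
    inflow V i = (((edgesOf V).filter fun e => e.2.1 = i).map fun e => (e.2.2 : ℕ)).sum := by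
  induction V using Multiset.induction_on with
  | empty => simp [inflow, edgesOf]
  | cons x V ih =>
    rw [inflow, Multiset.map_cons, Multiset.sum_cons, ← inflow, ih]
    obtain ⟨s, w, t | c⟩ := x
    · rw [edgesOf_cons_inl, Multiset.filter_cons]
      by_cases h : t = i
      · simp [h, Mark.tgt]
      · simp [h, Fin.val_inj, Mark.tgt]
    · rw [edgesOf_cons_inr]
      have := i.2.ne'
      simp [Mark.tgt, this]

theorem exists_compatible_iff {D : FloorDiagram d} {α β : ℕ+ →₀ ℕ} {V : Multiset (Mark d)} :
    (∃ C : D.Compatible α β, ∀ x, V.count x = labelCount C (Sum.inr x)) ↔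
      edgesOf V = D.edges ∧ Multiset.toFinsupp (allEndWeights V true) = α ∧
        Multiset.toFinsupp (allEndWeights V false) = β ∧
        ∀ i : Fin d, outflow V i = inflow V i + 1 := by
  have key : edgesOf V = D.edges → ∀ i : Fin d,
      ((seqDegree (Multiset.toFinsupp (endWeights V true i)) +
        seqDegree (Multiset.toFinsupp (endWeights V false i)) : ℤ) = 1 - D.div i ↔
      outflow V i = inflow V i + 1) := by
    intro h i
    have h1 := outflow_eq V i
    have h2 := inflow_eq V i
    rw [h] at h1 h2
    rw [seqDegree_toFinsupp, seqDegree_toFinsupp, FloorDiagram.div, edgeDivergence]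
    have h3 : ∀ s : Multiset (Fin d × Fin d × ℕ+), (s.map fun e => ((e.2.2 : ℕ) : ℤ)).sum =
        (((s.map fun e => (e.2.2 : ℕ)).sum : ℕ) : ℤ) := by
      intro s
      rw [Nat.cast_multiset_sum, Multiset.map_map]
      rfl
    rw [h3, h3]
    omega
  constructor
  · rintro ⟨C, hC⟩
    have h1 : edgesOf V = D.edges := by
      ext ⟨s, t, w⟩
      rw [count_edgesOf, hC, labelCount_mid]
    have ha : ∀ i, Multiset.toFinsupp (endWeights V true i) = C.a i := by
      intro i
      ext j
      rw [Multiset.toFinsupp_apply, count_endWeights, hC, labelCount_alpha]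
    have hb : ∀ i, Multiset.toFinsupp (endWeights V false i) = C.b i := by
      intro i
      ext j
      rw [Multiset.toFinsupp_apply, count_endWeights, hC, labelCount_beta]
    refine ⟨h1, ?_, ?_, fun i => (key h1 i).1 ?_⟩
    · rw [← sum_endWeights, map_sum, ← C.sum_a]
      exact Finset.sum_congr rfl fun i _ => ha i
    · rw [← sum_endWeights, map_sum, ← C.sum_b]
      exact Finset.sum_congr rfl fun i _ => hb i
    · rw [ha, hb, C.degree_eq]
  · rintro ⟨h1, h2, h3, h4⟩
    refine ⟨⟨fun i => Multiset.toFinsupp (endWeights V true i),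
      fun i => Multiset.toFinsupp (endWeights V false i), ?_, ?_, fun i => (key h1 i).2 (h4 i)⟩, ?_⟩
    · rw [← map_sum, sum_endWeights, h2]
    · rw [← map_sum, sum_endWeights, h3]
    · rintro ⟨s, w, t | _ | _⟩
      · rw [labelCount_mid, ← h1, count_edgesOf]
      · rw [labelCount_beta, Multiset.toFinsupp_apply, count_endWeights]
      · rw [labelCount_alpha, Multiset.toFinsupp_apply, count_endWeights]

theorem cutflow_zero {V : Multiset (Mark d)} (hV : ∀ x ∈ V, (x.1 : ℕ) < x.tgt) :
    cutflow V 0 + inflow V 0 = outflow V 0 := by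
  rw [cutflow, inflow, outflow, ← Multiset.sum_map_add]
  congr 1
  refine Multiset.map_congr rfl fun x hx => ?_
  have := hV x hx
  split_ifs <;> omega

theorem cutflow_succ {V : Multiset (Mark d)} (hV : ∀ x ∈ V, (x.1 : ℕ) < x.tgt) (g : ℕ) :
    cutflow V (g + 1) + inflow V (g + 1) = cutflow V g + outflow V (g + 1) := by
  rw [cutflow, inflow, outflow, cutflow, ← Multiset.sum_map_add, ← Multiset.sum_map_add]
  congr 1
  refine Multiset.map_congr rfl fun x hx => ?_
  have := hV x hx
  split_ifs <;> omega

theorem forall_outflow_iff {V : Multiset (Mark d)} (hV : ∀ x ∈ V, (x.1 : ℕ) < x.tgt) :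
    (∀ i : Fin d, outflow V i = inflow V i + 1) ↔ ∀ g < d, cutflow V g = g + 1 := by
  constructor
  · intro h g
    induction g with
    | zero =>
      intro hg
      have h1 := cutflow_zero hV
      have h2 := h ⟨0, hg⟩
      dsimp only at h2
      omega
    | succ g ih =>
      intro hg
      have h1 := cutflow_succ hV g
      have h2 := h ⟨g + 1, hg⟩
      have h3 := ih (by omega)
      dsimp only at h2
      omega
  · rintro h ⟨i, hi⟩
    dsimp only
    cases i with
    | zero =>
      have h1 := cutflow_zero hV
      have h2 := h 0 hi
      omega
    | succ i =>
      have h1 := cutflow_succ hV i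
      have h2 := h i (by omega)
      have h3 := h (i + 1) hi
      omega

/-- The words between the floors of the `(α, β)`-markings. -/
def IsMarking (α β : ℕ+ →₀ ℕ) (u : Fin d → List (Mark d)) : Prop :=
  IsOrdered u ∧ Multiset.toFinsupp (allEndWeights (marksOf u) true) = α ∧
    Multiset.toFinsupp (allEndWeights (marksOf u) false) = β ∧
    ∀ g < d, cutflow (marksOf u) g = g + 1

theorem mem_marksOf {u : Fin d → List (Mark d)} {x : Mark d} : x ∈ marksOf u ↔ ∃ g, x ∈ u g := by
  simp [marksOf, Multiset.mem_sum]

theorem IsOrdered.lt_tgt {u : Fin d → List (Mark d)} (h : IsOrdered u) :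
    ∀ x ∈ marksOf u, (x.1 : ℕ) < x.tgt := by
  intro x hx
  obtain ⟨g, hg⟩ := mem_marksOf.1 hx
  have := h.1 g x hg
  have h2 := Fin.le_def.1 this.1
  omega

theorem numMarkings_eq_card_isMarking (D : FloorDiagram d) (α β : ℕ+ →₀ ℕ) :
    D.numMarkings α β =
      Nat.card {u : Fin d → List (Mark d) // IsMarking α β u ∧ edgesOf (marksOf u) = D.edges} := by
  rw [numMarkings_eq]
  symm
  have h : ∀ u : Fin d → List (Mark d), (IsMarking α β u ∧ edgesOf (marksOf u) = D.edges) ↔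
      (flat u).Pairwise Label.Lt ∧ ∃ C : D.Compatible α β,
        ∀ x, (flat u : Multiset (Label d)).count x = labelCount C x := by
    intro u
    have h1 : (∃ C : D.Compatible α β, ∀ x, (flat u : Multiset (Label d)).count x = labelCount C x) ↔
        ∃ C : D.Compatible α β, ∀ x, (marksOf u).count x = labelCount C (Sum.inr x) := by
      refine exists_congr fun C => ⟨fun h x => by rw [← h, count_flat_inr], ?_⟩
      rintro h (i | x)
      · rw [count_flat_inl, labelCount_floor]
      · rw [count_flat_inr, h]
    rw [h1, exists_compatible_iff, pairwise_flat_iff, IsMarking]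
    constructor
    · rintro ⟨⟨h2, h3, h4, h5⟩, h6⟩
      exact ⟨h2, h6, h3, h4, (forall_outflow_iff h2.lt_tgt).2 h5⟩
    · rintro ⟨h2, h6, h3, h4, h5⟩
      exact ⟨⟨h2, h3, h4, (forall_outflow_iff h2.lt_tgt).1 h5⟩, h6⟩
  refine Nat.card_congr (Equiv.ofBijective (fun u => ⟨flat u.1, (h u.1).1 u.2⟩) ⟨?_, ?_⟩)
  · intro u u' e
    exact Subtype.ext (flat_injective (congrArg Subtype.val e))
  · rintro ⟨L, hL⟩
    obtain ⟨C, hC⟩ := hL.2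
    obtain ⟨u, rfl⟩ := exists_eq_flat hL.1 fun i => by rw [hC, labelCount_floor]
    exact ⟨⟨u, (h u).2 hL⟩, rfl⟩

theorem finite_isMarking (α β : ℕ+ →₀ ℕ) : {u : Fin d → List (Mark d) | IsMarking α β u}.Finite := by
  have h1 : {x : Mark d | (x.2.1 : ℕ) ≤ d}.Finite := by
    have : ({w : ℕ+ | (w : ℕ) ≤ d}).Finite :=
      Set.Finite.of_finite_image (f := fun w : ℕ+ => (w : ℕ)) ((Set.finite_Iic d).subset (by
        rintro _ ⟨w, hw, rfl⟩
        exact hw)) PNat.coe_injective.injOn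
    exact (Set.finite_univ.prod (this.prod Set.finite_univ)).subset fun x hx => by simpa using hx
  refine (Set.Finite.pi' fun _ : Fin d => finite_lists h1 d).subset fun u hu g => ?_
  have h2 := hu.2.2.2 g g.2
  have h3 : ((u g).map fun x => (x.2.1 : ℕ)).sum ≤ g + 1 := by
    rw [← h2, cutflow, marksOf, ← Finset.add_sum_erase _ _ (Finset.mem_univ g), Multiset.map_add,
      Multiset.sum_add]
    refine le_trans (le_of_eq ?_) (Nat.le_add_right _ _)
    rw [Multiset.map_coe, Multiset.sum_coe]
    congr 1
    refine List.map_congr_left fun x hx => ?_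
    have := hu.1.1 g x hx
    rw [if_pos ⟨this.1, this.2.1⟩]
  refine ⟨?_, fun x hx => ?_⟩
  · have : (u g).length ≤ ((u g).map fun x => (x.2.1 : ℕ)).sum := by
      have := List.length_le_sum_of_one_le ((u g).map fun x => (x.2.1 : ℕ)) (by
        simp only [List.mem_map, forall_exists_index, and_imp]
        rintro _ x _ rfl
        exact x.2.1.pos)
      simpa using this
    have := g.2
    omega
  · have : (x.2.1 : ℕ) ≤ ((u g).map fun x => (x.2.1 : ℕ)).sum :=
      List.le_sum_of_mem (List.mem_map.2 ⟨x, hx, rfl⟩)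
    have := g.2
    change (x.2.1 : ℕ) ≤ d
    omega

/-- The words between the floors of the markings of floor diagrams of cogenus `δ`. -/
noncomputable def markings (δ d : ℕ) (α β : ℕ+ →₀ ℕ) : Finset (Fin d → List (Mark d)) :=
  open Classical in
  {u ∈ (finite_isMarking α β).toFinset | 2 * ((edgesOf (marksOf u)).card + δ) = d * (d - 1)}

theorem mem_markings {δ : ℕ} {α β : ℕ+ →₀ ℕ} {u : Fin d → List (Mark d)} :
    u ∈ markings δ d α β ↔ IsMarking α β u ∧
      2 * ((edgesOf (marksOf u)).card + δ) = d * (d - 1) := by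
  simp [markings]

theorem exists_diagram {α β : ℕ+ →₀ ℕ} {u : Fin d → List (Mark d)} (hu : IsMarking α β u) :
    ∃ D : FloorDiagram d, edgesOf (marksOf u) = D.edges := by
  refine ⟨⟨edgesOf (marksOf u), ?_, fun j => ?_⟩, rfl⟩
  · rintro ⟨s, t, w⟩ he
    simp only [edgesOf, Multiset.mem_filterMap] at he
    obtain ⟨⟨s', w', t' | c⟩, hx, hx'⟩ := he
    · simp only [Sum.elim_inl, Option.some.injEq, Prod.mk.injEq] at hx'
      obtain ⟨rfl, rfl, rfl⟩ := hx'
      exact hu.1.lt_tgt _ hx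
    · simp at hx'
  · have h1 := outflow_eq (marksOf u) j
    have h2 := inflow_eq (marksOf u) j
    have h4 := (forall_outflow_iff hu.1.lt_tgt).2 hu.2.2.2 j
    have h3 : ∀ s : Multiset (Fin d × Fin d × ℕ+), (s.map fun e => ((e.2.2 : ℕ) : ℤ)).sum =
        (((s.map fun e => (e.2.2 : ℕ)).sum : ℕ) : ℤ) := by
      intro s
      rw [Nat.cast_multiset_sum, Multiset.map_map]
      rfl
    rw [edgeDivergence, h3, h3]
    omega

theorem relativeSeveriDegree_eq (δ : ℕ) (α β : ℕ+ →₀ ℕ) :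
    relativeSeveriDegree δ α β = (β.prod fun j k => (j : ℕ) ^ k) *
      ∑ u ∈ markings δ (seqDegree α + seqDegree β) α β,
        ((edgesOf (marksOf u)).map fun e => (e.2.2 : ℕ) ^ 2).prod := by
  classical
  rw [relativeSeveriDegree]
  generalize seqDegree α + seqDegree β = d
  have hcard : ∀ D : FloorDiagram d, D.cogenus = δ →
      D.numMarkings α β = #{u ∈ markings δ d α β | edgesOf (marksOf u) = D.edges} := by
    intro D hD
    rw [cogenus_eq_iff] at hD
    rw [numMarkings_eq_card_isMarking, ← Nat.card_eq_finsetCard]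
    refine Nat.card_congr (Equiv.subtypeEquivRight fun u => ?_)
    rw [Finset.mem_filter, mem_markings]
    constructor
    · rintro ⟨h1, h2⟩
      exact ⟨⟨h1, by rw [h2, hD]⟩, h2⟩
    · rintro ⟨h1, h2⟩
      exact ⟨h1.1, h2⟩
  have hD : ∀ u ∈ markings δ d α β, ∃ D : FloorDiagram d, edgesOf (marksOf u) = D.edges :=
    fun u hu => exists_diagram (mem_markings.1 hu).1
  have : Nonempty (FloorDiagram d) := ⟨0, by simp, by simp [edgeDivergence]⟩
  choose! D hD using hD
  have hDδ : ∀ u ∈ markings δ d α β, (D u).cogenus = δ := fun u hu => by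
    rw [cogenus_eq_iff, ← hD u hu]
    exact (mem_markings.1 hu).2
  rw [finsum_eq_sum_of_support_subset (s := (markings δ d α β).image D), Finset.mul_sum,
    ← Finset.sum_fiberwise_of_maps_to (t := (markings δ d α β).image D)
      fun u hu => Finset.mem_image_of_mem D hu]
  · refine Finset.sum_congr rfl fun D' hD' => ?_
    obtain ⟨v, hv, rfl⟩ := Finset.mem_image.1 hD'
    rw [finsum_eq_if, if_pos (hDδ v hv), hcard _ (hDδ v hv)]
    have h1 : {u ∈ markings δ d α β | edgesOf (marksOf u) = (D v).edges} =
        {u ∈ markings δ d α β | D u = D v} := Finset.filter_congr fun u hu => by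
      rw [FloorDiagram.ext_iff, hD u hu]
    rw [h1, Finset.sum_congr rfl (g := fun _ => (β.prod fun j k => (j : ℕ) ^ k) *
      (D v).multiplicity)]
    · rw [Finset.sum_const, smul_eq_mul, mul_comm]
    · intro u hu
      rw [Finset.mem_filter] at hu
      rw [hD u hu.1, hu.2, FloorDiagram.multiplicity]
  · intro D' hD'
    rw [Function.mem_support, finsum_eq_if] at hD'
    split_ifs at hD' with h
    · rw [hcard D' h] at hD'
      obtain ⟨u, hu⟩ := Finset.card_pos.1 (Nat.pos_of_ne_zero (right_ne_zero_of_mul hD'))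
      rw [Finset.mem_filter] at hu
      rw [Finset.mem_coe, Finset.mem_image]
      exact ⟨u, hu.1, FloorDiagram.ext (by rw [← hD u hu.1, hu.2])⟩
    · exact (hD' rfl).elim

end Words

/-! ### Counting arrangements -/

section Arrangements

variable {X : Type*}

theorem encard_insertions [DecidableEq X] {z : X} {v : List X} (hz : z ∉ v) (k : ℕ) :
    {l : List X | l.filter (fun x => x ≠ z) = v ∧ l.count z = k}.encard =
      ((v.length + k).choose k : ℕ) := by
  induction v generalizing k with
  | nil =>
    have : {l : List X | l.filter (fun x => x ≠ z) = [] ∧ l.count z = k} =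
        {List.replicate k z} := by
      ext l
      simp only [Set.mem_ofPred_eq, Set.mem_singleton_iff, List.filter_eq_nil_iff, ne_eq,
        decide_not, Bool.not_eq_eq_eq_not, Bool.not_true, decide_eq_false_iff_not, not_not]
      constructor
      · rintro ⟨h, rfl⟩
        rw [List.eq_replicate_iff]
        exact ⟨(List.count_eq_length.2 fun b hb => (h b hb).symm).symm, h⟩
      · rintro rfl
        exact ⟨fun a ha => List.eq_of_mem_replicate ha, List.count_replicate_self⟩
    rw [this]
    simp
  | cons x v ih =>
    have hx : x ≠ z := fun h => hz (h ▸ List.mem_cons_self)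
    have hv : z ∉ v := fun h => hz (List.mem_cons_of_mem _ h)
    induction k with
    | zero =>
      have : {l : List X | l.filter (fun x => x ≠ z) = x :: v ∧ l.count z = 0} = {x :: v} := by
        ext l
        simp only [Set.mem_ofPred_eq, Set.mem_singleton_iff, List.count_eq_zero]
        constructor
        · rintro ⟨h, h'⟩
          rw [← h, List.filter_eq_self.2]
          intro a ha
          simpa using fun e : a = z => h' (e ▸ ha)
        · rintro rfl
          refine ⟨List.filter_eq_self.2 fun a ha => ?_, hz⟩
          simpa using fun e : a = z => hz (e ▸ ha)
      rw [this]
      simp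
    | succ k ihk =>
      have : {l : List X | l.filter (fun x => x ≠ z) = x :: v ∧ l.count z = k + 1} =
          List.cons x '' {l | l.filter (fun x => x ≠ z) = v ∧ l.count z = k + 1} ∪
            List.cons z '' {l | l.filter (fun x => x ≠ z) = x :: v ∧ l.count z = k} := by
        ext l
        simp only [Set.mem_union, Set.mem_image, Set.mem_ofPred_eq]
        constructor
        · rintro ⟨h, h'⟩
          cases l with
          | nil => simp at h
          | cons y l =>
            by_cases hy : y = z
            · subst hy
              exact Or.inr ⟨l, ⟨by simpa using h, by simpa using h'⟩, rfl⟩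
            · rw [List.filter_cons_of_pos (by simpa using hy), List.cons.injEq] at h
              rw [List.count_cons_of_ne hy] at h'
              exact Or.inl ⟨l, ⟨h.2, h'⟩, by rw [h.1]⟩
        · rintro (⟨l, ⟨h, h'⟩, rfl⟩ | ⟨l, ⟨h, h'⟩, rfl⟩)
          · rw [List.filter_cons_of_pos (by simpa using hx), h, List.count_cons_of_ne hx, h']
            exact ⟨rfl, rfl⟩
          · rw [List.filter_cons_of_neg (by simp), h, List.count_cons_self, h']
            exact ⟨rfl, rfl⟩
      rw [this, Set.encard_union_eq, (List.cons_injective).encard_image,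
        (List.cons_injective).encard_image, ih hv, ihk]
      · rw [← Nat.cast_add, List.length_cons, show v.length + (k + 1) = v.length + 1 + k by ring,
          show v.length + 1 + (k + 1) = v.length + 1 + k + 1 by ring, Nat.choose_succ_succ, add_comm]
      · rw [Set.disjoint_left]
        rintro _ ⟨l, _, rfl⟩ ⟨l', _, h⟩
        exact hx (List.cons.inj h).1.symm

/-- The lists that arise from `v` by inserting `n z` copies of each `z ∈ S`. -/
def arrangements [DecidableEq X] (v : List X) (S : Finset X) (n : X → ℕ) : Set (List X) :=
  {l | l.filter (fun x => x ∉ S) = v ∧ ∀ z ∈ S, l.count z = n z}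

theorem finite_arrangements_and_ncard [DecidableEq X] {v : List X} {S : Finset X} (n : X → ℕ)
    (hv : ∀ x ∈ v, x ∉ S) : (arrangements v S n).Finite ∧
      (arrangements v S n).ncard * (v.length.factorial * ∏ z ∈ S, (n z).factorial) =
        (v.length + ∑ z ∈ S, n z).factorial := by
  induction S using Finset.induction_on generalizing v with
  | empty =>
    have : arrangements v ∅ n = {v} := by
      ext l
      simp [arrangements]
    rw [this]
    simp
  | insert z S hz ih =>
    set A := {l : List X | l.filter (fun x => x ≠ z) = v ∧ l.count z = n z} with hA
    have hAe : A.encard = _ := encard_insertions (fun h => hv z h (mem_insert_self _ _)) (n z)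
    have hAf : A.Finite := Set.finite_of_encard_eq_coe hAe
    have hAc : A.ncard = (v.length + n z).choose (n z) := by
      rw [Set.ncard, hAe, ENat.toNat_natCast]
    have hlen : ∀ w ∈ A, w.length = v.length + n z := by
      rintro w ⟨h, h'⟩
      rw [← h, ← h', List.count_eq_countP, ← List.countP_eq_length_filter,
        List.length_eq_countP_add_countP (fun x => x ≠ z)]
      congr 1
      exact List.countP_congr fun x _ => by simp
    have hS : ∀ w ∈ A, ∀ x ∈ w, x ∉ S := by
      rintro w ⟨h, h'⟩ x hx hxS
      refine hv x ?_ (mem_insert_of_mem hxS)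
      rw [← h, List.mem_filter]
      refine ⟨hx, ?_⟩
      simp only [ne_eq, decide_not, Bool.not_eq_eq_eq_not, Bool.not_true, decide_eq_false_iff_not]
      rintro rfl
      exact hz hxS
    have hmem : ∀ l, l ∈ arrangements v (insert z S) n ↔
        ∃ w ∈ A, l ∈ arrangements w S n := by
      intro l
      have h1 : (l.filter fun x => x ∉ S).filter (fun x => x ≠ z) =
          l.filter fun x => x ∉ insert z S := by
        rw [List.filter_filter]
        refine List.filter_congr fun x _ => ?_
        simp [not_or]
      have h2 : (l.filter fun x => x ∉ S).count z = l.count z :=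
        List.count_filter (by simpa using hz)
      simp only [arrangements, Set.mem_ofPred_eq, hA, ← h1, ← h2,
        Finset.forall_mem_insert]
      constructor
      · rintro ⟨h3, h4, h5⟩
        exact ⟨_, ⟨h3, h4⟩, rfl, h5⟩
      · rintro ⟨w, ⟨h3, h4⟩, rfl, h5⟩
        exact ⟨h3, h4, h5⟩
    have hfin : (arrangements v (insert z S) n).Finite := by
      refine (hAf.biUnion fun w hw => (ih (hS w hw)).1).subset fun l hl => ?_
      simpa using (hmem l).1 hl
    refine ⟨hfin, ?_⟩
    have hsum : (arrangements v (insert z S) n).ncard =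
        ∑ w ∈ hAf.toFinset, (arrangements w S n).ncard := by
      rw [Set.ncard_eq_toFinset_card _ hfin, Finset.card_eq_sum_card_fiberwise
        (f := fun l => l.filter fun x => x ∉ S) (t := hAf.toFinset)]
      · refine Finset.sum_congr rfl fun w hw => ?_
        rw [Set.Finite.mem_toFinset] at hw
        rw [← Set.ncard_coe_finset]
        congr 1
        ext l
        simp only [coe_filter, Set.Finite.mem_toFinset, hmem, Set.mem_ofPred_eq]
        constructor
        · rintro ⟨⟨w', _, h⟩, rfl⟩
          exact ⟨rfl, h.2⟩
        · exact fun h => ⟨⟨w, hw, h⟩, h.1⟩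
      · intro l hl
        simp only [Set.Finite.coe_toFinset, hmem] at hl ⊢
        obtain ⟨w, hw, h⟩ := hl
        rwa [h.1]
    have h3 : (arrangements v (insert z S) n).ncard *
        ((v.length + n z).factorial * ∏ z ∈ S, (n z).factorial) =
        A.ncard * (v.length + n z + ∑ z ∈ S, n z).factorial := by
      rw [hsum, Finset.sum_mul, Finset.sum_congr rfl (g := fun _ =>
        (v.length + n z + ∑ z ∈ S, n z).factorial), Finset.sum_const, smul_eq_mul,
        Set.ncard_eq_toFinset_card _ hAf]
      intro w hw
      rw [Set.Finite.mem_toFinset] at hw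
      rw [← hlen w hw]
      exact (ih (hS w hw)).2
    have h4 := Nat.add_choose_mul_factorial_mul_factorial v.length (n z)
    rw [← hAc] at h4
    rw [Finset.prod_insert hz, Finset.sum_insert hz, ← add_assoc]
    refine Nat.eq_of_mul_eq_mul_left (Nat.factorial_pos (v.length + n z)) ?_
    calc _ = ((arrangements v (insert z S) n).ncard *
        ((v.length + n z).factorial * ∏ z ∈ S, (n z).factorial)) *
        (v.length.factorial * (n z).factorial) := by ring
      _ = _ := by
        rw [h3, ← h4]
        ring

theorem filter_append_filter_of_pairwise {key : X → ℕ} {a : ℕ} {l : List X}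
    (hl : l.Pairwise fun x y => key x ≤ key y) (h : ∀ x ∈ l, key x ≤ a) :
    l.filter (fun x => key x ≠ a) ++ l.filter (fun x => key x = a) = l := by
  induction l with
  | nil => rfl
  | cons x l ih =>
    rw [List.pairwise_cons] at hl
    have ih' := ih hl.2 fun y hy => h y (List.mem_cons_of_mem _ hy)
    by_cases hx : key x = a
    · have h1 : ∀ y ∈ l, key y = a := fun y hy =>
        le_antisymm (h y (List.mem_cons_of_mem _ hy)) (hx ▸ hl.1 y hy)
      rw [List.filter_eq_nil_iff.2, List.filter_eq_self.2, List.nil_append]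
      · simpa [hx] using h1
      · simpa [hx] using h1
    · rw [List.filter_cons_of_pos (by simpa using hx), List.filter_cons_of_neg (by simpa using hx),
        List.cons_append, ih']

theorem eq_nil_of_forall_mem_empty {key : X → ℕ} {l : List X} (h : ∀ x ∈ l, key x ∈ (∅ : Finset ℕ)) :
    l = [] :=
  List.eq_nil_iff_forall_not_mem.2 fun x hx => by simpa using h x hx

theorem card_pairwise_key (key : X → ℕ) (T : Finset ℕ) (Q : ℕ → Set (List X)) :
    Nat.card {l : List X // l.Pairwise (fun x y => key x ≤ key y) ∧ (∀ x ∈ l, key x ∈ T) ∧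
      ∀ k ∈ T, l.filter (fun x => key x = k) ∈ Q k} =
    ∏ k ∈ T, Nat.card {l : List X // (∀ x ∈ l, key x = k) ∧ l ∈ Q k} := by
  induction T using Finset.induction_on_max with
  | empty =>
    rw [Finset.prod_empty, Nat.card_eq_one_iff_unique]
    refine ⟨⟨fun l l' => Subtype.ext ?_⟩, ⟨⟨[], by simp⟩⟩⟩
    rw [eq_nil_of_forall_mem_empty l.2.2.1, eq_nil_of_forall_mem_empty l'.2.2.1]
  | insert a T ha ih =>
    rw [Finset.prod_insert fun h => (ha a h).false, ← ih, mul_comm, ← Nat.card_prod]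
    have hle : ∀ l : List X, (∀ x ∈ l, key x ∈ insert a T) → ∀ x ∈ l, key x ≤ a := by
      intro l h x hx
      rcases mem_insert.1 (h x hx) with e | e
      exacts [e.le, (ha _ e).le]
    have hne : ∀ k ∈ T, k ≠ a := fun k hk => (ha k hk).ne
    refine Nat.card_congr
      { toFun := fun l => (⟨l.1.filter fun x => key x ≠ a, ?_, ?_, ?_⟩,
          ⟨l.1.filter fun x => key x = a, ?_, l.2.2.2 a (mem_insert_self _ _)⟩)
        invFun := fun p => ⟨p.1.1 ++ p.2.1, ?_, ?_, ?_⟩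
        left_inv := ?_
        right_inv := ?_ }
    · exact l.2.1.filter _
    · intro x hx
      rw [List.mem_filter] at hx
      exact (mem_insert.1 (l.2.2.1 x hx.1)).resolve_left (by simpa using hx.2)
    · intro k hk
      have := l.2.2.2 k (mem_insert_of_mem hk)
      rw [List.filter_filter]
      convert this using 2
      funext x
      have := hne k hk
      rw [Bool.eq_iff_iff]
      simp only [ne_eq, decide_not, Bool.and_eq_true, decide_eq_true_eq, Bool.not_eq_eq_eq_not,
        Bool.not_true, decide_eq_false_iff_not]
      omega
    · intro x hx
      simpa using (List.mem_filter.1 hx).2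
    · rw [List.pairwise_append]
      refine ⟨p.1.2.1, ?_, fun x hx y hy => ?_⟩
      · rw [List.pairwise_iff_forall_sublist]
        intro x y h
        rw [p.2.2.1 x (h.subset (by simp)), p.2.2.1 y (h.subset (by simp))]
      · rw [p.2.2.1 y hy]
        exact (ha _ (p.1.2.2.1 x hx)).le
    · intro x hx
      rw [List.mem_append] at hx
      rcases hx with hx | hx
      · exact mem_insert_of_mem (p.1.2.2.1 x hx)
      · rw [p.2.2.1 x hx]
        exact mem_insert_self _ _
    · intro k hk
      rw [List.filter_append]
      rcases mem_insert.1 hk with rfl | hk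
      · rw [List.filter_eq_nil_iff.2, List.filter_eq_self.2, List.nil_append]
        · exact p.2.2.2
        · intro x hx
          simpa using p.2.2.1 x hx
        · intro x hx
          simpa using hne _ (p.1.2.2.1 x hx)
      · have : p.2.1.filter (fun x => key x = k) = [] := List.filter_eq_nil_iff.2 fun x hx => by
          rw [p.2.2.1 x hx]
          simpa using (hne k hk).symm
        rw [this, List.append_nil]
        exact p.1.2.2.2 k hk
    · intro l
      exact Subtype.ext (filter_append_filter_of_pairwise l.2.1 (hle _ l.2.2.1))
    · rintro ⟨⟨l, hl⟩, ⟨l', hl'⟩⟩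
      refine Prod.ext (Subtype.ext ?_) (Subtype.ext ?_)
      · dsimp only
        rw [List.filter_append, List.filter_eq_self.2, List.filter_eq_nil_iff.2, List.append_nil]
        · intro x hx
          simpa using hl'.1 x hx
        · intro x hx
          simpa using hne _ (hl.2.1 x hx)
      · dsimp only
        rw [List.filter_append, List.filter_eq_nil_iff.2, List.filter_eq_self.2, List.nil_append]
        · intro x hx
          simpa using hl'.1 x hx
        · intro x hx
          simpa using hne _ (hl.2.1 x hx)

theorem eq_of_pairwise_key {key : X → ℕ} {T : Finset ℕ} {w w' : List X}
    (hw : w.Pairwise fun x y => key x ≤ key y) (hw' : w'.Pairwise fun x y => key x ≤ key y)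
    (h : ∀ x ∈ w, key x ∈ T) (h' : ∀ x ∈ w', key x ∈ T)
    (hk : ∀ k ∈ T, (w.filter fun x => key x = k) = w'.filter fun x => key x = k) : w = w' := by
  induction T using Finset.induction_on_max generalizing w w' with
  | empty =>
    rw [eq_nil_of_forall_mem_empty h, eq_nil_of_forall_mem_empty h']
  | insert a T ha ih =>
    have hle : ∀ l : List X, (∀ x ∈ l, key x ∈ insert a T) → ∀ x ∈ l, key x ≤ a := by
      intro l h x hx
      rcases mem_insert.1 (h x hx) with e | e
      exacts [e.le, (ha _ e).le]
    have hm : ∀ l : List X, (∀ x ∈ l, key x ∈ insert a T) →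
        ∀ x ∈ l.filter fun x => key x ≠ a, key x ∈ T := by
      intro l h x hx
      rw [List.mem_filter] at hx
      exact (mem_insert.1 (h x hx.1)).resolve_left (by simpa using hx.2)
    rw [← filter_append_filter_of_pairwise hw (hle w h),
      ← filter_append_filter_of_pairwise hw' (hle w' h'), hk a (mem_insert_self _ _),
      ih (hw.filter _) (hw'.filter _) (hm w h) (hm w' h')]
    intro k hkT
    have e : ∀ l : List X, ((l.filter fun x => key x ≠ a).filter fun x => key x = k) =
        l.filter fun x => key x = k := by
      intro l
      rw [List.filter_filter]
      refine List.filter_congr fun x _ => ?_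
      have := (ha k hkT).ne
      rw [Bool.eq_iff_iff]
      simp only [ne_eq, decide_not, Bool.and_eq_true, decide_eq_true_eq,
        Bool.not_eq_eq_eq_not, Bool.not_true, decide_eq_false_iff_not]
      omega
    rw [e, e, hk k (mem_insert_of_mem hkT)]

theorem card_pairwise_key_arrangements [DecidableEq X] {key : X → ℕ} {v : List X} {S : Finset X} {n : X → ℕ}
    {T : Finset ℕ} (hv : v.Pairwise fun x y => key x ≤ key y) (hvS : ∀ x ∈ v, x ∉ S)
    (hvT : ∀ x ∈ v, key x ∈ T) (hST : ∀ z ∈ S, key z ∈ T) :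
    (Nat.card {l : List X // l.Pairwise (fun x y => key x ≤ key y) ∧ l ∈ arrangements v S n} : ℚ) =
    ∏ k ∈ T, (((v.filter fun x => key x = k).length + ∑ z ∈ S with key z = k, n z).factorial : ℚ) /
      ((v.filter fun x => key x = k).length.factorial *
        ∏ z ∈ S with key z = k, ((n z).factorial : ℚ)) := by
  let Q : ℕ → Set (List X) := fun k =>
    arrangements (v.filter fun x => key x = k) {z ∈ S | key z = k} n
  have hT : ∀ {l : List X}, l ∈ arrangements v S n → ∀ x ∈ l, key x ∈ T := by
    intro l h x hx
    by_cases hxS : x ∈ S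
    · exact hST x hxS
    · refine hvT x ?_
      rw [← h.1, List.mem_filter]
      exact ⟨hx, by simpa using hxS⟩
  have h1 : Nat.card {l : List X // l.Pairwise (fun x y => key x ≤ key y) ∧
      l ∈ arrangements v S n} = ∏ k ∈ T, (Q k).ncard := by
    have h2 : ∀ l : List X, (l.Pairwise (fun x y => key x ≤ key y) ∧ l ∈ arrangements v S n) ↔
        l.Pairwise (fun x y => key x ≤ key y) ∧ (∀ x ∈ l, key x ∈ T) ∧
          ∀ k ∈ T, l.filter (fun x => key x = k) ∈ Q k := by
      intro l
      have h3 : ∀ k, ((l.filter fun x => key x = k).filter fun x => x ∉ {z ∈ S | key z = k}) =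
          (l.filter fun x => x ∉ S).filter fun x => key x = k := by
        intro k
        rw [List.filter_filter, List.filter_filter]
        refine List.filter_congr fun x _ => ?_
        rw [Bool.eq_iff_iff]
        simp
        tauto
      have h4 : ∀ z, (l.filter fun x => key x = key z).count z = l.count z := fun z =>
        List.count_filter (by simp)
      constructor
      · rintro ⟨h5, h6⟩
        refine ⟨h5, hT h6, fun k _ => ⟨?_, fun z hz => ?_⟩⟩
        · rw [h3, h6.1]
        · obtain ⟨hz', rfl⟩ := Finset.mem_filter.1 hz
          rw [h4, h6.2 z hz']
      · rintro ⟨h5, h6, h7⟩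
        refine ⟨h5, ?_, fun z hz => ?_⟩
        · refine eq_of_pairwise_key (h5.filter _) hv (fun x hx => h6 x (List.mem_of_mem_filter hx)) hvT
            fun k hk => ?_
          rw [← h3, (h7 k hk).1]
        · rw [← h4, (h7 _ (hST z hz)).2 z (Finset.mem_filter.2 ⟨hz, rfl⟩)]
    rw [Nat.card_congr (Equiv.subtypeEquivRight h2), card_pairwise_key]
    refine Finset.prod_congr rfl fun k _ => ?_
    rw [← Nat.card_coe_set_eq]
    refine Nat.card_congr (Equiv.subtypeEquivRight fun l => and_iff_right_of_imp fun h x hx => ?_)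
    by_cases hxS : x ∈ {z ∈ S | key z = k}
    · exact (Finset.mem_filter.1 hxS).2
    · have : x ∈ v.filter fun x => key x = k := by
        rw [← h.1, List.mem_filter]
        exact ⟨hx, decide_eq_true hxS⟩
      simpa using (List.mem_filter.1 this).2
  rw [h1, Nat.cast_prod]
  refine Finset.prod_congr rfl fun k _ => ?_
  rw [eq_div_iff (by positivity), ← (finite_arrangements_and_ncard n _).2]
  · push_cast
    rfl
  · intro x hx hxS
    exact hvS x (List.mem_of_mem_filter hx) (Finset.mem_filter.1 hxS).1

end Arrangements

/-! ### Inserting the trivial edges -/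

noncomputable instance : DecidableEq Letter := Classical.decEq _

@[to_additive]
theorem prod_entries_ofFn {M : Type*} [CommMonoid M] {d : ℕ} (f : Fin d → List Letter)
    (F : ℕ × Letter → M) :
    ((entries (List.ofFn f)).map F).prod = ∏ g : Fin d, ((f g).map fun l => F (g, l)).prod := by
  induction d generalizing F with
  | zero => simp [entries]
  | succ d ih =>
    rw [List.ofFn_succ, entries, List.map_append, List.prod_append, List.map_map, List.map_map,
      ih, Fin.prod_univ_succ]
    rfl

theorem mem_entries_ofFn {d : ℕ} {f : Fin d → List Letter} {x : ℕ × Letter} :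
    x ∈ entries (List.ofFn f) ↔ ∃ g : Fin d, ∃ l ∈ f g, x = (↑g, l) := by
  rw [mem_entries]
  constructor
  · rintro ⟨h, hx⟩
    rw [List.length_ofFn] at h
    exact ⟨⟨x.1, h⟩, x.2, by simpa using hx, rfl⟩
  · rintro ⟨g, l, hl, rfl⟩
    exact ⟨by simp, by simpa using hl⟩

theorem sum_map_ite_one {X : Type*} (L : List X) (p : X → Prop) [DecidablePred p] :
    (L.map fun x => if p x then 1 else 0).sum = (L.filter p).length := by
  induction L with
  | nil => rfl
  | cons x L ih => by_cases h : p x <;> simp [h, ih, add_comm]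

@[to_additive]
theorem prod_map_filter {X M : Type*} [CommMonoid M] (L : List X) (p : X → Prop) [DecidablePred p]
    {F : X → M} (h : ∀ x ∈ L, ¬ p x → F x = 1) : ((L.filter p).map F).prod = (L.map F).prod := by
  induction L with
  | nil => rfl
  | cons x L ih =>
    have ih' := ih fun y hy => h y (List.mem_cons_of_mem _ hy)
    by_cases hx : p x
    · simp [hx, ih']
    · simp [hx, ih', h x List.mem_cons_self hx]

theorem sum_map_eq_filter_add_count {X : Type*} [DecidableEq X] (L : List X) (p : X → Prop)
    [DecidablePred p] {F : X → ℕ} (z : X) (c : Prop) [Decidable c]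
    (h : ∀ x ∈ L, ¬ p x → F x = if c ∧ x = z then 1 else 0) (hz : c → ¬ p z) :
    (L.map F).sum = ((L.filter p).map F).sum + if c then L.count z else 0 := by
  induction L with
  | nil => simp
  | cons x L ih =>
    have ih' := ih fun y hy => h y (List.mem_cons_of_mem _ hy)
    by_cases hx : p x
    · rw [List.filter_cons_of_pos (by simpa using hx), List.map_cons, List.map_cons, List.sum_cons,
        List.sum_cons, ih', add_assoc]
      by_cases hc : c
      · have : x ≠ z := by
          rintro rfl
          exact hz hc hx
        simp [hc, this]
      · simp [hc]
    · rw [List.filter_cons_of_neg (by simpa using hx), List.map_cons, List.sum_cons, ih',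
        h x List.mem_cons_self hx]
      by_cases hc : c
      · by_cases hxz : x = z
        · subst hxz
          simp [hc]
          ring
        · simp [hc, hxz]
      · simp [hc]

section Reduce

variable {d : ℕ}

/-- The words without their trivial edges. -/
def reduce (f : Fin d → List Letter) (g : Fin d) : List Letter :=
  (f g).filter fun l => 1 ≤ endLetterCost d (g, l)

/-- The edge fits into the gap behind the floor `g`. -/
def Fits (g : Fin d) (l : Letter) : Prop :=
  l.left ≤ g ∧ g + l.right < d ∧ (l.tag = true → (g : ℕ) + 1 = d)

/-- An edge that crosses just one cut. -/
def straight (w : ℕ+) (t : Bool) : Letter := ⟨0, 0, w, t⟩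

theorem Fits.endLetterCost_eq_zero_iff {g : Fin d} {l : Letter} (h : Fits g l)
    (hg : (g : ℕ) + 1 < d) : endLetterCost d (g, l) = 0 ↔ l = straight 1 false := by
  obtain ⟨left, right, w, t⟩ := l
  have hw := w.pos
  simp only [Fits] at h
  have ht : t = false := by
    by_contra ht
    have := h.2.2 (by simpa using ht)
    omega
  simp only [straight, Letter.mk.injEq, ht, and_true, endLetterCost, ReachesEnd, letterCost]
  constructor
  · intro h0
    split_ifs at h0 with hr
    · rcases Nat.mul_eq_zero.1 h0 with h0 | h0 <;> omega
    · have h1 : (left + right + 1) * (w : ℕ) ≤ 1 := by omega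
      have h2 : (left + right + 1) ≤ 1 := (Nat.le_mul_of_pos_right _ hw).trans h1
      have h3 : (w : ℕ) ≤ 1 := (Nat.le_mul_of_pos_left _ (by omega)).trans h1
      refine ⟨by omega, by omega, ?_⟩
      rw [← PNat.coe_inj, PNat.one_coe]
      omega
  · rintro ⟨rfl, rfl, rfl⟩
    rw [if_neg (by omega)]
    simp

theorem Fits.endLetterCost_eq_zero_iff_of_last {g : Fin d} {l : Letter} (h : Fits g l)
    (hg : (g : ℕ) + 1 = d) : endLetterCost d (g, l) = 0 ↔ l = straight l.wt l.tag := by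
  obtain ⟨left, right, w, t⟩ := l
  have hw := w.pos
  simp only [Fits] at h
  have hr : right = 0 := by omega
  subst hr
  simp only [straight, Letter.mk.injEq, and_true, endLetterCost, ReachesEnd, add_zero]
  rw [if_pos hg, Nat.mul_eq_zero]
  omega

theorem closed_ofFn {f : Fin d → List Letter} (hf : ∀ g, ∀ l ∈ f g, Fits g l) :
    Closed (List.ofFn f) := by
  intro x hx
  obtain ⟨g, l, hl, rfl⟩ := mem_entries_ofFn.1 hx
  rw [List.length_ofFn]
  exact ⟨(hf g l hl).1, (hf g l hl).2.1⟩

theorem sum_entries_reduce {f : Fin d → List Letter} {F : ℕ × Letter → ℕ} {g₀ : Fin d} {z : Letter}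
    (h : ∀ g, ∀ l ∈ f g, endLetterCost d (g, l) = 0 → F (g, l) = if g = g₀ ∧ l = z then 1 else 0)
    (hz : endLetterCost d (g₀, z) = 0) :
    ((entries (List.ofFn f)).map F).sum =
      ((entries (List.ofFn (reduce f))).map F).sum + (f g₀).count z := by
  rw [sum_entries_ofFn, sum_entries_ofFn]
  have h1 : (f g₀).count z = ∑ g, if g = g₀ then (f g).count z else 0 := by simp
  rw [h1, ← Finset.sum_add_distrib]
  refine Finset.sum_congr rfl fun g _ => ?_
  refine sum_map_eq_filter_add_count (f g) (fun l => 1 ≤ endLetterCost d (g, l)) z (g = g₀)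
    (fun l hl h0 => h g l hl (by omega)) ?_
  rintro rfl
  omega

@[to_additive sum_reduce_entries]
theorem prod_entries_reduce {M : Type*} [CommMonoid M] {f : Fin d → List Letter}
    {F : ℕ × Letter → M} (h : ∀ g, ∀ l ∈ f g, endLetterCost d (g, l) = 0 → F (g, l) = 1) :
    ((entries (List.ofFn (reduce f))).map F).prod = ((entries (List.ofFn f)).map F).prod := by
  rw [prod_entries_ofFn, prod_entries_ofFn]
  refine Finset.prod_congr rfl fun g _ => ?_
  exact prod_map_filter (f g) (fun l => 1 ≤ endLetterCost d (g, l))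
    fun l hl h0 => h g l hl (by omega)

theorem cutWeight_eq_reduce {f : Fin d → List Letter} (hf : ∀ g, ∀ l ∈ f g, Fits g l) {h : Fin d}
    (hh : (h : ℕ) + 1 < d) : cutWeight (List.ofFn f) h =
      cutWeight (List.ofFn (reduce f)) h + (f h).count (straight 1 false) := by
  refine sum_entries_reduce (fun g l hl h0 => ?_) ?_
  · by_cases hg : (g : ℕ) + 1 < d
    · rw [(hf g l hl).endLetterCost_eq_zero_iff hg] at h0
      subst h0
      refine if_congr ?_ rfl rfl
      simp only [Crosses, straight, and_true, Fin.ext_iff]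
      omega
    · rw [(hf g l hl).endLetterCost_eq_zero_iff_of_last (by omega)] at h0
      rw [h0, if_neg, if_neg]
      · rintro ⟨rfl, -⟩
        exact hg hh
      · simp only [Crosses, straight]
        omega
  · refine (Fits.endLetterCost_eq_zero_iff ⟨Nat.zero_le _, h.2, fun h => ?_⟩ hh).2 rfl
    simp [straight] at h

theorem betaCount_eq_reduce {f : Fin d → List Letter} (hf : ∀ g, ∀ l ∈ f g, Fits g l) {h : Fin d}
    (hh : (h : ℕ) + 1 = d) (w : ℕ+) : betaCount (List.ofFn f) w =
      betaCount (List.ofFn (reduce f)) w + (f h).count (straight w false) := by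
  rw [betaCount, betaCount, List.length_ofFn, List.length_ofFn]
  refine sum_entries_reduce (fun g l hl h0 => ?_) ?_
  · by_cases hg : (g : ℕ) + 1 < d
    · rw [(hf g l hl).endLetterCost_eq_zero_iff hg] at h0
      rw [h0, if_neg, if_neg]
      · rintro ⟨rfl, -⟩
        exact hg.ne hh
      · simp only [ReachesEnd, straight]
        omega
    · rw [(hf g l hl).endLetterCost_eq_zero_iff_of_last (by omega)] at h0
      have hgh : g = h := Fin.ext (by omega)
      refine if_congr ?_ rfl rfl
      rw [h0]
      simp only [ReachesEnd, straight, Letter.mk.injEq, true_and, hgh, add_zero, hh]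
      tauto
  · simp [straight, endLetterCost, ReachesEnd, hh]

theorem alphaCount_eq_reduce {f : Fin d → List Letter} (hf : ∀ g, ∀ l ∈ f g, Fits g l) {h : Fin d}
    (hh : (h : ℕ) + 1 = d) (w : ℕ+) : alphaCount (List.ofFn f) w =
      alphaCount (List.ofFn (reduce f)) w + (f h).count (straight w true) := by
  rw [alphaCount, alphaCount, List.length_ofFn, List.length_ofFn]
  refine sum_entries_reduce (fun g l hl h0 => ?_) ?_
  · by_cases hg : (g : ℕ) + 1 < d
    · rw [(hf g l hl).endLetterCost_eq_zero_iff hg] at h0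
      rw [h0, if_neg, if_neg]
      · rintro ⟨rfl, -⟩
        exact hg.ne hh
      · simp only [ReachesEnd, straight]
        omega
    · rw [(hf g l hl).endLetterCost_eq_zero_iff_of_last (by omega)] at h0
      have hgh : g = h := Fin.ext (by omega)
      refine if_congr ?_ rfl rfl
      rw [h0]
      simp only [ReachesEnd, straight, Letter.mk.injEq, true_and, hgh, add_zero, hh]
      tauto
  · simp [straight, endLetterCost, ReachesEnd, hh]

theorem endCost_reduce (f : Fin d → List Letter) :
    endCost (List.ofFn (reduce f)) = endCost (List.ofFn f) := by
  rw [endCost, endCost, List.length_ofFn, List.length_ofFn]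
  exact sum_reduce_entries fun _ _ _ h => h

theorem innerSqProd_reduce {f : Fin d → List Letter} (hf : ∀ g, ∀ l ∈ f g, Fits g l) :
    innerSqProd (List.ofFn (reduce f)) = innerSqProd (List.ofFn f) := by
  rw [innerSqProd, innerSqProd, List.length_ofFn, List.length_ofFn]
  refine prod_entries_reduce fun g l hl h0 => ?_
  by_cases hg : (g : ℕ) + 1 < d
  · rw [(hf g l hl).endLetterCost_eq_zero_iff hg] at h0
    simp [h0, straight]
  · rw [(hf g l hl).endLetterCost_eq_zero_iff_of_last (by omega)] at h0
    rw [h0, if_pos]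
    simp only [ReachesEnd, straight]
    omega

/-- The number of edges that end at a floor. -/
def innerCount (c : List (List Letter)) : ℕ :=
  ((entries c).map fun x => if ReachesEnd c.length x then 0 else 1).sum

theorem endCost_add_innerCount {c : List (List Letter)} {n : ℕ} (hn : c.length = n + 1)
    (hc : Closed c) (h : ∀ i < n, cutWeight c i = i + 1) :
    2 * (endCost c + innerCount c) = (n + 1) * n := by
  have h1 := sum_endCutWeight hc
  have h2 : endCutWeight c n + innerCount c = (entries c).length := by
    rw [endCutWeight, innerCount, show (entries c).length = ((entries c).map fun _ => 1).sum by simp,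
      ← List.sum_map_add]
    congr 1
    refine List.map_congr_left fun x hx => ?_
    have := hc x hx
    simp only [endWt, hn, lt_irrefl, if_false, Crosses, ReachesEnd]
    split_ifs <;> omega
  rw [sum_marks, hn, Finset.sum_range_succ, Finset.sum_congr rfl (g := fun i => i + 1)] at h1
  · have h3 := Finset.sum_range_id_mul_two (n + 1)
    rw [Finset.sum_range_succ', add_zero, Nat.add_sub_cancel] at h3
    omega
  · intro i hi
    rw [mem_range] at hi
    rw [endCutWeight_of_lt (by omega), h i hi]

end Reduce

/-! ### Counting the completions of a word -/

section Completions

variable {d : ℕ}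

/-- The word `l` in the gap behind the floor `g` arises from the word `r g` by inserting the right
number of trivial edges. -/
def IsCompletion (α β : ℕ+ →₀ ℕ) (r : Fin d → List Letter) (g : Fin d) (l : List Letter) : Prop :=
  l.Pairwise (fun x y => x.key ≤ y.key) ∧ (∀ x ∈ l, Fits g x) ∧
    l.filter (fun x => 1 ≤ endLetterCost d (g, x)) = r g ∧
    ((g : ℕ) + 1 < d → l.count (straight 1 false) + cutWeight (List.ofFn r) g = g + 1) ∧
    ((g : ℕ) + 1 = d → ∀ w, l.count (straight w false) + betaCount (List.ofFn r) w = β w ∧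
      l.count (straight w true) + alphaCount (List.ofFn r) w = α w)

variable {δ : ℕ} {α β : ℕ+ →₀ ℕ} {r : Fin d → List Letter}

theorem Fits.right_eq_zero {g : Fin d} {l : Letter} (h : Fits g l) (hg : (g : ℕ) + 1 = d) :
    l.right = 0 := by
  have := h.2.1
  omega

theorem Fits.tag_eq_false {g : Fin d} {l : Letter} (h : Fits g l) (hg : (g : ℕ) + 1 < d) :
    l.tag = false := by
  by_contra ht
  have := h.2.2 (by simpa using ht)
  omega

theorem fits_of_mem_endConfigs (hr : List.ofFn r ∈ endConfigs δ d) {g : Fin d} {l : Letter}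
    (hl : l ∈ r g) : Fits g l ∧ 1 ≤ endLetterCost d (g, l) := by
  rw [mem_endConfigs] at hr
  have hx : ((g : ℕ), l) ∈ entries (List.ofFn r) := mem_entries_ofFn.2 ⟨g, l, hl, rfl⟩
  have h1 := hr.2.1 _ hx
  have h2 := hr.2.2.1.1 _ hx
  rw [List.length_ofFn] at h1 h2
  exact ⟨⟨h1.1, h1.2, h2.1⟩, h2.2⟩

theorem marks_ofFn (g : Fin d) : marks (List.ofFn r) g = (r g).length := by
  rw [marks, sum_entries_ofFn, Finset.sum_eq_single g]
  · simp
  · intro g' _ hg'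
    rw [List.sum_eq_zero_iff]
    simp only [List.mem_map, forall_exists_index, and_imp]
    rintro _ x _ rfl
    rw [if_neg fun h => hg' (Fin.ext h)]
  · simp

theorem card_isCompletion_of_lt (hr : List.ofFn r ∈ endConfigs δ d) {g : Fin d}
    (hg : (g : ℕ) + 1 < d) : (Nat.card {l // IsCompletion α β r g l} : ℚ) =
      gapCount (g + 1) (cutWeight (List.ofFn r) g) (marks (List.ofFn r) g) := by
  rw [gapCount, marks_ofFn]
  split_ifs with hX
  · have hfit : Fits g (straight 1 false) := ⟨Nat.zero_le _, g.2, fun h => by simp [straight] at h⟩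
    have h0 := (hfit.endLetterCost_eq_zero_iff hg).2 rfl
    have hz : straight 1 false ∉ r g := fun h => by
      have := (fits_of_mem_endConfigs hr h).2
      omega
    have h1 : {l | IsCompletion α β r g l} = {l | l.filter (fun x => x ≠ straight 1 false) = r g ∧
        l.count (straight 1 false) = g + 1 - cutWeight (List.ofFn r) g} := by
      ext l
      simp only [Set.mem_ofPred_eq]
      have hfilter : (∀ x ∈ l, Fits g x) → l.filter (fun x => x ≠ straight 1 false) =
          l.filter fun x => 1 ≤ endLetterCost d (g, x) := by
        refine fun h => List.filter_congr fun x hx => ?_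
        have := (h x hx).endLetterCost_eq_zero_iff hg
        rw [decide_eq_decide, ne_eq, ← this]
        omega
      constructor
      · rintro ⟨-, h2, h3, h4, -⟩
        have := h4 hg
        exact ⟨by rw [hfilter h2, h3], by omega⟩
      · rintro ⟨h2, h3⟩
        have hl : ∀ x ∈ l, Fits g x := by
          intro x hx
          by_cases hxz : x = straight 1 false
          · rw [hxz]
            exact hfit
          · refine (fits_of_mem_endConfigs hr (l := x) ?_).1
            rw [← h2, List.mem_filter]
            exact ⟨hx, decide_eq_true hxz⟩
        refine ⟨?_, hl, by rw [← hfilter hl, h2], fun _ => by omega, fun h => by omega⟩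
        rw [List.pairwise_iff_forall_sublist]
        intro x y hxy
        rw [Letter.key, (hl x (hxy.subset (by simp))).tag_eq_false hg]
        exact Nat.zero_le _
    have h2 := encard_insertions hz (g + 1 - cutWeight (List.ofFn r) g)
    rw [← h1] at h2
    rw [← Set.coe_ofPred, Nat.card_coe_set_eq, Set.ncard, h2, ENat.toNat_natCast, add_comm,
      ← Nat.choose_symm_add, add_comm]
  · rw [Nat.cast_eq_zero, Nat.card_eq_zero]
    left
    constructor
    rintro ⟨l, hl⟩
    have := hl.2.2.2.1 hg
    omega

theorem sum_entries_eq_last (F : ℕ × Letter → ℕ) {g : Fin d}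
    (h : ∀ g' ≠ g, ∀ l ∈ r g', F (g', l) = 0) :
    ((entries (List.ofFn r)).map F).sum = ((r g).map fun l => F (g, l)).sum := by
  rw [sum_entries_ofFn, Finset.sum_eq_single g]
  · intro g' _ hg'
    rw [List.sum_eq_zero_iff]
    simp only [List.mem_map, forall_exists_index, and_imp]
    rintro _ x hx rfl
    exact h g' hg' x hx
  · simp

theorem lastMarks_eq (hr : List.ofFn r ∈ endConfigs δ d) {g : Fin d} (hg : (g : ℕ) + 1 = d) :
    lastMarks (List.ofFn r) = ((r g).filter fun l => l.key = 0).length := by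
  rw [lastMarks, List.length_ofFn, sum_entries_eq_last (g := g), ← sum_map_ite_one]
  · congr 1
    refine List.map_congr_left fun l hl => if_congr ?_ rfl rfl
    have h1 := (fits_of_mem_endConfigs hr hl).1.right_eq_zero hg
    have := l.wt.pos
    simp only [ReachesEnd, h1, Letter.key]
    cases l.tag <;> simp [hg]
  · intro g' hg' l _
    rw [if_neg]
    rintro ⟨h1, -, h2⟩
    have h1 : (g' : ℕ) + l.right + 1 = d := h1
    have h2 : l.right = 0 := h2
    exact hg' (Fin.ext (by omega))

theorem alphaCount_eq (hr : List.ofFn r ∈ endConfigs δ d) {g : Fin d} (hg : (g : ℕ) + 1 = d)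
    (w : ℕ+) : alphaCount (List.ofFn r) w = ((r g).filter fun l => l.key = (w : ℕ)).length := by
  rw [alphaCount, List.length_ofFn, sum_entries_eq_last (g := g), ← sum_map_ite_one]
  · congr 1
    refine List.map_congr_left fun l hl => if_congr ?_ rfl rfl
    have h1 := (fits_of_mem_endConfigs hr hl).1.right_eq_zero hg
    have := w.pos
    simp only [ReachesEnd, h1, Letter.key]
    cases l.tag <;> simp [hg, this.ne]
  · intro g' hg' l hl
    rw [if_neg]
    rintro ⟨-, h2, -⟩
    have := (fits_of_mem_endConfigs hr hl).1.2.2 h2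
    exact hg' (Fin.ext (by omega))

theorem sum_betaCount (c : List (List Letter)) {s : Finset ℕ+}
    (hs : ∀ w, betaCount c w ≠ 0 → w ∈ s) : ∑ w ∈ s, betaCount c w = betaTotal c := by
  simp only [betaCount, betaTotal]
  rw [sum_map_finset_sum]
  congr 1
  refine List.map_congr_left fun x hx => ?_
  by_cases h : ReachesEnd c.length x ∧ x.2.tag = false
  · rw [if_pos h, Finset.sum_eq_single x.2.wt]
    · simp [h]
    · intro w _ hw
      rw [if_neg fun h' => hw h'.2.2.symm]
    · intro hw
      refine (hw (hs _ ?_)).elim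
      rw [betaCount, Ne, List.sum_eq_zero_iff]
      intro h0
      have := h0 _ (List.mem_map.2 ⟨x, hx, rfl⟩)
      simp [h] at this
  · rw [if_neg h]
    refine Finset.sum_eq_zero fun w _ => ?_
    rw [if_neg fun h' => h ⟨h'.1, h'.2.1⟩]

theorem straight_injective (t : Bool) : Function.Injective fun w => straight w t :=
  fun _ _ h => congrArg Letter.wt h

/-- The trivial edges in the last gap. -/
noncomputable def ends (α β : ℕ+ →₀ ℕ) : Finset Letter :=
  β.support.image (fun w => straight w false) ∪ α.support.image fun w => straight w true

/-- The number of trivial edges in the last gap. -/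
noncomputable def endMult (α β : ℕ+ →₀ ℕ) (c : List (List Letter)) (z : Letter) : ℕ :=
  if z.tag then α z.wt - alphaCount c z.wt else β z.wt - betaCount c z.wt

theorem straight_mem_ends {w : ℕ+} {t : Bool} :
    straight w t ∈ ends α β ↔ if t then w ∈ α.support else w ∈ β.support := by
  simp only [ends, mem_union, mem_image, straight, Letter.mk.injEq, true_and]
  cases t <;> simp

theorem exists_of_mem_ends {z : Letter} (hz : z ∈ ends α β) : z = straight z.wt z.tag := by
  simp only [ends, mem_union, mem_image] at hz
  rcases hz with ⟨w, _, rfl⟩ | ⟨w, _, rfl⟩ <;> rfl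

theorem fits_straight {g : Fin d} (hg : (g : ℕ) + 1 = d) (w : ℕ+) (t : Bool) :
    Fits g (straight w t) := ⟨Nat.zero_le _, g.2, fun _ => hg⟩

theorem isCompletion_iff_of_last (hr : List.ofFn r ∈ endConfigs δ d) {g : Fin d}
    (hg : (g : ℕ) + 1 = d)
    (h : (∀ w, betaCount (List.ofFn r) w ≤ β w) ∧ ∀ w, alphaCount (List.ofFn r) w ≤ α w)
    (l : List Letter) : IsCompletion α β r g l ↔ l.Pairwise (fun x y => x.key ≤ y.key) ∧
      l ∈ arrangements (r g) (ends α β) (endMult α β (List.ofFn r)) := by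
  have hz : ∀ w t, endLetterCost d (g, straight w t) = 0 := fun w t =>
    ((fits_straight hg w t).endLetterCost_eq_zero_iff_of_last hg).2 rfl
  have hmem : ∀ w t, straight w t ∉ r g := fun w t h => by
    have := (fits_of_mem_endConfigs hr h).2
    rw [hz] at this
    omega
  constructor
  · rintro ⟨h1, h2, h3, -, h4⟩
    refine ⟨h1, ?_, fun z hz' => ?_⟩
    · rw [← h3]
      refine List.filter_congr fun x hx => ?_
      rw [decide_eq_decide]
      by_cases hx0 : endLetterCost d (g, x) = 0
      · rw [hx0]
        refine iff_of_false (not_not.2 ?_) (by omega)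
        rw [(h2 x hx).endLetterCost_eq_zero_iff_of_last hg] at hx0
        rw [hx0] at hx ⊢
        have hpos := List.count_pos_iff.2 hx
        have h5 := h4 hg x.wt
        rw [straight_mem_ends]
        cases ht : x.tag
        · rw [ht] at hpos
          simp only [Bool.false_eq_true, if_false, Finsupp.mem_support_iff]
          omega
        · rw [ht] at hpos
          simp only [if_true, Finsupp.mem_support_iff]
          omega
      · refine iff_of_true (fun hxm => hx0 ?_) (by omega)
        rw [exists_of_mem_ends hxm, hz]
    · have h5 := h4 hg z.wt
      rw [endMult]
      conv_lhs => rw [exists_of_mem_ends hz']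
      cases z.tag
      · simp only [Bool.false_eq_true, if_false]
        omega
      · simp only [if_true]
        omega
  · rintro ⟨h1, h2, h3⟩
    have hl : ∀ x ∈ l, x ∉ ends α β → x ∈ r g := by
      intro x hx hxm
      rw [← h2, List.mem_filter]
      exact ⟨hx, decide_eq_true hxm⟩
    have hfit : ∀ x ∈ l, Fits g x := by
      intro x hx
      by_cases hxm : x ∈ ends α β
      · rw [exists_of_mem_ends hxm]
        exact fits_straight hg _ _
      · exact (fits_of_mem_endConfigs hr (hl x hx hxm)).1
    refine ⟨h1, hfit, ?_, fun h' => by omega, fun _ w => ?_⟩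
    · rw [← h2]
      refine List.filter_congr fun x hx => ?_
      rw [decide_eq_decide]
      by_cases hxm : x ∈ ends α β
      · refine iff_of_false ?_ (not_not.2 hxm)
        rw [exists_of_mem_ends hxm, hz]
        omega
      · exact iff_of_true (fits_of_mem_endConfigs hr (hl x hx hxm)).2 hxm
    · have hzero : ∀ t, straight w t ∉ ends α β → l.count (straight w t) = 0 := fun t ht =>
        List.count_eq_zero.2 fun hx => hmem w t (hl _ hx ht)
      have hb := h.1 w
      have ha := h.2 w
      constructor
      · by_cases hw : straight w false ∈ ends α β
        · have : l.count (straight w false) = β w - betaCount (List.ofFn r) w := h3 _ hw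
          omega
        · rw [hzero _ hw]
          rw [straight_mem_ends] at hw
          simp only [Bool.false_eq_true, if_false, Finsupp.mem_support_iff, not_not] at hw
          omega
      · by_cases hw : straight w true ∈ ends α β
        · have : l.count (straight w true) = α w - alphaCount (List.ofFn r) w := h3 _ hw
          omega
        · rw [hzero _ hw]
          rw [straight_mem_ends] at hw
          simp only [if_true, Finsupp.mem_support_iff, not_not] at hw
          omega

theorem filter_ends_zero :
    {z ∈ ends α β | z.key = 0} = β.support.image fun w => straight w false := by
  ext z
  simp only [ends, Finset.mem_filter, mem_union, mem_image]
  constructor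
  · rintro ⟨h | ⟨w, _, rfl⟩, hz⟩
    · exact h
    · exact absurd hz w.pos.ne'
  · rintro ⟨w, hw, rfl⟩
    exact ⟨Or.inl ⟨w, hw, rfl⟩, rfl⟩

theorem filter_ends {w : ℕ+} (hw : w ∈ α.support) :
    {z ∈ ends α β | z.key = (w : ℕ)} = {straight w true} := by
  ext z
  simp only [ends, Finset.mem_filter, mem_union, mem_image, Finset.mem_singleton]
  constructor
  · rintro ⟨⟨w', _, rfl⟩ | ⟨w', _, rfl⟩, hz⟩
    · exact absurd hz w.pos.ne
    · have : w' = w := PNat.coe_injective hz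
      rw [this]
  · rintro rfl
    exact ⟨Or.inr ⟨w, hw, rfl⟩, rfl⟩

theorem card_isCompletion_of_last (hr : List.ofFn r ∈ endConfigs δ d) {g : Fin d}
    (hg : (g : ℕ) + 1 = d) : (Nat.card {l // IsCompletion α β r g l} : ℚ) =
      lastWeight (List.ofFn r) α β := by
  rw [lastWeight]
  split_ifs with h
  · rw [Nat.card_congr (Equiv.subtypeEquivRight (isCompletion_iff_of_last hr hg h)),
      card_pairwise_key_arrangements (T := insert 0 (α.support.image fun w : ℕ+ => (w : ℕ))),
      Finset.prod_insert (by simp), Finset.prod_image PNat.coe_injective.injOn]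
    · congr 1
      · rw [filter_ends_zero, Finset.sum_image (straight_injective _).injOn,
          Finset.prod_image (straight_injective _).injOn, ← lastMarks_eq hr hg]
        have h1 : ∀ w, endMult α β (List.ofFn r) (straight w false) =
          β w - betaCount (List.ofFn r) w := fun _ => rfl
        simp only [h1]
        rw [Finset.sum_tsub_distrib _ fun w _ => h.1 w, sum_betaCount, ← Finsupp.degree_apply,
          add_comm]
        intro w hw
        have := h.1 w
        rw [Finsupp.mem_support_iff]
        omega
      · refine Finset.prod_congr rfl fun w hw => ?_
        have h1 : endMult α β (List.ofFn r) (straight w true) =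
          α w - alphaCount (List.ofFn r) w := rfl
        rw [filter_ends hw, Finset.sum_singleton, Finset.prod_singleton, ← alphaCount_eq hr hg, h1,
          Nat.add_sub_cancel' (h.2 w), Nat.cast_choose _ (h.2 w)]
    · have := (mem_endConfigs.1 hr).2.2.1.2 (r g) (by
        rw [List.getLast?_eq_getElem?]
        simp only [List.length_ofFn, Option.mem_def, List.getElem?_ofFn]
        rw [dif_pos (by omega)]
        congr 2
        exact Fin.ext (by simp only; omega))
      exact this
    · intro x hx hxm
      have := (fits_of_mem_endConfigs hr hx).2
      rw [exists_of_mem_ends hxm,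
        ((fits_straight hg _ _).endLetterCost_eq_zero_iff_of_last hg).2 rfl] at this
      omega
    · intro x hx
      cases ht : x.tag
      · simp [Letter.key, ht]
      · refine mem_insert_of_mem (mem_image.2 ⟨x.wt, ?_, by simp [Letter.key, ht]⟩)
        have h1 := h.2 x.wt
        rw [alphaCount_eq hr hg] at h1
        have h2 : x ∈ (r g).filter fun l => l.key = (x.wt : ℕ) :=
          List.mem_filter.2 ⟨hx, by simp [Letter.key, ht]⟩
        have h3 := List.length_pos_of_mem h2
        rw [Finsupp.mem_support_iff]
        omega
    · intro z hz
      simp only [ends, mem_union, mem_image] at hz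
      rcases hz with ⟨w, _, rfl⟩ | ⟨w, hw, rfl⟩
      · exact mem_insert_self _ _
      · exact mem_insert_of_mem (mem_image_of_mem _ hw)
  · rw [Nat.cast_eq_zero, Nat.card_eq_zero]
    left
    constructor
    rintro ⟨l, hl⟩
    refine h ⟨fun w => ?_, fun w => ?_⟩
    · have := (hl.2.2.2.2 hg w).1
      omega
    · have := (hl.2.2.2.2 hg w).2
      omega

end Completions

/-! ### From markings to configurations -/

section Convert

variable {d : ℕ}

/-- The relative position of a vertex in the gap behind the floor `g`. -/
def Mark.toLetter (x : Mark d) (g : Fin d) : Letter :=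
  ⟨g - x.1, x.tgt - 1 - g, x.2.1, decide x.IsAlpha⟩

/-- The vertex in a given relative position to the gap behind the floor `g`. -/
def Letter.toMark (l : Letter) (g : Fin d) : Mark d :=
  (⟨g - l.left, (Nat.sub_le _ _).trans_lt g.2⟩, l.wt,
    if h : g + l.right + 1 < d then Sum.inl ⟨g + l.right + 1, h⟩ else Sum.inr l.tag)

/-- The vertex may be placed into the gap behind the floor `g`. -/
def MarkFits (g : Fin d) (x : Mark d) : Prop :=
  x.1 ≤ g ∧ (g : ℕ) < x.tgt ∧ (x.IsAlpha → (g : ℕ) + 1 = d)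

theorem tgt_le (x : Mark d) : x.tgt ≤ d := by
  obtain ⟨s, w, t | b⟩ := x
  exacts [t.2.le, le_rfl]

theorem MarkFits.fits {g : Fin d} {x : Mark d} (h : MarkFits g x) : Fits g (x.toLetter g) := by
  have := tgt_le x
  have := h.2.1
  refine ⟨Nat.sub_le _ _, ?_, fun ht => h.2.2 (of_decide_eq_true ht)⟩
  change (g : ℕ) + (x.tgt - 1 - g) < d
  omega

theorem tgt_toMark {g : Fin d} {l : Letter} (h : Fits g l) :
    (l.toMark g).tgt = g + l.right + 1 := by
  have := h.2.1
  rw [Letter.toMark, Mark.tgt]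
  dsimp only
  split_ifs with h1
  · rfl
  · simp only [Sum.elim_inr]
    omega

theorem isAlpha_toMark {g : Fin d} {l : Letter} (h : Fits g l) :
    (l.toMark g).IsAlpha ↔ l.tag = true := by
  rw [Letter.toMark, Mark.IsAlpha]
  dsimp only
  split_ifs with h1
  · refine iff_of_false (by simp) fun ht => ?_
    have := h.2.2 ht
    omega
  · simp

theorem Fits.markFits {g : Fin d} {l : Letter} (h : Fits g l) : MarkFits g (l.toMark g) := by
  refine ⟨Fin.le_def.2 (Nat.sub_le _ _), ?_, fun ht => h.2.2 ((isAlpha_toMark h).1 ht)⟩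
  rw [tgt_toMark h]
  omega

theorem toLetter_toMark {g : Fin d} {l : Letter} (h : Fits g l) :
    (l.toMark g).toLetter g = l := by
  have h1 := h.1
  ext
  · change (g : ℕ) - (g - l.left) = l.left
    omega
  · change (l.toMark g).tgt - 1 - g = l.right
    rw [tgt_toMark h]
    omega
  · rfl
  · change decide (l.toMark g).IsAlpha = l.tag
    rw [Bool.eq_iff_iff, decide_eq_true_iff, isAlpha_toMark h]

theorem toMark_toLetter {g : Fin d} {x : Mark d} (h : MarkFits g x) :
    (x.toLetter g).toMark g = x := by
  obtain ⟨s, w, k⟩ := x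
  have h1 := Fin.le_def.1 h.1
  have h2 := h.2.1
  refine Prod.ext (Fin.ext ?_) (Prod.ext rfl ?_)
  · change (g : ℕ) - (g - s) = s
    dsimp only at h1
    omega
  · rcases k with t | b
    · have h3 : (g : ℕ) + (t - 1 - g) + 1 = t := by
        change (g : ℕ) < t at h2
        omega
      have h4 : (g : ℕ) + (t - 1 - g) + 1 < d := h3.trans_lt t.2
      change (if h : (g : ℕ) + (t - 1 - g) + 1 < d then Sum.inl ⟨(g : ℕ) + (t - 1 - g) + 1, h⟩
        else _) = Sum.inl t
      rw [dif_pos h4]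
      exact congrArg Sum.inl (Fin.ext h3)
    · have h4 : ¬ (g : ℕ) + (d - 1 - g) + 1 < d := by omega
      change (if h : (g : ℕ) + (d - 1 - g) + 1 < d then _
        else Sum.inr (decide (Sum.inr b = (Sum.inr true : Fin d ⊕ Bool)))) = Sum.inr b
      rw [dif_neg h4]
      cases b <;> simp

theorem key_toLetter (x : Mark d) (g : Fin d) : (x.toLetter g).key = x.key := by
  rw [Letter.key, Mark.key, Mark.toLetter]
  by_cases h : x.IsAlpha <;> simp [h]

theorem reachesEnd_toLetter {g : Fin d} {x : Mark d} (h : MarkFits g x) :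
    ReachesEnd d (g, x.toLetter g) ↔ x.tgt = d := by
  have := h.2.1
  have := tgt_le x
  change (g : ℕ) + (x.tgt - 1 - g) + 1 = d ↔ _
  omega

/-- The configuration of a marking, including the trivial edges. -/
def letters (u : Fin d → List (Mark d)) (g : Fin d) : List Letter :=
  (u g).map fun x => x.toLetter g

/-- The marking with a given configuration. -/
def marksOfLetters (f : Fin d → List Letter) (g : Fin d) : List (Mark d) :=
  (f g).map fun l => l.toMark g

theorem letters_marksOfLetters {f : Fin d → List Letter} (hf : ∀ g, ∀ l ∈ f g, Fits g l) :
    letters (marksOfLetters f) = f := by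
  funext g
  rw [letters, marksOfLetters, List.map_map]
  conv_rhs => rw [← List.map_id (f g)]
  exact List.map_congr_left fun l hl => toLetter_toMark (hf g l hl)

theorem marksOfLetters_letters {u : Fin d → List (Mark d)} (hu : ∀ g, ∀ x ∈ u g, MarkFits g x) :
    marksOfLetters (letters u) = u := by
  funext g
  rw [marksOfLetters, letters, List.map_map]
  conv_rhs => rw [← List.map_id (u g)]
  exact List.map_congr_left fun x hx => toMark_toLetter (hu g x hx)

theorem fits_letters {u : Fin d → List (Mark d)} (hu : ∀ g, ∀ x ∈ u g, MarkFits g x) :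
    ∀ g, ∀ l ∈ letters u g, Fits g l := by
  intro g l hl
  obtain ⟨x, hx, rfl⟩ := List.mem_map.1 hl
  exact (hu g x hx).fits

@[to_additive]
theorem prod_map_marksOf {M : Type*} [CommMonoid M] {u : Fin d → List (Mark d)}
    (hu : ∀ g, ∀ x ∈ u g, MarkFits g x) {F : ℕ × Letter → M} {G : Mark d → M}
    (h : ∀ g x, MarkFits g x → F (g, x.toLetter g) = G x) :
    ((marksOf u).map G).prod = ((entries (List.ofFn (letters u))).map F).prod := by
  rw [prod_entries_ofFn, marksOf]
  have h1 : ∀ s : Finset (Fin d), ((∑ g ∈ s, (u g : Multiset (Mark d))).map G).prod =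
      ∏ g ∈ s, ((letters u g).map fun l => F (g, l)).prod := by
    intro s
    induction s using Finset.induction_on with
    | empty => simp
    | insert g s hg ih =>
      rw [Finset.sum_insert hg, Finset.prod_insert hg, Multiset.map_add, Multiset.prod_add, ih,
        Multiset.map_coe, Multiset.prod_coe, letters, List.map_map]
      congr 2
      exact List.map_congr_left fun x hx => (h g x (hu g x hx)).symm
  exact h1 _

theorem cutflow_marksOf {u : Fin d → List (Mark d)} (hu : ∀ g, ∀ x ∈ u g, MarkFits g x) {h : ℕ} :
    cutflow (marksOf u) h = cutWeight (List.ofFn (letters u)) h := by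
  refine sum_map_marksOf hu fun g x hx => ?_
  have h1 := Fin.le_def.1 hx.1
  have h2 := hx.2.1
  refine if_congr ?_ rfl rfl
  change (g : ℕ) ≤ h + (g - x.1) ∧ h ≤ g + (x.tgt - 1 - g) ↔ _
  omega

theorem count_allEndWeights (V : Multiset (Mark d)) (c : Bool) (w : ℕ+) :
    (allEndWeights V c).count w =
      (V.map fun x => if x.2.2 = Sum.inr c ∧ x.2.1 = w then 1 else 0).sum := by
  induction V using Multiset.induction_on with
  | empty => simp [allEndWeights]
  | cons x V ih =>
    rw [allEndWeights_cons, Multiset.count_add, ih, Multiset.map_cons, Multiset.sum_cons]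
    congr 1
    by_cases h : x.2.2 = Sum.inr c
    · simp [h, Multiset.count_singleton, eq_comm]
    · simp [h]

theorem count_allEndWeights_false {u : Fin d → List (Mark d)}
    (hu : ∀ g, ∀ x ∈ u g, MarkFits g x) (w : ℕ+) :
    (allEndWeights (marksOf u) false).count w = betaCount (List.ofFn (letters u)) w := by
  rw [count_allEndWeights, betaCount, List.length_ofFn]
  refine sum_map_marksOf hu fun g x hx => if_congr ?_ rfl rfl
  rw [reachesEnd_toLetter hx]
  obtain ⟨s, v, t | b⟩ := x
  · simp [Mark.tgt, t.2.ne]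
  · cases b <;> simp [Mark.tgt, Mark.toLetter]

theorem count_allEndWeights_true {u : Fin d → List (Mark d)}
    (hu : ∀ g, ∀ x ∈ u g, MarkFits g x) (w : ℕ+) :
    (allEndWeights (marksOf u) true).count w = alphaCount (List.ofFn (letters u)) w := by
  rw [count_allEndWeights, alphaCount, List.length_ofFn]
  refine sum_map_marksOf hu fun g x hx => if_congr ?_ rfl rfl
  rw [reachesEnd_toLetter hx]
  obtain ⟨s, v, t | b⟩ := x
  · simp [Mark.tgt, t.2.ne]
  · cases b <;> simp [Mark.tgt, Mark.toLetter]

theorem card_edgesOf {u : Fin d → List (Mark d)} (hu : ∀ g, ∀ x ∈ u g, MarkFits g x) :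
    (edgesOf (marksOf u)).card = innerCount (List.ofFn (letters u)) := by
  have h : ∀ V : Multiset (Mark d), (edgesOf V).card =
      (V.map fun x => if x.tgt = d then 0 else 1).sum := by
    intro V
    induction V using Multiset.induction_on with
    | empty => simp [edgesOf]
    | cons x V ih =>
      obtain ⟨s, v, t | b⟩ := x
      · simp [edgesOf_cons_inl, ih, Mark.tgt, t.2.ne, add_comm]
      · simp [edgesOf_cons_inr, ih, Mark.tgt]
  rw [h, innerCount, List.length_ofFn]
  exact sum_map_marksOf hu fun g x hx => if_congr (reachesEnd_toLetter hx) rfl rfl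

theorem prod_edgesOf {u : Fin d → List (Mark d)} (hu : ∀ g, ∀ x ∈ u g, MarkFits g x) :
    ((((edgesOf (marksOf u)).map fun e => (e.2.2 : ℕ) ^ 2).prod : ℕ) : ℚ) =
      innerSqProd (List.ofFn (letters u)) := by
  have h : ∀ V : Multiset (Mark d), ((((edgesOf V).map fun e => (e.2.2 : ℕ) ^ 2).prod : ℕ) : ℚ) =
      (V.map fun x => if x.tgt = d then 1 else ((x.2.1 : ℕ) : ℚ) ^ 2).prod := by
    intro V
    induction V using Multiset.induction_on with
    | empty => simp [edgesOf]
    | cons x V ih =>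
      obtain ⟨s, v, t | b⟩ := x
      · rw [edgesOf_cons_inl, Multiset.map_cons, Multiset.prod_cons, Nat.cast_mul, ih]
        simp [Mark.tgt, t.2.ne]
      · rw [edgesOf_cons_inr, ih]
        simp [Mark.tgt]
  rw [h, innerSqProd, List.length_ofFn]
  exact prod_map_marksOf hu fun g x hx => if_congr (reachesEnd_toLetter hx) rfl rfl

theorem isOrdered_iff {u : Fin d → List (Mark d)} :
    IsOrdered u ↔ (∀ g, ∀ x ∈ u g, MarkFits g x) ∧
      ∀ g, (letters u g).Pairwise fun x y => x.key ≤ y.key := by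
  refine and_congr Iff.rfl (forall_congr' fun g => ?_)
  rw [letters, List.pairwise_map]
  simp only [key_toLetter]

theorem cutflow_last (V : Multiset (Mark d)) {n : ℕ} (hn : n + 1 = d) : cutflow V n = seqDegree (Multiset.toFinsupp (allEndWeights V true)) +
      seqDegree (Multiset.toFinsupp (allEndWeights V false)) := by
  rw [seqDegree_toFinsupp, seqDegree_toFinsupp]
  induction V using Multiset.induction_on with
  | empty => simp [cutflow, allEndWeights]
  | cons x V ih =>
    rw [cutflow, Multiset.map_cons, Multiset.sum_cons, ← cutflow, ih, allEndWeights_cons,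
      allEndWeights_cons]
    have h2 := x.1.2
    have h3 : (x.1 : ℕ) ≤ n := by omega
    obtain ⟨s, v, t | b⟩ := x
    · have h4 : ¬ n < Mark.tgt (s, v, Sum.inl t) := by
        have := t.2
        change ¬ n < (t : ℕ)
        omega
      simp [h4]
    · have h4 : n < Mark.tgt (s, v, (Sum.inr b : Fin d ⊕ Bool)) := by
        change n < d
        omega
      cases b <;> simp [h3, h4] <;> ring

variable {δ : ℕ} {α β : ℕ+ →₀ ℕ}

theorem mem_markings_iff (hd : d = seqDegree α + seqDegree β) {r : Fin d → List Letter}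
    {u : Fin d → List (Mark d)} (hd1 : 1 ≤ d) (hu : ∀ g, ∀ x ∈ u g, MarkFits g x)
    (hr : reduce (letters u) = r) :
    u ∈ markings δ d α β ↔ List.ofFn r ∈ endConfigs δ d ∧
      ∀ g, IsCompletion α β r g (letters u g) := by
  obtain ⟨n, rfl⟩ : ∃ n, d = n + 1 := ⟨d - 1, by omega⟩
  have hfit := fits_letters hu
  have hcost : ∀ h : ∀ i < n, cutWeight (List.ofFn (letters u)) i = i + 1,
      2 * (endCost (List.ofFn r) + (edgesOf (marksOf u)).card) = (n + 1) * n := by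
    intro h
    rw [card_edgesOf hu, ← hr, endCost_reduce]
    exact endCost_add_innerCount (by simp) (closed_ofFn hfit) h
  have hcut : ∀ i : Fin (n + 1), (i : ℕ) + 1 < n + 1 → cutflow (marksOf u) i =
      cutWeight (List.ofFn r) i + (letters u i).count (straight 1 false) := by
    intro i hi
    rw [cutflow_marksOf hu, cutWeight_eq_reduce hfit hi, hr]
  have hα : ∀ w, (allEndWeights (marksOf u) true).count w = alphaCount (List.ofFn r) w +
      (letters u (Fin.last n)).count (straight w true) := fun w => by
    rw [count_allEndWeights_true hu, alphaCount_eq_reduce hfit (h := Fin.last n) rfl, hr]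
  have hβ : ∀ w, (allEndWeights (marksOf u) false).count w = betaCount (List.ofFn r) w +
      (letters u (Fin.last n)).count (straight w false) := fun w => by
    rw [count_allEndWeights_false hu, betaCount_eq_reduce hfit (h := Fin.last n) rfl, hr]
  rw [mem_markings, IsMarking, isOrdered_iff]
  constructor
  · rintro ⟨⟨⟨-, h1⟩, h2, h3, h4⟩, h5⟩
    have h6 := hcost fun i hi => by rw [← cutflow_marksOf hu, h4 i (by omega)]
    rw [mem_endConfigs]
    refine ⟨⟨by simp, ?_, ⟨?_, ?_⟩, ?_⟩, fun g => ⟨h1 g, hfit g, ?_, fun hg => ?_, fun hg w => ?_⟩⟩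
    · rw [← hr]
      exact closed_ofFn fun g l hl => hfit g l (List.mem_of_mem_filter hl)
    · rw [← hr]
      intro x hx
      obtain ⟨g, l, hl, rfl⟩ := mem_entries_ofFn.1 hx
      rw [reduce, List.mem_filter] at hl
      rw [List.length_ofFn]
      exact ⟨(hfit g l hl.1).2.2, by simpa using hl.2⟩
    · intro w hw
      rw [← hr, List.ofFn_succ', List.concat_eq_append, List.getLast?_concat, Option.mem_some_iff] at hw
      subst hw
      exact (h1 _).filter _
    · rw [Nat.add_sub_cancel] at h5
      omega
    · rw [← hr]
      rfl
    · rw [add_comm, ← hcut g hg, h4 g g.2]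
    · obtain rfl : g = Fin.last n := Fin.ext (by simpa using hg)
      have h7 := hα w
      have h8 := hβ w
      rw [← Multiset.toFinsupp_apply, h2] at h7
      rw [← Multiset.toFinsupp_apply, h3] at h8
      omega
  · rintro ⟨hc, h⟩
    have h2 : Multiset.toFinsupp (allEndWeights (marksOf u) true) = α := by
      ext w
      rw [Multiset.toFinsupp_apply, hα, add_comm]
      exact ((h (Fin.last n)).2.2.2.2 rfl w).2
    have h3 : Multiset.toFinsupp (allEndWeights (marksOf u) false) = β := by
      ext w
      rw [Multiset.toFinsupp_apply, hβ, add_comm]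
      exact ((h (Fin.last n)).2.2.2.2 rfl w).1
    have h4 : ∀ g < n + 1, cutflow (marksOf u) g = g + 1 := by
      intro g hg
      by_cases hg' : g + 1 < n + 1
      · have h5 := hcut ⟨g, hg⟩ hg'
        have h6 := (h ⟨g, hg⟩).2.2.2.1 hg'
        dsimp only at h5 h6
        omega
      · obtain rfl : g = n := by omega
        rw [cutflow_last _ rfl, h2, h3, hd]
    refine ⟨⟨⟨hu, fun g => (h g).1⟩, h2, h3, h4⟩, ?_⟩
    have h6 := hcost fun i hi => by rw [← cutflow_marksOf hu, h4 i (by omega)]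
    rw [(mem_endConfigs.1 hc).2.2.2] at h6
    rw [Nat.add_sub_cancel]
    omega

theorem markFits_of_mem_markings {u : Fin d → List (Mark d)} (hu : u ∈ markings δ d α β) :
    ∀ g, ∀ x ∈ u g, MarkFits g x := (mem_markings.1 hu).1.1.1

theorem card_fiber (hd : d = seqDegree α + seqDegree β) (hd1 : 1 ≤ d) {r : Fin d → List Letter}
    (hr : List.ofFn r ∈ endConfigs δ d) :
    #{u ∈ markings δ d α β | List.ofFn (reduce (letters u)) = List.ofFn r} =
      ∏ g, Nat.card {l // IsCompletion α β r g l} := by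
  rw [← Nat.card_pi, ← Nat.card_eq_finsetCard]
  have hmem : ∀ u, u ∈ ({u ∈ markings δ d α β | List.ofFn (reduce (letters u)) = List.ofFn r} :
      Finset (Fin d → List (Mark d))) →
      (∀ g, ∀ x ∈ u g, MarkFits g x) ∧ ∀ g, IsCompletion α β r g (letters u g) := by
    intro u hu
    rw [Finset.mem_filter, List.ofFn_inj] at hu
    have h1 := markFits_of_mem_markings hu.1
    exact ⟨h1, ((mem_markings_iff hd hd1 h1 hu.2).1 hu.1).2⟩
  refine Nat.card_congr (Equiv.ofBijective
    (fun u g => ⟨letters u.1 g, (hmem u.1 u.2).2 g⟩) ⟨fun u u' e => Subtype.ext ?_, fun f => ?_⟩)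
  · have h1 : letters u.1 = letters u'.1 := funext fun g => congrArg Subtype.val (congrFun e g)
    rw [← marksOfLetters_letters (hmem u.1 u.2).1, h1, marksOfLetters_letters (hmem u'.1 u'.2).1]
  · have h1 : ∀ g, ∀ l ∈ (f g).1, Fits g l := fun g => (f g).2.2.1
    have h2 : letters (marksOfLetters fun g => (f g).1) = fun g => (f g).1 :=
      letters_marksOfLetters h1
    have h3 : reduce (letters (marksOfLetters fun g => (f g).1)) = r := by
      rw [h2]
      funext g
      exact (f g).2.2.2.1
    refine ⟨⟨marksOfLetters fun g => (f g).1, ?_⟩, ?_⟩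
    · rw [Finset.mem_filter, h3, mem_markings_iff hd hd1 _ h3]
      · refine ⟨⟨hr, fun g => ?_⟩, rfl⟩
        rw [h2]
        exact (f g).2
      · intro g x hx
        obtain ⟨l, hl, rfl⟩ := List.mem_map.1 hx
        exact (h1 g l hl).markFits
    · funext g
      exact Subtype.ext (congrFun h2 g)

theorem sum_markings (hd : d = seqDegree α + seqDegree β) (hd1 : 1 ≤ d) :
    ((∑ u ∈ markings δ d α β, ((edgesOf (marksOf u)).map fun e => (e.2.2 : ℕ) ^ 2).prod : ℕ) : ℚ) =
      endCount δ d α β := by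
  classical
  rw [Nat.cast_sum, endCount, ← Finset.sum_fiberwise_of_maps_to
    (g := fun u => List.ofFn (reduce (letters u))) (t := endConfigs δ d)]
  · refine Finset.sum_congr rfl fun c hc => ?_
    obtain ⟨r, rfl⟩ : ∃ r : Fin d → List Letter, c = List.ofFn r := by
      have := (mem_endConfigs.1 hc).1
      subst this
      exact ⟨c.get, (List.ofFn_get c).symm⟩
    rw [Finset.sum_congr rfl (g := fun _ => innerSqProd (List.ofFn r)), Finset.sum_const,
      card_fiber hd hd1 hc, nsmul_eq_mul, Nat.cast_prod]
    · obtain ⟨n, rfl⟩ : ∃ n, d = n + 1 := ⟨d - 1, by omega⟩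
      rw [Fin.prod_univ_castSucc, card_isCompletion_of_last hc rfl, endConfigWeight,
        List.length_ofFn, Nat.add_sub_cancel, cutProd, ← Fin.prod_univ_eq_prod_range
          (fun h => gapCount (0 + h + 1) (cutWeight (List.ofFn r) h) (marks (List.ofFn r) h)) n,
        Finset.prod_congr rfl fun (i : Fin n) _ => card_isCompletion_of_lt (g := i.castSucc) hc
          (by simp)]
      simp only [Fin.val_castSucc, zero_add]
      ring
    · intro u hu
      rw [Finset.mem_filter] at hu
      have h1 := markFits_of_mem_markings hu.1
      rw [prod_edgesOf h1, ← innerSqProd_reduce (fits_letters h1), hu.2]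
  · intro u hu
    have h1 := markFits_of_mem_markings hu
    exact ((mem_markings_iff hd hd1 h1 rfl).1 hu).1

theorem relativeSeveriDegree_eq_endCount (h : 1 ≤ seqDegree α + seqDegree β) :
    (relativeSeveriDegree δ α β : ℚ) = (β.prod fun j k => ((j : ℕ) : ℚ) ^ k) *
      endCount δ (seqDegree α + seqDegree β) α β := by
  rw [relativeSeveriDegree_eq, Nat.cast_mul, sum_markings rfl h, Finsupp.prod, Finsupp.prod,
    Nat.cast_prod]
  simp only [Nat.cast_pow]

end Convert

/-! ### Relative node polynomials -/

theorem killCompl_X {σ τ : Type*} {f : σ → τ} (hf : f.Injective) (i : σ) :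
    MvPolynomial.killCompl hf (MvPolynomial.X (R := ℚ) (f i)) = MvPolynomial.X i := by
  rw [← MvPolynomial.rename_X (R := ℚ) f i, MvPolynomial.killCompl_rename_app]

theorem killCompl_X_of_notMem {σ τ : Type*} {f : σ → τ} (hf : f.Injective) {i : τ}
    (hi : i ∉ Set.range f) : MvPolynomial.killCompl hf (MvPolynomial.X (R := ℚ) i) = 0 := by
  rw [MvPolynomial.killCompl, MvPolynomial.aeval_X, dif_neg hi]

theorem eval_killCompl {σ τ : Type*} {f : σ → τ} (hf : f.Injective) {x : σ → ℚ} {y : τ → ℚ}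
    (h : ∀ i, y (f i) = x i) (h0 : ∀ i ∉ Set.range f, y i = 0) (P : MvPolynomial τ ℚ) :
    MvPolynomial.eval x (MvPolynomial.killCompl hf P) = MvPolynomial.eval y P := by
  have : (MvPolynomial.aeval x).comp (MvPolynomial.killCompl (R := ℚ) hf) =
      MvPolynomial.aeval y := by
    refine MvPolynomial.algHom_ext fun i => ?_
    rw [AlgHom.comp_apply]
    by_cases hi : i ∈ Set.range f
    · obtain ⟨i, rfl⟩ := hi
      rw [killCompl_X, MvPolynomial.aeval_X, MvPolynomial.aeval_X, h]
    · rw [killCompl_X_of_notMem hf hi, map_zero, MvPolynomial.aeval_X, h0 i hi]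
  have := DFunLike.congr_fun this P
  simpa [MvPolynomial.aeval_eq_eval] using this

/-- The factor that relates the relative Severi degree to the relative node polynomial. -/
noncomputable def nodeFactor (δ : ℕ) (β : ℕ+ →₀ ℕ) : ℚ :=
  (β.prod fun j k => ((j : ℕ) : ℚ) ^ k) *
    (((β.degree - δ).factorial : ℚ) / β.prod fun _ k => (k.factorial : ℚ))

theorem nodeFactor_ne_zero (δ : ℕ) (β : ℕ+ →₀ ℕ) : nodeFactor δ β ≠ 0 := by
  refine mul_ne_zero ?_ (div_ne_zero (by positivity) ?_)
  · exact Finset.prod_ne_zero_iff.2 fun j _ => pow_ne_zero _ (by positivity)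
  · exact Finset.prod_ne_zero_iff.2 fun j _ => by positivity

theorem isRelativeNodePolynomial_iff {δ m m' : ℕ} {P : MvPolynomial (Fin m ⊕ Fin m') ℚ} :
    IsRelativeNodePolynomial δ m m' P ↔ ∀ (α : Fin m → ℕ) (β : Fin m' → ℕ),
      δ ≤ (toSeq β).degree → (relativeSeveriDegree δ (toSeq α) (toSeq β) : ℚ) =
        nodeFactor δ (toSeq β) *
          MvPolynomial.eval (Sum.elim (fun i => (α i : ℚ)) fun j => (β j : ℚ)) P := by
  refine forall_congr' fun α => forall_congr' fun β => ?_
  rw [nodeFactor, degree_toSeq, toSeq_prod _ _ (by simp), toSeq_prod _ _ (by simp)]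
  simp only [Nat.succPNat_coe, Nat.succ_eq_add_one, Nat.cast_add, Nat.cast_one]

theorem exists_isRelativeNodePolynomial {δ : ℕ} (hδ : 1 ≤ δ) (m : ℕ) {m' : ℕ} (hm' : 1 ≤ m') :
    ∃ P, IsRelativeNodePolynomial δ m m' P := by
  obtain ⟨k, rfl⟩ : ∃ k, m' = k + 1 := ⟨m' - 1, by omega⟩
  obtain ⟨P, hP⟩ := exists_polynomial_endCount_of_le hδ m k
  refine ⟨P, isRelativeNodePolynomial_iff.2 fun α β h => ?_⟩
  have hd : (toSeq β).degree ≤ seqDegree (toSeq β) := by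
    rw [degree_toSeq, seqDegree_toSeq]
    exact Finset.sum_le_sum fun j _ => Nat.le_mul_of_pos_left _ (by omega)
  rw [relativeSeveriDegree_eq_endCount (by omega), hP α β (by rwa [← degree_toSeq]), nodeFactor,
    degree_toSeq, toSeq_prod β (fun _ k => (k.factorial : ℚ)) (by simp), mul_assoc]

theorem IsRelativeNodePolynomial.unique {δ m m' : ℕ} (hm' : 1 ≤ m')
    {P Q : MvPolynomial (Fin m ⊕ Fin m') ℚ} (hP : IsRelativeNodePolynomial δ m m' P)
    (hQ : IsRelativeNodePolynomial δ m m' Q) : P = Q := by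
  rw [isRelativeNodePolynomial_iff] at hP hQ
  refine MvPolynomial.funext_set (fun _ => (fun n : ℕ => (n : ℚ)) '' Set.Ici δ)
    (fun _ => (Set.Ici_infinite δ).image Nat.cast_injective.injOn) fun x hx => ?_
  choose y hy hyx using fun i => hx i trivial
  have hx' : x = Sum.elim (fun i => (y (Sum.inl i) : ℚ)) fun j => (y (Sum.inr j) : ℚ) := by
    funext i
    rcases i with i | j
    exacts [(hyx _).symm, (hyx _).symm]
  have hdeg : δ ≤ (toSeq fun j => y (Sum.inr j)).degree := by
    rw [degree_toSeq]
    exact (hy (Sum.inr ⟨0, hm'⟩)).trans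
      (Finset.single_le_sum (f := fun j => y (Sum.inr j)) (fun _ _ => Nat.zero_le _)
        (Finset.mem_univ _))
  have h1 := hP (fun i => y (Sum.inl i)) _ hdeg
  rw [hQ (fun i => y (Sum.inl i)) _ hdeg] at h1
  rw [hx']
  exact (mul_left_cancel₀ (nodeFactor_ne_zero _ _) h1).symm

theorem isRelativeNodePolynomial_relativeNodePolynomial {δ : ℕ} (hδ : 1 ≤ δ) (m : ℕ) {m' : ℕ}
    (hm' : 1 ≤ m') : IsRelativeNodePolynomial δ m m' (relativeNodePolynomial δ m m') := by
  have h := exists_isRelativeNodePolynomial hδ m hm'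
  rw [relativeNodePolynomial, dif_pos h]
  exact h.choose_spec

/-- The first variables among more variables. -/
def castVariables {m m' M M' : ℕ} (h : m ≤ M) (h' : m' ≤ M') : Fin m ⊕ Fin m' ↪ Fin M ⊕ Fin M' :=
  Function.Embedding.sumMap (Fin.castLEEmb h) (Fin.castLEEmb h')

theorem toSeq_of_le {m : ℕ} (a : Fin m → ℕ) {k : ℕ} (h : m ≤ k) : toSeq a (Nat.succPNat k) = 0 := by
  rw [toSeq_apply]
  refine Finset.sum_eq_zero fun i _ => if_neg fun e => ?_
  have := Nat.succPNat_injective e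
  omega

theorem toSeq_extend {m M : ℕ} (h : m ≤ M) (a : Fin m → ℕ) :
    toSeq (fun i : Fin M => toSeq a (Nat.succPNat i)) = toSeq a := by
  ext j
  obtain ⟨k, rfl⟩ : ∃ k, j = Nat.succPNat k := ⟨j.natPred, (PNat.succPNat_natPred j).symm⟩
  by_cases hk : k < M
  · exact toSeq_succPNat (fun i : Fin M => toSeq a (Nat.succPNat i)) ⟨k, hk⟩
  · rw [toSeq_of_le _ (by omega), toSeq_of_le _ (by omega)]

theorem IsRelativeNodePolynomial.killCompl {δ m m' M M' : ℕ} (h : m ≤ M) (h' : m' ≤ M')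
    {P : MvPolynomial (Fin M ⊕ Fin M') ℚ} (hP : IsRelativeNodePolynomial δ M M' P) :
    IsRelativeNodePolynomial δ m m'
      (MvPolynomial.killCompl (castVariables h h').injective P) := by
  rw [isRelativeNodePolynomial_iff] at hP ⊢
  intro α β hβ
  have h1 := hP (fun i => toSeq α (Nat.succPNat i)) (fun j => toSeq β (Nat.succPNat j))
  rw [toSeq_extend h, toSeq_extend h'] at h1
  rw [h1 hβ]
  congr 1
  symm
  refine eval_killCompl _ ?_ ?_ P
  · rintro (i | j)
    · exact congrArg Nat.cast (toSeq_succPNat α i)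
    · exact congrArg Nat.cast (toSeq_succPNat β j)
  · rintro (i | j) hi
    · have : m ≤ i := by
        by_contra hlt
        exact hi ⟨Sum.inl ⟨i, not_le.1 hlt⟩, rfl⟩
      exact Nat.cast_eq_zero.2 (toSeq_of_le α this)
    · have : m' ≤ j := by
        by_contra hlt
        exact hi ⟨Sum.inr ⟨j, not_le.1 hlt⟩, rfl⟩
      exact Nat.cast_eq_zero.2 (toSeq_of_le β this)

theorem killCompl_relativeNodePolynomial {δ m m' M M' : ℕ} (hδ : 1 ≤ δ) (hm' : 1 ≤ m') (h : m ≤ M)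
    (h' : m' ≤ M') : MvPolynomial.killCompl (castVariables h h').injective
      (relativeNodePolynomial δ M M') = relativeNodePolynomial δ m m' :=
  IsRelativeNodePolynomial.unique hm' (IsRelativeNodePolynomial.killCompl h h'
    (isRelativeNodePolynomial_relativeNodePolynomial hδ M (hm'.trans h')))
    (isRelativeNodePolynomial_relativeNodePolynomial hδ m hm')

theorem setLastAlphaZero_eq (m m' : ℕ) : setLastAlphaZero m m' =
    MvPolynomial.killCompl (castVariables m.le_succ m'.le_refl).injective := by
  refine MvPolynomial.algHom_ext fun i => ?_
  rw [setLastAlphaZero, MvPolynomial.aeval_X]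
  rcases i with i | j
  · cases i using Fin.lastCases with
    | last =>
      rw [killCompl_X_of_notMem, Sum.elim_inl, Fin.snoc_last]
      rintro ⟨i | j, e⟩
      · exact (Fin.castSucc_lt_last i).ne (Sum.inl_injective e)
      · exact Sum.inr_ne_inl e
    | cast i =>
      rw [Sum.elim_inl, Fin.snoc_castSucc]
      exact (killCompl_X _ (Sum.inl i)).symm
  · exact (killCompl_X _ (Sum.inr j)).symm

theorem setLastBetaZero_eq (m m' : ℕ) : setLastBetaZero m m' =
    MvPolynomial.killCompl (castVariables m.le_refl m'.le_succ).injective := by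
  refine MvPolynomial.algHom_ext fun i => ?_
  rw [setLastBetaZero, MvPolynomial.aeval_X]
  rcases i with i | j
  · exact (killCompl_X _ (Sum.inl i)).symm
  · cases j using Fin.lastCases with
    | last =>
      rw [killCompl_X_of_notMem, Sum.elim_inr, Fin.snoc_last]
      rintro ⟨i | j, e⟩
      · exact Sum.inl_ne_inr e
      · exact (Fin.castSucc_lt_last j).ne (Sum.inr_injective e)
    | cast j =>
      rw [Sum.elim_inr, Fin.snoc_castSucc]
      exact (killCompl_X _ (Sum.inr j)).symm

theorem coeff_relativeNodePolynomial {δ m m' M M' : ℕ} (hδ : 1 ≤ δ) (hm' : 1 ≤ m') (h : m ≤ M)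
    (h' : m' ≤ M') (x : Fin m ⊕ Fin m' →₀ ℕ) :
    (relativeNodePolynomial δ m m').coeff x =
      (relativeNodePolynomial δ M M').coeff (x.mapDomain (castVariables h h')) := by
  rw [← killCompl_relativeNodePolynomial hδ hm' h h', MvPolynomial.coeff_killCompl]

theorem mapDomain_castVariables {m m' M M' : ℕ} (h : m ≤ M) (h' : m' ≤ M')
    (x : Fin m ⊕ Fin m' →₀ ℕ) :
    (x.mapDomain (castVariables h h')).mapDomain (initialVariables M M') =
      x.mapDomain (initialVariables m m') := by
  rw [← Finsupp.mapDomain_comp]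
  congr 1
  funext i
  rcases i with i | j <;> rfl

theorem coeff_eq_of_mapDomain_eq {δ m m' n n' : ℕ} (hδ : 1 ≤ δ) (hm' : 1 ≤ m') (hn' : 1 ≤ n')
    {x : Fin m ⊕ Fin m' →₀ ℕ} {y : Fin n ⊕ Fin n' →₀ ℕ}
    (h : x.mapDomain (initialVariables m m') = y.mapDomain (initialVariables n n')) :
    (relativeNodePolynomial δ m m').coeff x = (relativeNodePolynomial δ n n').coeff y := by
  rw [coeff_relativeNodePolynomial hδ hm' (le_max_left m n) (le_max_left m' n'),
    coeff_relativeNodePolynomial hδ hn' (le_max_right m n) (le_max_right m' n')]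
  congr 1
  refine Finsupp.mapDomain_injective (initialVariables _ _).injective ?_
  rw [mapDomain_castVariables, mapDomain_castVariables, h]

open Classical in
/-- The formal power series in infinitely many variables that specializes to the relative node
polynomials. -/
noncomputable def nodeSeries (δ : ℕ) : MvPowerSeries (ℕ+ ⊕ ℕ+) ℚ := fun e =>
  if h : ∃ (m m' : ℕ) (x : Fin m ⊕ Fin m' →₀ ℕ), 1 ≤ m' ∧
      x.mapDomain (initialVariables m m') = e then
    (relativeNodePolynomial δ h.choose h.choose_spec.choose).coeff h.choose_spec.choose_spec.choose
  else 0

theorem killCompl_nodeSeries {δ m m' : ℕ} (hδ : 1 ≤ δ) (hm' : 1 ≤ m') :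
    MvPowerSeries.killCompl (initialVariables m m') (nodeSeries δ) =
      (relativeNodePolynomial δ m m' : MvPowerSeries (Fin m ⊕ Fin m') ℚ) := by
  ext x
  rw [MvPowerSeries.coeff_killCompl, MvPolynomial.coeff_coe, Finsupp.embDomain_eq_mapDomain]
  have h : ∃ (n n' : ℕ) (y : Fin n ⊕ Fin n' →₀ ℕ), 1 ≤ n' ∧
      y.mapDomain (initialVariables n n') = x.mapDomain (initialVariables m m') :=
    ⟨m, m', x, hm', rfl⟩
  have hspec := h.choose_spec.choose_spec.choose_spec
  change nodeSeries δ _ = _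
  rw [nodeSeries, dif_pos h]
  exact coeff_eq_of_mapDomain_eq hδ hspec.1 hm' hspec.2

end RelativeSeveri

open RelativeSeveri in
/-- The relative node polynomials are well defined (first part), stable under appending zeros
(second and third part), and specializations of a single formal power series in
`α₁, α₂, …, β₁, β₂, …` (last part): `MvPowerSeries.killCompl` sets all variables outside
the given ones to zero. -/
theorem theorem1p2 (δ : ℕ) (hδ : 1 ≤ δ) :
    (∀ m m' : ℕ, 1 ≤ m' → ∀ P : MvPolynomial (Fin m ⊕ Fin m') ℚ,
      IsRelativeNodePolynomial δ m m' P ↔ P = relativeNodePolynomial δ m m') ∧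
    (∀ m m' : ℕ, 1 ≤ m' →
      setLastAlphaZero m m' (relativeNodePolynomial δ (m + 1) m') =
        relativeNodePolynomial δ m m') ∧
    (∀ m m' : ℕ, 1 ≤ m' →
      setLastBetaZero m m' (relativeNodePolynomial δ m (m' + 1)) =
        relativeNodePolynomial δ m m') ∧
    ∃ F : MvPowerSeries (ℕ+ ⊕ ℕ+) ℚ, ∀ m m' : ℕ, 1 ≤ m' →
      MvPowerSeries.killCompl (initialVariables m m') F =
        (relativeNodePolynomial δ m m' : MvPowerSeries (Fin m ⊕ Fin m') ℚ) := by
  refine ⟨fun m m' hm' P => ⟨fun hP => ?_, ?_⟩, fun m m' hm' => ?_, fun m m' hm' => ?_,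
    nodeSeries δ, fun m m' => killCompl_nodeSeries hδ⟩
  · exact IsRelativeNodePolynomial.unique hm' hP (isRelativeNodePolynomial_relativeNodePolynomial hδ m hm')
  · rintro rfl
    exact isRelativeNodePolynomial_relativeNodePolynomial hδ m hm'
  · rw [setLastAlphaZero_eq, killCompl_relativeNodePolynomial hδ hm']
  · rw [setLastBetaZero_eq, killCompl_relativeNodePolynomial hδ hm']
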